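/- **Setting.** Let $1\le k<d$ be integers and let $(\Omega,\mathbb P)$ be a probability space. Write $\nu_j$ for $j$-dimensional volume in $\mathbb R^d$, that is, $j$-dimensional Hausdorff measure, normalized so as to be Lebesgue measure on $j$-flats ($\nu_0$ is counting measure), and $|\cdot|=\nu_d$. Let $\mathcal C'_d$ be the space of non-empty compact convex subsets of $\mathbb R^d$ with the Borel $\sigma$-algebra of the Hausdorff metric. A *tessellation* is a family $(C_n)_{n\ge1}$ in $\mathcal C'_d$ whose members (*cells*) have non-empty, pairwise disjoint interiors and cover $\mathbb R^d$, and only finitely many of which meet any given compact set. A *random tessellation* is a sequence of random elements of $\mathcal C'_d$ that is almost surely a tessellation. It is *stationary* (*motion-invariant*) if the law of its point process of cells $\sum_n\delta_{C_n}$ is invariant under translations (under proper rigid motions). For $C\in\mathcal C'_d$ let $C^{(j)}$ be the union of its $j$-faces. For a tessellation $\tau$ let $\tau^{(j)}$ be the union of its $j$-facets, that is, of all $j$-dimensional intersections of finitely many cells. Let $X=(\Xi_n)_{n\ge1}$ be a stationary random tessellation and let $X_0$ be a motion-invariant random tessellation. Let $X_1,X_2,\dots$ be independent copies of $X_0$ such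 that $(X_n)_{n\ge1}$ is independent of $X$ (an *$X/X_0$-nesting*). For $W\in\mathcal C'_d$ put $$Z_k(W)=\sum_{n\ge1}\nu_{k-1}\big(X_n^{(d-1)}\cap\Xi_n^{(k)}\cap W\big).$$ Let $\alpha:\mathcal C'_d\to\mathbb R^d$ be measurable with $\alpha(C)\in C$ and $\alpha(C+x)=\alpha(C)+x$ for all $C\in\mathcal C'_d$ and $x\in\mathbb R^d$. Assume that $\gamma=\mathbb E\,\#\{n:\alpha(\Xi_n)\in[0,1)^d\}$ satisfies $0<\gamma<\infty$. Let $$P^0(B)=\gamma^{-1}\,\mathbb E\,\#\{n:\alpha(\Xi_n)\in[0,1)^d,\ \Xi_n-\alpha(\Xi_n)\in B\}$$ be the Palm mark distribution (the law of the typical cell $\Xi^*$) of $X$. Put $$\mu_k=\mathbb E\,\nu_k\big(X^{(k)}\cap[0,1)^d\big),\qquad \lambda_0^{(k,d)}=\mathbb E\,\nu_{k-1}\big(X_0^{(d-1)}\cap\mathbb R^k\cap[0,1)^k\big),$$ where $\mathbb R^k\subset\mathbb R^d$ is spanned by the first $k$ coordinate directions. Assume *Condition F*: there is a non-random integer $m_k\ge1$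 such that, for every $W\in\mathcal C'_d$ with $|W|>0$, almost surely $$m_k\,\nu_k(X^{(k)}\cap W)=\sum_{n\ge1}\nu_k(\Xi_n^{(k)}\cap W).$$ **Lemma 3.1.** The condition $\mu_k<\infty$ is equivalent to $\mathbb E\,\nu_k(\Xi^{*(k)})=\int\nu_k(C^{(k)})\,P^0(dC)<\infty$. If $\mu_k<\infty$ and $\lambda_0^{(k,d)}<\infty$, then for every $W\in\mathcal C'_d$ $$\mathbb E Z_k(W)=\lambda_0^{(k,d)}\,m_k\,\mu_k\,|W|.$$ If, in addition, $$\mathbb E\,\nu_k^2\big(X^{(k)}\cap[0,1]^d\big)<\infty\quad\text{and}\quad\int\mathbb E\,\nu_{k-1}^2\big(X_0^{(d-1)}\cap C^{(k)}\big)\,P^0(dC)<\infty,$$ then for every $W\in\mathcal C'_d$ the variable $Z_k(W)$ has a finite second moment and $$\operatorname{Var}Z_k(W)=\gamma\int\int_{\mathbb R^d}\operatorname{Var}\Big(\nu_{k-1}\big(X_0^{(d-1)}\cap C^{(k)}\cap(W-x)\big)\Big)\,dx\,P^0(dC)+\big(\lambda_0^{(k,d)}m_k\big)^2\operatorname{Var}\nu_k\big(X^{(k)}\cap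 W\big).$$ -/

import Mathlib

open MeasureTheory ProbabilityTheory Set
open scoped ENNReal

/-- The `d`-dimensional Euclidean space. -/
abbrev Euc (d : ℕ) : Type := EuclideanSpace ℝ (Fin d)

/-- Non-empty compact convex sets carry the Borel σ-algebra of the Hausdorff metric, which is the
trace of the Borel σ-algebra of the Fell topology on closed sets. -/
noncomputable instance convexBodyMeasurableSpace (d : ℕ) : MeasurableSpace (ConvexBody (Euc d)) := borel _

instance convexBodyBorelSpace (d : ℕ) : BorelSpace (ConvexBody (Euc d)) := ⟨rfl⟩

namespace Tess

noncomputable section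

variable {d : ℕ} {Ω : Type*} [MeasurableSpace Ω]

/-! ### Deterministic geometry -/

/-- The image `g C` of a convex body under an isometry `g` of the space. -/
def moveBody (g : Euc d ≃ᵃⁱ[ℝ] Euc d) (C : ConvexBody (Euc d)) : ConvexBody (Euc d) where
  carrier := g '' (C : Set (Euc d))
  convex' := C.convex.affine_image (g.toAffineEquiv : Euc d →ᵃ[ℝ] Euc d)
  isCompact' := C.isCompact.image g.continuous
  nonempty' := C.nonempty.image g

/-- The translate `C + x`. -/
def translate (x : Euc d) (C : ConvexBody (Euc d)) : ConvexBody (Euc d) :=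
  moveBody (AffineIsometryEquiv.constVAdd ℝ (Euc d) x) C

/-- `C` enumerates the cells of a tessellation: the cells have non-empty pairwise disjoint
interiors, cover the space, and every compact set meets only finitely many of them. -/
structure IsTessellation (C : ℕ → ConvexBody (Euc d)) : Prop where
  interior_nonempty : ∀ n, (interior (C n : Set (Euc d))).Nonempty
  interior_disjoint :
    ∀ i j, i ≠ j → Disjoint (interior (C i : Set (Euc d))) (interior (C j : Set (Euc d)))
  covers : (⋃ n, (C n : Set (Euc d))) = univ
  locally_finite : ∀ K : Set (Euc d), IsCompact K → {n | ((C n : Set (Euc d)) ∩ K).Nonempty}.Finite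

/-- `S` is non-empty and its affine hull has dimension `k`. -/
def HasDim (k : ℕ) (S : Set (Euc d)) : Prop :=
  S.Nonempty ∧ Module.finrank ℝ (vectorSpan ℝ S) = k

/-- `F` is a `k`-face of `C`: a `k`-dimensional convex extreme subset of `C`. -/
structure IsFace (k : ℕ) (C F : Set (Euc d)) : Prop where
  convex : Convex ℝ F
  extreme : IsExtreme ℝ C F
  dim : HasDim k F

/-- The union `C^{(k)}` of all `k`-faces of `C`. -/
def faceUnion (k : ℕ) (C : ConvexBody (Euc d)) : Set (Euc d) :=
  ⋃₀ {F | IsFace k (C : Set (Euc d)) F}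

/-- `F` is a `k`-facet of the tessellation `C`: a `k`-dimensional intersection of finitely many
cells. -/
def IsFacet (k : ℕ) (C : ℕ → ConvexBody (Euc d)) (F : Set (Euc d)) : Prop :=
  ∃ I : Finset ℕ, I.Nonempty ∧ F = (⋂ i ∈ I, (C i : Set (Euc d))) ∧ HasDim k F

/-- The union of all `k`-facets of the tessellation `C`. -/
def facetUnion (k : ℕ) (C : ℕ → ConvexBody (Euc d)) : Set (Euc d) :=
  ⋃₀ {F | IsFacet k C F}

/-- The `k`-volume `ν_k` of subsets of the `d`-dimensional space: the `k`-dimensional Hausdorff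
measure, normalized so as to be Lebesgue measure on `k`-dimensional flats (counting measure
for `k = 0`). -/
def vol (k : ℕ) (S : Set (Euc d)) : ℝ≥0∞ := Measure.euclideanHausdorffMeasure k S

/-- `[0,1)^d`. -/
def halfOpenCube (d : ℕ) : Set (Euc d) := {x | ∀ i, x i ∈ Ico (0 : ℝ) 1}

/-- `[0,1]^d`. -/
def closedCube (d : ℕ) : Set (Euc d) := {x | ∀ i, x i ∈ Icc (0 : ℝ) 1}

/-- `[0,1)^k`, seen in the `d`-dimensional space through the flat spanned by the first `k`
coordinate directions. -/
def halfOpenSubcube (d k : ℕ) : Set (Euc d) :=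
  {x | ∀ i : Fin d, if (i : ℕ) < k then x i ∈ Ico (0 : ℝ) 1 else x i = 0}

/-- An associated point: a measurable, translation equivariant selection `α(C) ∈ C`. -/
structure IsAssociatedPoint (α : ConvexBody (Euc d) → Euc d) : Prop where
  measurable : Measurable α
  mem : ∀ C, α C ∈ C
  translate : ∀ x C, α (translate x C) = α C + x

/-- The centred body `C - α(C)`. -/
def centred (α : ConvexBody (Euc d) → Euc d) (C : ConvexBody (Euc d)) : ConvexBody (Euc d) :=
  translate (-α C) C

/-! ### Random tessellations -/

/-- The point process `∑ₙ δ_{Cₙ}` of cells; it forgets the enumeration of the cells. -/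
def cellMeasure (C : ℕ → ConvexBody (Euc d)) : Measure (ConvexBody (Euc d)) :=
  Measure.sum fun n => Measure.dirac (C n)

/-- A random tessellation: a sequence of random convex bodies which is almost surely a
tessellation. -/
structure IsRandomTessellation (P : Measure Ω) (X : ℕ → Ω → ConvexBody (Euc d)) : Prop where
  measurable : ∀ n, Measurable (X n)
  ae_tessellation : ∀ᵐ ω ∂P, IsTessellation fun n => X n ω

/-- The law of the point process of cells is invariant under all translations. -/
def IsStationary (P : Measure Ω) (X : ℕ → Ω → ConvexBody (Euc d)) : Prop :=
  ∀ x : Euc d, IdentDistrib (fun ω => cellMeasure fun n => translate x (X n ω))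
    (fun ω => cellMeasure fun n => X n ω) P P

/-- The law of the point process of cells is invariant under all proper rigid motions. -/
def IsMotionInvariant (P : Measure Ω) (X : ℕ → Ω → ConvexBody (Euc d)) : Prop :=
  ∀ g : Euc d ≃ᵃⁱ[ℝ] Euc d,
    LinearMap.det (g.linearIsometryEquiv.toLinearEquiv : Euc d →ₗ[ℝ] Euc d) = 1 →
    IdentDistrib (fun ω => cellMeasure fun n => moveBody g (X n ω))
      (fun ω => cellMeasure fun n => X n ω) P P

/-- `X` is the initial tessellation, `X₀` the generic component tessellation, and `Y n` the
component tessellation of the `n`-th cell of `X`: the `Y n` are independent copies of `X₀`, and the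
sequence `(Y n)` is independent of `X`. -/
structure IsNesting (P : Measure Ω) (X X₀ : ℕ → Ω → ConvexBody (Euc d))
    (Y : ℕ → ℕ → Ω → ConvexBody (Euc d)) : Prop where
  initial : IsRandomTessellation P X
  generic : IsRandomTessellation P X₀
  component : ∀ n, IsRandomTessellation P (Y n)
  copies : ∀ n, IdentDistrib (fun ω => cellMeasure fun l => Y n l ω)
    (fun ω => cellMeasure fun l => X₀ l ω) P P
  independent : iIndepFun (fun n ω => cellMeasure fun l => Y n l ω) P
  independent_initial : IndepFun (fun ω n => X n ω) (fun ω n => cellMeasure fun l => Y n l ω) P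

/-- The cell intensity `γ`: the mean number of associated points of cells in `[0,1)^d`. -/
def cellIntensity (P : Measure Ω) (X : ℕ → Ω → ConvexBody (Euc d))
    (α : ConvexBody (Euc d) → Euc d) : ℝ≥0∞ :=
  ∫⁻ ω, Measure.count {n : ℕ | α (X n ω) ∈ halfOpenCube d} ∂P

/-- The Palm mark distribution `P⁰` of `X` (the law of the typical cell): `P⁰(B)` is `γ⁻¹` times
the mean number of cells with associated point in `[0,1)^d` and centred version in `B`. -/
def palmMark (P : Measure Ω) (X : ℕ → Ω → ConvexBody (Euc d))
    (α : ConvexBody (Euc d) → Euc d) : Measure (ConvexBody (Euc d)) :=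
  (cellIntensity P X α)⁻¹ • Measure.sum fun n =>
    (P.restrict {ω | α (X n ω) ∈ halfOpenCube d}).map fun ω => centred α (X n ω)

/-- `μ_k`, the mean `k`-volume of the `k`-facets of `X` in `[0,1)^d`. -/
def facetIntensity (P : Measure Ω) (X : ℕ → Ω → ConvexBody (Euc d)) (k : ℕ) : ℝ≥0∞ :=
  ∫⁻ ω, vol k (facetUnion k (fun n => X n ω) ∩ halfOpenCube d) ∂P

/-- `λ₀^{(k,d)}`, the mean `(k-1)`-volume of the intersection of the `(d-1)`-facets of `X₀` with
the cube `[0,1)^k` in a `k`-flat (used for `1 ≤ k < d`). -/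
def sectionIntensity (P : Measure Ω) (X₀ : ℕ → Ω → ConvexBody (Euc d)) (k : ℕ) : ℝ≥0∞ :=
  ∫⁻ ω, vol (k - 1) (facetUnion (d - 1) (fun n => X₀ n ω) ∩ halfOpenSubcube d k) ∂P

/-- Condition F in dimension `k`, with multiplicity `m`. -/
def ConditionF (P : Measure Ω) (X : ℕ → Ω → ConvexBody (Euc d)) (k m : ℕ) : Prop :=
  1 ≤ m ∧ ∀ W : ConvexBody (Euc d), 0 < volume (W : Set (Euc d)) →
    ∀ᵐ ω ∂P, (m : ℝ≥0∞) * vol k (facetUnion k (fun n => X n ω) ∩ W) =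
      ∑' n, vol k (faceUnion k (X n ω) ∩ W)

/-- `Z_k(W)`: the total `(k-1)`-volume in `W` of the intersections of the `k`-faces of the `n`-th
cell of `X` with the `(d-1)`-facets of the `n`-th component tessellation (used for `1 ≤ k < d`). -/
def Z (X : ℕ → Ω → ConvexBody (Euc d)) (Y : ℕ → ℕ → Ω → ConvexBody (Euc d)) (k : ℕ)
    (W : Set (Euc d)) (ω : Ω) : ℝ≥0∞ :=
  ∑' n, vol (k - 1) (facetUnion (d - 1) (fun l => Y n l ω) ∩ faceUnion k (X n ω) ∩ W)

/-- The variance, with values in `[0,∞]`, of an almost surely finite `[0,∞]`-valued random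
variable. -/
def var (P : Measure Ω) (f : Ω → ℝ≥0∞) : ℝ≥0∞ := evariance (fun ω => (f ω).toReal) P

end

end Tess

/-!
# Mean and variance of the section content of a nested tessellation

Given the initial tessellation, `Z` is a sum of independent terms, one for each cell: the content of
the section of the `k`-faces of the cell with an independent copy of the motion-invariant
tessellation `X₀`. Hence the mean of `Z` is that of the sum of the conditional means, and its second
moment is the second moment of the sum of the conditional means plus the mean of the sum of the
conditional variances (`lintegral_tsum_mark_sq`).

The conditional mean for a cell `C` is `λ₀ ν_k(C^{(k)} ∩ W)`, with `λ₀` the section intensity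
(`IsInvariantLaw.meanVol_skeleton`): for a convex body in the flat of the first `k` coordinates, a
symmetric Fubini argument with a cube shows that the mean section is proportional to the volume;
proper rigid motions carry every body of dimension at most `k < d` into this flat, and
inclusion-exclusion gives finite unions. So the sum of the conditional means is `λ₀` times the total
face content of the cells in `W`, which is `λ₀ m ν_k(X^{(k)} ∩ W)` by Condition F. This yields the
second summand of the variance.

Campbell's theorem (`campbell`) turns the mean of a sum over the cells into an integral over the
typical cell and its translates. It gives the mean of the face content (`lintegral_cellContent`), so
the equivalence of the two finiteness conditions, and the first summand of the variance.
Condition F is only given for bodies of positive volume; for the others, both of its sides vanish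
almost surely, as parallel bodies show (`ConditionF.ae_eq_of_facetIntensity_lt_top`).

The remaining work is measurability and geometry. The Hausdorff measure of a random compact set is
measurable (`measurable_hausdorffMeasure_of_compact`). The cells of a tessellation are polytopes,
and the union of the `k`-faces of a polytope is replaced by the closed set `skeleton k C`, which
contains in addition at most points of lower-dimensional faces. These do not contribute, by the mean
section formula. The union of the `(d-1)`-facets of a tessellation is the complement of the union of
the interiors of the cells (`IsTessellation.facetUnion_eq`), so it is determined by a countable
family of events, the `code` of the point process of cells, whose law inherits the motion
invariance.
-/

namespace Tess

open Filter Topology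

/-! ### Measurability of the Hausdorff measure of a random compact set -/

section HausdorffMeasurability

lemma exists_thickening_diam_rpow_le {E : Type*} [MetricSpace E] {s : ℝ} (hs : 0 ≤ s)
    (A : Set E) (hA : Metric.ediam A ≠ ∞) {r ε : ℝ≥0∞} (hr : Metric.ediam A < r) (hε : ε ≠ 0) :
    ∃ δ : ℝ, 0 < δ ∧ Metric.ediam (Metric.thickening δ A) ≤ r ∧
      Metric.ediam (Metric.thickening δ A) ^ s ≤ Metric.ediam A ^ s + ε := by
  have hcont : Tendsto (fun δ : NNReal => Metric.ediam A + 2 * (δ : ℝ≥0∞)) (𝓝[>] 0)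
      (𝓝 (Metric.ediam A)) := by
    have h : Continuous fun δ : NNReal => Metric.ediam A + 2 * (δ : ℝ≥0∞) := by
      have : Continuous fun δ : NNReal => 2 * (δ : ℝ≥0∞) :=
        (ENNReal.continuous_const_mul (by simp)).comp ENNReal.continuous_coe
      fun_prop
    have := h.tendsto 0
    simp only [ENNReal.coe_zero, mul_zero, add_zero] at this
    exact this.mono_left nhdsWithin_le_nhds
  have hcont2 : Tendsto (fun δ : NNReal => (Metric.ediam A + 2 * (δ : ℝ≥0∞)) ^ s) (𝓝[>] 0)
      (𝓝 (Metric.ediam A ^ s)) := ((ENNReal.continuous_rpow_const (y := s)).tendsto _).comp hcont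
  have h1 : ∀ᶠ δ : NNReal in 𝓝[>] 0, Metric.ediam A + 2 * (δ : ℝ≥0∞) < r :=
    hcont.eventually (gt_mem_nhds hr)
  have hfin : Metric.ediam A ^ s ≠ ∞ := ENNReal.rpow_ne_top_of_nonneg hs hA
  have h2 : ∀ᶠ δ : NNReal in 𝓝[>] 0, (Metric.ediam A + 2 * (δ : ℝ≥0∞)) ^ s
      < Metric.ediam A ^ s + ε :=
    hcont2.eventually (gt_mem_nhds (ENNReal.lt_add_right hfin hε))
  obtain ⟨δ, ⟨h1, h2⟩, h3⟩ := ((h1.and h2).and self_mem_nhdsWithin).exists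
  have hle := Metric.ediam_thickening_le (s := A) δ
  exact ⟨δ, by exact_mod_cast h3, hle.trans h1.le, (ENNReal.rpow_le_rpow hle hs).trans h2.le⟩

variable {E : Type*} [MetricSpace E] [SecondCountableTopology E]

/-- The open set that is the union of a finite family of members of the countable basis. -/
def basicUnion (s : Finset (TopologicalSpace.countableBasis E)) : Set E :=
  ⋃ u ∈ s, (u : Set E)

lemma isOpen_basicUnion (s : Finset (TopologicalSpace.countableBasis E)) :
    IsOpen (basicUnion s) :=
  isOpen_biUnion fun u _ => TopologicalSpace.isOpen_of_mem_countableBasis u.2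

lemma exists_basicUnion_between {K U : Set E} (hK : IsCompact K) (hU : IsOpen U) (hKU : K ⊆ U) :
    ∃ s : Finset (TopologicalSpace.countableBasis E), K ⊆ basicUnion s ∧ basicUnion s ⊆ U := by
  have hcov : K ⊆ ⋃ u : {u : TopologicalSpace.countableBasis E // (u : Set E) ⊆ U},
      ((u : TopologicalSpace.countableBasis E) : Set E) := by
    intro x hx
    obtain ⟨u, hu, hxu, huU⟩ := (TopologicalSpace.isBasis_countableBasis E).exists_subset_of_mem_open
      (hKU hx) hU
    exact mem_iUnion.2 ⟨⟨⟨u, hu⟩, huU⟩, hxu⟩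
  obtain ⟨t, ht⟩ := hK.elim_finite_subcover _
    (fun u => TopologicalSpace.isOpen_of_mem_countableBasis u.1.2) hcov
  classical
  refine ⟨t.image Subtype.val, fun x hx => ?_, ?_⟩
  · obtain ⟨u, hu, hxu⟩ := mem_iUnion₂.1 (ht hx)
    exact mem_iUnion₂.2 ⟨u.1, Finset.mem_image_of_mem _ hu, hxu⟩
  · refine iUnion₂_subset fun u hu => ?_
    obtain ⟨v, -, rfl⟩ := Finset.mem_image.1 hu
    exact v.2

/-- The infimum of `∑ diam ^ s` over the finite covers of `K` by basic open sets of diameter at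
most `1 / (n + 1)`. -/
noncomputable def hausdorffPremeasure (s : ℝ) (n : ℕ) (K : Set E) : ℝ≥0∞ :=
  ⨅ J : {J : Finset (Finset (TopologicalSpace.countableBasis E)) //
      ∀ V ∈ J, Metric.ediam (basicUnion V) ≤ ((n : ℝ≥0∞) + 1)⁻¹},
    ⨅ _ : K ⊆ ⋃ V ∈ J.1, basicUnion V, ∑ V ∈ J.1, Metric.ediam (basicUnion V) ^ s

lemma hausdorffPremeasure_le [MeasurableSpace E] [BorelSpace E] {s : ℝ} (hs : 0 ≤ s) (n : ℕ)
    {K : Set E} (hK : IsCompact K) : hausdorffPremeasure s n K ≤ μH[s] K := by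
  classical
  set r : ℝ≥0∞ := ((n : ℝ≥0∞) + 1)⁻¹ with hr
  have hr0 : r ≠ 0 := by simp [hr]
  have hrtop : r ≠ ∞ := by simp [hr]
  rw [Measure.hausdorffMeasure_apply]
  refine le_trans ?_ (le_iSup₂ (f := fun (r : ℝ≥0∞) (_ : 0 < r) =>
        ⨅ (t : ℕ → Set E) (_ : K ⊆ ⋃ n, t n) (_ : ∀ n, Metric.ediam (t n) ≤ r),
          ∑' n, ⨆ _ : (t n).Nonempty, Metric.ediam (t n) ^ s) (r / 2) (by simpa using hr0))
  refine le_iInf fun t => le_iInf fun ht => le_iInf fun hd => ?_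
  refine ENNReal.le_of_forall_pos_le_add fun ε hε _ => ?_
  obtain ⟨ε', hε', hsum⟩ := ENNReal.exists_pos_sum_of_countable' (ε := (ε : ℝ≥0∞))
    (by exact_mod_cast hε.ne') ℕ
  have hlt : ∀ i, Metric.ediam (t i) < r := fun i =>
    (hd i).trans_lt (ENNReal.half_lt_self hr0 hrtop)
  choose δ hδ hδr hδε using fun i => exists_thickening_diam_rpow_le hs (t i)
    ((hlt i).trans_le le_top).ne (hlt i) (hε' i).ne'
  -- The covering sets need not be compact, so their closures are cut with `K` before being
  -- enclosed in basic open sets.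
  have hV : ∀ i, ∃ V : Finset (TopologicalSpace.countableBasis E),
      K ∩ closure (t i) ⊆ basicUnion V ∧ basicUnion V ⊆ Metric.thickening (δ i) (t i) := fun i =>
    exists_basicUnion_between (hK.inter_right isClosed_closure) Metric.isOpen_thickening
      (inter_subset_right.trans (Metric.closure_subset_thickening (hδ i) _))
  choose V hKV hVδ using hV
  have hcov : K ⊆ ⋃ i, basicUnion (V i) := fun x hx => by
    obtain ⟨i, hi⟩ := mem_iUnion.1 (ht hx)
    exact mem_iUnion.2 ⟨i, hKV i ⟨hx, subset_closure hi⟩⟩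
  obtain ⟨I, hI⟩ := hK.elim_finite_subcover _ (fun i => isOpen_basicUnion (V i)) hcov
  set I' := I.filter fun i => (t i).Nonempty with hI'
  have hcov' : K ⊆ ⋃ W ∈ I'.image V, basicUnion W := fun x hx => by
    obtain ⟨i, hi, hxi⟩ := mem_iUnion₂.1 (hI hx)
    refine mem_iUnion₂.2 ⟨V i, Finset.mem_image_of_mem _ (Finset.mem_filter.2 ⟨hi, ?_⟩), hxi⟩
    obtain ⟨y, hy, -⟩ := Metric.mem_thickening_iff.1 (hVδ i hxi)
    exact ⟨y, hy⟩
  have hdiam : ∀ W ∈ I'.image V, Metric.ediam (basicUnion W) ≤ r := fun W hW => by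
    obtain ⟨i, -, rfl⟩ := Finset.mem_image.1 hW
    exact (Metric.ediam_mono (hVδ i)).trans (hδr i)
  refine (iInf₂_le_of_le ⟨I'.image V, hdiam⟩ hcov' le_rfl).trans ?_
  calc ∑ W ∈ I'.image V, Metric.ediam (basicUnion W) ^ s
      ≤ ∑ i ∈ I', Metric.ediam (basicUnion (V i)) ^ s :=
        Finset.sum_image_le_of_nonneg (fun _ _ => zero_le)
    _ ≤ ∑ i ∈ I', ((⨆ _ : (t i).Nonempty, Metric.ediam (t i) ^ s) + ε' i) := by
        refine Finset.sum_le_sum fun i hi => ?_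
        rw [iSup_pos (Finset.mem_filter.1 hi).2]
        exact (ENNReal.rpow_le_rpow (Metric.ediam_mono (hVδ i)) hs).trans (hδε i)
    _ ≤ ∑' i, ((⨆ _ : (t i).Nonempty, Metric.ediam (t i) ^ s) + ε' i) := ENNReal.sum_le_tsum _
    _ = (∑' i, ⨆ _ : (t i).Nonempty, Metric.ediam (t i) ^ s) + ∑' i, ε' i := ENNReal.tsum_add
    _ ≤ _ := by gcongr

lemma hausdorffMeasure_le_iSup_premeasure [MeasurableSpace E] [BorelSpace E] {s : ℝ} (K : Set E) :
    μH[s] K ≤ ⨆ n, hausdorffPremeasure s n K := by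
  by_cases htop : (⨆ n, hausdorffPremeasure s n K) = ∞
  · rw [htop]; exact le_top
  set c := ⨆ n, hausdorffPremeasure s n K
  set r : ℕ → ℝ≥0∞ := fun n => ((n : ℝ≥0∞) + 1)⁻¹ with hr
  have hr0 : Tendsto r atTop (𝓝 0) := by
    have := (tendsto_add_atTop_iff_nat 1).2 ENNReal.tendsto_inv_nat_nhds_zero
    simpa [hr] using this
  have hlt : ∀ n, hausdorffPremeasure s n K < c + r n := fun n =>
    (le_iSup (fun n => hausdorffPremeasure s n K) n).trans_lt
      (ENNReal.lt_add_right htop (by simp [hr]))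
  have hJ : ∀ n, ∃ J : Finset (Finset (TopologicalSpace.countableBasis E)),
      (∀ V ∈ J, Metric.ediam (basicUnion V) ≤ r n) ∧ K ⊆ (⋃ V ∈ J, basicUnion V) ∧
      ∑ V ∈ J, Metric.ediam (basicUnion V) ^ s < c + r n := fun n => by
    obtain ⟨J, hJ⟩ := iInf_lt_iff.1 (hlt n)
    obtain ⟨h, hJ⟩ := iInf_lt_iff.1 hJ
    exact ⟨J.1, J.2, h, hJ⟩
  choose J hJd hJc hJs using hJ
  refine (Measure.hausdorffMeasure_le_liminf_sum (ι := fun n => {V // V ∈ J n}) s K r hr0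
    (fun n V => basicUnion V.1) (Eventually.of_forall fun n V => hJd n _ V.2)
    (Eventually.of_forall fun n => ?_)).trans ?_
  · intro x hx
    obtain ⟨V, hV, hxV⟩ := mem_iUnion₂.1 (hJc n hx)
    exact mem_iUnion.2 ⟨⟨V, hV⟩, hxV⟩
  · have hle : ∀ n, ∑ V : {V // V ∈ J n}, Metric.ediam (basicUnion V.1) ^ s ≤ c + r n := fun n => by
      rw [Finset.sum_coe_sort (J n) fun V => Metric.ediam (basicUnion V) ^ s]
      exact (hJs n).le
    have hlim : Tendsto (fun n => c + r n) atTop (𝓝 c) := by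
      simpa using tendsto_const_nhds.add hr0
    rw [← hlim.liminf_eq]
    exact liminf_le_liminf (Eventually.of_forall hle)

/-- A compact-set-valued map whose upper inverse images of open sets are measurable has a
measurable Hausdorff measure: it is a countable supremum of countable infima over finite open
covers. -/
theorem measurable_hausdorffMeasure_of_compact [MeasurableSpace E] [BorelSpace E]
    {p : Type*} [MeasurableSpace p] {s : ℝ} (hs : 0 ≤ s)
    {K : p → Set E} (hK : ∀ a, IsCompact (K a))
    (hmeas : ∀ U : Set E, IsOpen U → MeasurableSet {a | K a ⊆ U}) :
    Measurable fun a => μH[s] (K a) := by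
  have h : (fun a => μH[s] (K a)) = fun a => ⨆ n, hausdorffPremeasure s n (K a) := by
    funext a
    exact le_antisymm (hausdorffMeasure_le_iSup_premeasure _)
      (iSup_le fun n => hausdorffPremeasure_le hs n (hK a))
  rw [h]
  refine Measurable.iSup fun n => Measurable.iInf fun J => ?_
  have : MeasurableSet {a | K a ⊆ ⋃ V ∈ J.1, basicUnion V} :=
    hmeas _ (isOpen_biUnion fun V _ => isOpen_basicUnion V)
  classical
  have h' : (fun a => ⨅ _ : K a ⊆ ⋃ V ∈ J.1, basicUnion V,
        ∑ V ∈ J.1, Metric.ediam (basicUnion V) ^ s) =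
      {a | K a ⊆ ⋃ V ∈ J.1, basicUnion V}.piecewise
        (fun _ => ∑ V ∈ J.1, Metric.ediam (basicUnion V) ^ s) (fun _ => ∞) := by
    funext a
    by_cases ha : K a ⊆ ⋃ V ∈ J.1, basicUnion V <;> simp [Set.piecewise, ha]
  rw [h']
  exact Measurable.piecewise this measurable_const measurable_const

end HausdorffMeasurability

theorem measurable_vol_of_compact {d : ℕ} {p : Type*} [MeasurableSpace p] (k : ℕ)
    {K : p → Set (Euc d)} (hK : ∀ a, IsCompact (K a))
    (hmeas : ∀ U : Set (Euc d), IsOpen U → MeasurableSet {a | K a ⊆ U}) :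
    Measurable fun a => vol k (K a) := by
  have h := measurable_hausdorffMeasure_of_compact (s := k) (Nat.cast_nonneg k) hK hmeas
  simp only [vol, Measure.euclideanHausdorffMeasure_def, Measure.smul_apply]
  exact h.const_smul _

/-! ### The space of convex bodies -/

section Bodies

variable {d : ℕ}

/-- A convex body, seen as a non-empty compact set. -/
def toNonemptyCompacts (C : ConvexBody (Euc d)) : TopologicalSpace.NonemptyCompacts (Euc d) :=
  ⟨⟨C, C.isCompact⟩, C.nonempty⟩

lemma isometry_toNonemptyCompacts : Isometry (toNonemptyCompacts (d := d)) :=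
  fun C C' => ConvexBody.hausdorffEDist_coe C C'

instance secondCountable_convexBody : SecondCountableTopology (ConvexBody (Euc d)) :=
  isometry_toNonemptyCompacts.isEmbedding.secondCountableTopology

lemma infDist_body_le (C C' : ConvexBody (Euc d)) (x x' : Euc d) :
    Metric.infDist x (C : Set (Euc d)) ≤ Metric.infDist x' (C' : Set (Euc d)) +
      (dist C C' + dist x x') := by
  have h1 := Metric.infDist_le_infDist_add_hausdorffDist (x := x)
    (ConvexBody.hausdorffEDist_ne_top (K := C') (L := C))
  have h2 := Metric.infDist_le_infDist_add_dist (s := (C' : Set (Euc d))) (x := x) (y := x')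
  rw [ConvexBody.hausdorffDist_coe, dist_comm] at h1
  linarith

lemma isClosed_mem_body : IsClosed {p : ConvexBody (Euc d) × Euc d | p.2 ∈ p.1} := by
  have h : {p : ConvexBody (Euc d) × Euc d | p.2 ∈ p.1} =
      {p | Metric.infDist p.2 (p.1 : Set (Euc d)) = 0} := by
    ext p
    exact p.1.isClosed.mem_iff_infDist_zero p.1.nonempty
  rw [h]
  refine isClosed_eq ?_ continuous_const
  refine (LipschitzWith.of_le_add_mul 2 fun p q => ?_).continuous
  have h1 := infDist_body_le p.1 q.1 p.2 q.2
  have h2 : dist p.1 q.1 ≤ dist p q := le_max_left _ _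
  have h3 : dist p.2 q.2 ≤ dist p q := le_max_right _ _
  push_cast
  linarith

lemma isClosed_mem_body_left (x : Euc d) : IsClosed {C : ConvexBody (Euc d) | x ∈ C} :=
  isClosed_mem_body.preimage (f := fun C => (C, x)) (by fun_prop)

@[simp] lemma coe_moveBody (g : Euc d ≃ᵃⁱ[ℝ] Euc d) (C : ConvexBody (Euc d)) :
    (moveBody g C : Set (Euc d)) = g '' C := rfl

@[simp] lemma coe_translate (x : Euc d) (C : ConvexBody (Euc d)) :
    (translate x C : Set (Euc d)) = (fun y => x + y) '' C := rfl

lemma isometry_moveBody (g : Euc d ≃ᵃⁱ[ℝ] Euc d) : Isometry (moveBody g) :=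
  Isometry.of_dist_eq fun _ _ => Metric.hausdorffDist_image g.isometry

lemma dist_translate_le (x y : Euc d) (C : ConvexBody (Euc d)) :
    dist (translate x C) (translate y C) ≤ dist x y := by
  refine Metric.hausdorffDist_le_of_mem_dist dist_nonneg ?_ ?_
  · rintro _ ⟨z, hz, rfl⟩
    exact ⟨y + z, ⟨z, hz, rfl⟩, by simp⟩
  · rintro _ ⟨z, hz, rfl⟩
    exact ⟨x + z, ⟨z, hz, rfl⟩, by simp [dist_comm]⟩

lemma continuous_translate :
    Continuous fun p : Euc d × ConvexBody (Euc d) => translate p.1 p.2 := by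
  refine (LipschitzWith.of_dist_le_mul (K := 2) fun p q => ?_).continuous
  have h1 := dist_translate_le p.1 q.1 p.2
  have h2 : dist (translate q.1 p.2) (translate q.1 q.2) = dist p.2 q.2 :=
    (isometry_moveBody _).dist_eq _ _
  have h3 := dist_triangle (translate p.1 p.2) (translate q.1 p.2) (translate q.1 q.2)
  have h4 : dist p.1 q.1 ≤ dist p q := le_max_left _ _
  have h5 : dist p.2 q.2 ≤ dist p q := le_max_right _ _
  push_cast
  linarith

lemma translate_translate (x y : Euc d) (C : ConvexBody (Euc d)) :
    translate x (translate y C) = translate (x + y) C := by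
  apply ConvexBody.ext
  simp only [coe_translate, image_image, add_assoc]

lemma translate_zero (C : ConvexBody (Euc d)) : translate 0 C = C := by
  apply ConvexBody.ext
  simp

lemma mem_translate {x y : Euc d} {C : ConvexBody (Euc d)} : y ∈ translate x C ↔ y - x ∈ C := by
  change y ∈ (translate x C : Set (Euc d)) ↔ _
  rw [coe_translate]
  constructor
  · rintro ⟨z, hz, rfl⟩
    simpa using hz
  · intro h
    exact ⟨y - x, h, by simp⟩

lemma coe_translate_neg (x : Euc d) (W : ConvexBody (Euc d)) :
    (translate (-x) W : Set (Euc d)) = {y | y + x ∈ W} := by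
  ext y
  change y ∈ translate (-x) W ↔ _
  rw [mem_translate]
  simp

end Bodies

/-! ### Measurability of projections along the Euclidean space -/

section Projection

variable {A E : Type*} [TopologicalSpace A] [TopologicalSpace E]

lemma isClosed_exists_mem_compact {S : Set (A × E)} (hS : IsClosed S) {K : Set E}
    (hK : IsCompact K) : IsClosed {a | ∃ x ∈ K, (a, x) ∈ S} := by
  have : CompactSpace K := isCompact_iff_compactSpace.1 hK
  have h : {a | ∃ x ∈ K, (a, x) ∈ S} =
      Prod.fst '' ((fun p : A × K => (p.1, (p.2 : E))) ⁻¹' S) := by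
    ext a
    constructor
    · rintro ⟨x, hx, h⟩
      exact ⟨(a, ⟨x, hx⟩), h, rfl⟩
    · rintro ⟨⟨a', x⟩, h, rfl⟩
      exact ⟨x, x.2, h⟩
  rw [h]
  exact isClosedMap_fst_of_compactSpace _ (hS.preimage (by fun_prop))

/-- The projection of the intersection of a closed and an open set along a `σ`-compact space is an
`F_σ` set. -/
lemma measurableSet_exists_closed_open [TopologicalSpace.PseudoMetrizableSpace A]
    [TopologicalSpace.PseudoMetrizableSpace E] [SigmaCompactSpace E] [MeasurableSpace A]
    [OpensMeasurableSpace A] {S U : Set (A × E)} (hS : IsClosed S) (hU : IsOpen U) :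
    MeasurableSet {a | ∃ x, (a, x) ∈ S ∧ (a, x) ∈ U} := by
  obtain ⟨F, hF, -, hFU, -⟩ :
      ∃ F : ℕ → Set (A × E), (∀ n, IsClosed (F n)) ∧ (∀ n, F n ⊆ U) ∧ ⋃ n, F n = U ∧
        Monotone F := by
    let := TopologicalSpace.pseudoMetrizableSpacePseudoMetric (A × E)
    exact hU.exists_iUnion_isClosed
  have h : {a | ∃ x, (a, x) ∈ S ∧ (a, x) ∈ U} =
      ⋃ n : ℕ, ⋃ R : ℕ, {a | ∃ x ∈ compactCovering E R, (a, x) ∈ S ∩ F n} := by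
    ext a
    simp only [mem_ofPred_eq, mem_iUnion]
    constructor
    · rintro ⟨x, hxS, hxU⟩
      rw [← hFU] at hxU
      obtain ⟨n, hn⟩ := mem_iUnion.1 hxU
      obtain ⟨R, hR⟩ := mem_iUnion.1 ((iUnion_compactCovering E).symm ▸ mem_univ x)
      exact ⟨n, R, x, hR, hxS, hn⟩
    · rintro ⟨n, R, x, -, hxS, hxF⟩
      exact ⟨x, hxS, hFU ▸ mem_iUnion.2 ⟨n, hxF⟩⟩
  rw [h]
  exact MeasurableSet.iUnion fun n => MeasurableSet.iUnion fun R =>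
    (isClosed_exists_mem_compact (hS.inter (hF n)) (isCompact_compactCovering E R)).measurableSet

end Projection

/-! ### Polytopes -/

section Polytopes

variable {d : ℕ}

/-- A polytope is the convex hull of finitely many points. -/
def IsPolytope (C : ConvexBody (Euc d)) : Prop :=
  ∃ S : Finset (Euc d), (C : Set (Euc d)) = convexHull ℝ (S : Set (Euc d))

/-- The convex hull of a finite non-empty family of points. -/
def hullBody {ι : Type*} [Finite ι] [Nonempty ι] (p : ι → Euc d) : ConvexBody (Euc d) where
  carrier := convexHull ℝ (range p)
  convex' := convex_convexHull ℝ _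
  isCompact' := (finite_range p).isCompact_convexHull ℝ
  nonempty' := (range_nonempty p).convexHull

lemma mem_hullBody_iff {ι : Type*} [Fintype ι] [Nonempty ι] {p : ι → Euc d} {x : Euc d} :
    x ∈ hullBody p ↔ ∃ w ∈ stdSimplex ℝ ι, ∑ i, w i • p i = x := by
  classical
  have h : convexHull ℝ (range p) = Fintype.linearCombination ℝ p '' stdSimplex ℝ ι := by
    rw [← convexHull_rangle_single_eq_stdSimplex, LinearMap.image_convexHull, ← range_comp]
    congr 2
    funext i
    simp
  change x ∈ convexHull ℝ (range p) ↔ _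
  rw [h]
  simp [Fintype.linearCombination_apply]

lemma hullBody_infDist_le {ι : Type*} [Fintype ι] [Nonempty ι] (p q : ι → Euc d) {x : Euc d}
    (hx : x ∈ hullBody p) : Metric.infDist x (hullBody q : Set (Euc d)) ≤ dist p q := by
  have hsub : convexHull ℝ (range p) ⊆
      Metric.cthickening (dist p q) (hullBody q : Set (Euc d)) := by
    refine convexHull_min ?_ ((hullBody q).convex.cthickening _)
    rintro _ ⟨i, rfl⟩
    exact Metric.mem_cthickening_of_dist_le _ (q i) _ _ (subset_convexHull ℝ _ ⟨i, rfl⟩)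
      (dist_le_pi_dist p q i)
  have := hsub hx
  rw [Metric.mem_cthickening_iff] at this
  exact ENNReal.toReal_le_of_le_ofReal dist_nonneg this

lemma continuous_hullBody {ι : Type*} [Fintype ι] [Nonempty ι] :
    Continuous fun p : ι → Euc d => hullBody p := by
  refine (LipschitzWith.of_dist_le_mul (K := 1) fun p q => ?_).continuous
  rw [NNReal.coe_one, one_mul]
  exact Metric.hausdorffDist_le_of_infDist dist_nonneg (fun x hx => hullBody_infDist_le p q hx)
    (fun x hx => (hullBody_infDist_le q p hx).trans_eq (dist_comm _ _))

lemma isPolytope_iff_exists_hullBody {C : ConvexBody (Euc d)} :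
    IsPolytope C ↔ ∃ (n : ℕ) (p : Fin (n + 1) → Euc d), hullBody p = C := by
  constructor
  · rintro ⟨S, hS⟩
    have hSne : S.Nonempty := by
      have := C.nonempty
      rw [hS, convexHull_nonempty_iff] at this
      exact_mod_cast this
    obtain ⟨n, hn⟩ : ∃ n, S.card = n + 1 := ⟨S.card - 1, by have := hSne.card_pos; omega⟩
    refine ⟨n, fun i => (S.equivFinOfCardEq hn).symm i, ConvexBody.ext ?_⟩
    rw [hS]
    change convexHull ℝ (range fun i => ((S.equivFinOfCardEq hn).symm i : Euc d)) = _
    congr 1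
    ext x
    simp only [mem_range, SetLike.mem_coe]
    constructor
    · rintro ⟨i, rfl⟩
      exact ((S.equivFinOfCardEq hn).symm i).2
    · intro hx
      exact ⟨S.equivFinOfCardEq hn ⟨x, hx⟩, by simp⟩
  · rintro ⟨n, p, rfl⟩
    classical
    exact ⟨Finset.univ.image p, by simp [hullBody]⟩

lemma measurableSet_isPolytope : MeasurableSet {C : ConvexBody (Euc d) | IsPolytope C} := by
  have h : {C : ConvexBody (Euc d) | IsPolytope C} =
      ⋃ (n : ℕ) (R : ℕ), (fun p : Fin (n + 1) → Euc d => hullBody p) '' Metric.closedBall 0 R := by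
    ext C
    simp only [mem_ofPred_eq, isPolytope_iff_exists_hullBody, mem_iUnion, mem_image]
    constructor
    · rintro ⟨n, p, rfl⟩
      obtain ⟨R, hR⟩ := exists_nat_ge (dist p 0)
      exact ⟨n, R, p, hR, rfl⟩
    · rintro ⟨n, R, p, -, rfl⟩
      exact ⟨n, p, rfl⟩
  rw [h]
  exact MeasurableSet.iUnion fun n => MeasurableSet.iUnion fun R =>
    ((isCompact_closedBall _ _).image continuous_hullBody).isClosed.measurableSet

lemma IsPolytope.moveBody {C : ConvexBody (Euc d)} (hC : IsPolytope C) (g : Euc d ≃ᵃⁱ[ℝ] Euc d) :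
    IsPolytope (moveBody g C) := by
  classical
  obtain ⟨S, hS⟩ := hC
  refine ⟨S.image g, ?_⟩
  rw [coe_moveBody, hS, Finset.coe_image]
  exact (g.toAffineEquiv : Euc d →ᵃ[ℝ] Euc d).image_convexHull _

/-- Near a point `x` of a polytope, every point of the polytope is the midpoint of `x` and another
point of the polytope. In terms of a convergent sequence of weights of the vertices: weights that
converge to the weights of `x` are eventually at least half the latter. -/
lemma IsPolytope.eventually_reflect_mem {C : ConvexBody (Euc d)} (hC : IsPolytope C) {x : Euc d}
    (hx : x ∈ C) : ∀ᶠ y in 𝓝[(C : Set (Euc d))] x, (2 : ℝ) • y - x ∈ C := by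
  obtain ⟨n, p, rfl⟩ := isPolytope_iff_exists_hullBody.1 hC
  by_contra hcon
  obtain ⟨y, hyx, hy⟩ := exists_seq_forall_of_frequently (not_eventually.1 hcon)
  obtain ⟨hyx, hyC⟩ := tendsto_nhdsWithin_iff.1 hyx
  obtain ⟨N, hN⟩ := eventually_atTop.1 hyC
  choose w hw hwy using fun i => mem_hullBody_iff.1 (hN (N + i) (Nat.le_add_right _ _))
  obtain ⟨w', hw', φ, hφ, hlim⟩ := (isCompact_stdSimplex ℝ (Fin (n + 1))).tendsto_subseq hw
  have hsub : Tendsto (fun i => y (N + φ i)) atTop (𝓝 x) :=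
    hyx.comp (tendsto_atTop_mono (fun i => Nat.le_add_left _ _) hφ.tendsto_atTop)
  have hlim' : ∀ j, Tendsto (fun i => w (φ i) j) atTop (𝓝 (w' j)) := fun j =>
    (tendsto_pi_nhds.1 hlim) j
  have hx' : ∑ j, w' j • p j = x := by
    refine tendsto_nhds_unique ?_ hsub
    simp_rw [← hwy]
    exact tendsto_finsetSum _ fun j _ => (hlim' j).smul_const _
  have hhalf : ∀ᶠ i in atTop, ∀ j, w' j ≤ 2 * w (φ i) j := by
    refine eventually_all.2 fun j => ?_
    rcases (hw'.1 j).eq_or_lt with h0 | hpos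
    · exact Eventually.of_forall fun i => by
        rw [← h0]; exact mul_nonneg zero_le_two ((hw (φ i)).1 j)
    · have : w' j / 2 < w' j := by linarith
      filter_upwards [(hlim' j).eventually (lt_mem_nhds this)] with i hi
      linarith
  obtain ⟨i, hi⟩ := hhalf.exists
  refine hy (N + φ i) (mem_hullBody_iff.2 ⟨fun j => 2 * w (φ i) j - w' j, ⟨fun j => ?_, ?_⟩, ?_⟩)
  · have := hi j
    linarith
  · rw [Finset.sum_sub_distrib, ← Finset.mul_sum, (hw (φ i)).2, hw'.2]
    norm_num
  · simp only [sub_smul, mul_smul, Finset.sum_sub_distrib]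
    rw [← Finset.smul_sum, hwy, hx']

end Polytopes

/-! ### Skeletons of polytopes -/

section Skeleton

variable {d : ℕ}

/-- Two collinear points `x ± ε • v` of a convex set on both sides of one of its points `x` may be
moved towards `x`. -/
lemma segment_shrink {s : Set (Euc d)} (hs : Convex ℝ s) {x v : Euc d} {ε δ : ℝ} (hδ : 0 ≤ δ)
    (hδε : δ ≤ ε) (h1 : x + ε • v ∈ s) (h2 : x - ε • v ∈ s) :
    x + δ • v ∈ s ∧ x - δ • v ∈ s := by
  rcases hδ.eq_or_lt with rfl | hδ'
  · have := hs h1 h2 (a := 1 / 2) (b := 1 / 2) (by norm_num) (by norm_num) (by norm_num)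
    have hx : x ∈ s := by convert this using 1; module
    simpa using hx
  have hε : 0 < ε := hδ'.trans_le hδε
  obtain ⟨t, ht0, ht1, rfl⟩ : ∃ t : ℝ, 0 ≤ t ∧ t ≤ 1 ∧ δ = t * ε :=
    ⟨δ / ε, by positivity, (div_le_one hε).2 hδε, (div_mul_cancel₀ _ hε.ne').symm⟩
  constructor
  · have := hs h1 h2 (a := (1 + t) / 2) (b := (1 - t) / 2) (by linarith) (by linarith) (by ring)
    convert this using 1
    module
  · have := hs h1 h2 (a := (1 - t) / 2) (b := (1 + t) / 2) (by linarith) (by linarith) (by ring)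
    convert this using 1
    module

/-- The space of directions `v` such that the point `x` of the convex body `C` is an inner point of
a segment of direction `v` in `C`: the direction of the smallest face of `C` that contains `x`.
(All directions if `x` is not in `C`.) -/
def faceDirection (C : ConvexBody (Euc d)) (x : Euc d) : Submodule ℝ (Euc d) where
  carrier := {v | x ∈ C → ∃ ε : ℝ, 0 < ε ∧ x + ε • v ∈ C ∧ x - ε • v ∈ C}
  zero_mem' := fun hx => ⟨1, one_pos, by simpa using hx, by simpa using hx⟩
  add_mem' := by
    intro v w hv hw hx
    obtain ⟨ε, hε, hv1, hv2⟩ := hv hx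
    obtain ⟨δ, hδ, hw1, hw2⟩ := hw hx
    have hm : 0 < min ε δ := lt_min hε hδ
    obtain ⟨hv1, hv2⟩ := segment_shrink C.convex hm.le (min_le_left ε δ) hv1 hv2
    obtain ⟨hw1, hw2⟩ := segment_shrink C.convex hm.le (min_le_right ε δ) hw1 hw2
    refine ⟨min ε δ / 2, by positivity, ?_, ?_⟩
    · have := C.convex hv1 hw1 (a := 1 / 2) (b := 1 / 2) (by norm_num) (by norm_num) (by norm_num)
      have h2 : x + (min ε δ / 2) • (v + w) ∈ (C : Set (Euc d)) := by
        convert this using 1; module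
      exact h2
    · have := C.convex hv2 hw2 (a := 1 / 2) (b := 1 / 2) (by norm_num) (by norm_num) (by norm_num)
      have h2 : x - (min ε δ / 2) • (v + w) ∈ (C : Set (Euc d)) := by
        convert this using 1; module
      exact h2
  smul_mem' := by
    intro c v hv hx
    obtain ⟨ε, hε, hv1, hv2⟩ := hv hx
    rcases lt_trichotomy c 0 with hc | rfl | hc
    · refine ⟨ε / -c, div_pos hε (neg_pos.2 hc), ?_, ?_⟩
      · rw [smul_smul, div_neg, neg_mul, div_mul_cancel₀ _ hc.ne, neg_smul, ← sub_eq_add_neg]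
        exact hv2
      · rw [smul_smul, div_neg, neg_mul, div_mul_cancel₀ _ hc.ne, neg_smul, sub_neg_eq_add]
        exact hv1
    · exact ⟨1, one_pos, by simpa using hx, by simpa using hx⟩
    · refine ⟨ε / c, div_pos hε hc, ?_, ?_⟩
      · rwa [smul_smul, div_mul_cancel₀ _ hc.ne']
      · rwa [smul_smul, div_mul_cancel₀ _ hc.ne']

lemma mem_faceDirection {C : ConvexBody (Euc d)} {x v : Euc d} (hx : x ∈ C) :
    v ∈ faceDirection C x ↔ ∃ ε : ℝ, 0 < ε ∧ x + ε • v ∈ C ∧ x - ε • v ∈ C :=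
  ⟨fun h => h hx, fun h _ => h⟩

/-- If the point `x` lies strictly between the points `a` and `z` of `C`, then `a - x` is a
direction of the smallest face of `x`. -/
lemma sub_mem_faceDirection {C : ConvexBody (Euc d)} {x a z : Euc d} (hx : x ∈ C) (ha : a ∈ C)
    (hz : z ∈ C) {c : ℝ} (hc0 : 0 < c) (hc1 : c < 1) (h : x = c • a + (1 - c) • z) :
    a - x ∈ faceDirection C x := by
  -- The point `z` is `x - (c / (1 - c)) • (a - x)`.
  have hcc : 0 < 1 - c := by linarith
  have hz' : x - (c / (1 - c)) • (a - x) ∈ C := by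
    have h3 : a - x = (1 - c) • (a - z) := by rw [h]; module
    have h4 : x - (c / (1 - c)) • (a - x) = z := by
      rw [h3, smul_smul, div_mul_cancel₀ _ hcc.ne', h]
      module
    rwa [h4]
  refine (mem_faceDirection hx).2 ⟨min 1 (c / (1 - c)), by positivity, ?_, ?_⟩
  · have hm : min 1 (c / (1 - c)) ≤ 1 := min_le_left _ _
    have hm0 : 0 ≤ min 1 (c / (1 - c)) := by positivity
    have := C.convex hx ha (a := 1 - min 1 (c / (1 - c))) (b := min 1 (c / (1 - c)))
      (by linarith) hm0 (by ring)
    change _ ∈ (C : Set (Euc d))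
    convert this using 1
    module
  · have hr : 0 < c / (1 - c) := by positivity
    have hm : min 1 (c / (1 - c)) ≤ c / (1 - c) := min_le_right _ _
    have hm0 : 0 ≤ min 1 (c / (1 - c)) := by positivity
    set r := c / (1 - c)
    set m := min 1 r
    have := C.convex hx hz' (a := 1 - m / r) (b := m / r)
      (by have := (div_le_one hr).2 hm; linarith) (by positivity) (by ring)
    change _ ∈ (C : Set (Euc d))
    convert this using 1
    have h8 : m = m / r * r := (div_mul_cancel₀ _ hr.ne').symm
    conv_lhs => rw [h8]
    module

/-- The smallest face of a point `y` of the smallest face of `x` is contained in the latter. -/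
lemma faceDirection_le {C : ConvexBody (Euc d)} {x y : Euc d} (hx : x ∈ C) (hy : y ∈ C)
    (hyx : y - x ∈ faceDirection C x) : faceDirection C y ≤ faceDirection C x := by
  intro v hv
  obtain ⟨ε, hε, hv1, hv2⟩ := (mem_faceDirection hy).1 hv
  obtain ⟨δ, hδ, -, hz⟩ := (mem_faceDirection hx).1 hyx
  -- `x` is a convex combination of `y` and `z = x - δ • (y - x)`.
  have hδ1 : 0 < 1 + δ := by linarith
  have key : ∀ w ∈ (C : Set (Euc d)), x + (δ / (1 + δ)) • (w - y) ∈ (C : Set (Euc d)) := by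
    intro w hw
    have := C.convex hw hz (a := δ / (1 + δ)) (b := 1 / (1 + δ)) (by positivity) (by positivity)
      (by field_simp; ring)
    convert this using 1
    have h1 : (1 : ℝ) / (1 + δ) * δ = δ / (1 + δ) := by ring
    have h2 : (1 : ℝ) / (1 + δ) = 1 - δ / (1 + δ) := by field_simp; ring
    have h3 : (1 / (1 + δ)) • (x - δ • (y - x)) =
      (1 / (1 + δ)) • x - ((1 / (1 + δ)) * δ) • (y - x) := by module
    rw [h3, h1, h2]
    module
  refine (mem_faceDirection hx).2 ⟨δ / (1 + δ) * ε, by positivity, ?_, ?_⟩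
  · have := key _ hv1
    change _ ∈ (C : Set (Euc d))
    convert this using 1
    module
  · have := key _ hv2
    change _ ∈ (C : Set (Euc d))
    convert this using 1
    module

/-- The `k`-skeleton of a polytope: the set of its points whose smallest face has dimension at most
`k`. It is taken to be empty if the body is not a polytope. -/
def skeleton (k : ℕ) (C : ConvexBody (Euc d)) : Set (Euc d) :=
  {x | IsPolytope C ∧ x ∈ C ∧ Module.finrank ℝ (faceDirection C x) ≤ k}

lemma skeleton_subset (k : ℕ) (C : ConvexBody (Euc d)) : skeleton k C ⊆ C := fun _ hx => hx.2.1

lemma faceUnion_subset_skeleton {k : ℕ} {C : ConvexBody (Euc d)} (hC : IsPolytope C) :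
    faceUnion k C ⊆ skeleton k C := by
  rintro x ⟨F, hF, hxF⟩
  have hx : x ∈ C := hF.extreme.1 hxF
  refine ⟨hC, hx, ?_⟩
  rw [← hF.dim.2]
  refine Submodule.finrank_mono fun v hv => ?_
  obtain ⟨ε, hε, h1, h2⟩ := (mem_faceDirection hx).1 hv
  have hxo : x ∈ openSegment ℝ (x + ε • v) (x - ε • v) :=
    ⟨1 / 2, 1 / 2, by norm_num, by norm_num, by norm_num, by module⟩
  have hmem := hF.extreme.2 h1 h2 hxF hxo
  have := vsub_mem_vectorSpan ℝ hmem hxF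
  rw [vsub_eq_sub, add_sub_cancel_left] at this
  exact (Submodule.smul_mem_iff _ hε.ne').1 this

lemma skeleton_diff_faceUnion_subset {k : ℕ} {C : ConvexBody (Euc d)} :
    skeleton k C \ faceUnion k C ⊆ skeleton (k - 1) C := by
  rintro x ⟨⟨hC, hx, hdim⟩, hxF⟩
  refine ⟨hC, hx, ?_⟩
  by_contra hlt
  have hk : Module.finrank ℝ (faceDirection C x) = k := by omega
  refine hxF ⟨{y | y ∈ C ∧ y - x ∈ faceDirection C x}, ⟨?_, ⟨fun y hy => hy.1, ?_⟩, ⟨x, hx, ?_⟩, ?_⟩,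
    hx, ?_⟩
  · intro y hy z hz a b ha hb hab
    refine ⟨C.convex hy.1 hz.1 ha hb hab, ?_⟩
    have : a • y + b • z - x = a • (y - x) + b • (z - x) := by
      have : x = (a + b) • x := by rw [hab, one_smul]
      conv_lhs => rw [this]
      module
    rw [this]
    exact add_mem (Submodule.smul_mem _ _ hy.2) (Submodule.smul_mem _ _ hz.2)
  · rintro a ha b hb y hy ⟨s, t, hs, ht, hst, rfl⟩
    refine ⟨ha, ?_⟩
    have h1 : a - (s • a + t • b) ∈ faceDirection C (s • a + t • b) :=
      sub_mem_faceDirection hy.1 ha hb hs (by linarith) (by rw [show 1 - s = t by linarith])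
    have h2 := faceDirection_le hx hy.1 hy.2 h1
    have := add_mem h2 hy.2
    convert this using 1
    abel
  · simp
  · rw [← hk]
    refine congrArg (fun S : Submodule ℝ (Euc d) => Module.finrank ℝ S) (le_antisymm ?_ ?_)
    · rw [vectorSpan_def, Submodule.span_le]
      rintro _ ⟨y, hy, z, hz, rfl⟩
      have := sub_mem hy.2 hz.2
      rw [sub_sub_sub_cancel_right] at this
      exact this
    · intro v hv
      obtain ⟨ε, hε, h1, h2⟩ := (mem_faceDirection hx).1 hv
      have hmem : x + ε • v ∈ {y | y ∈ C ∧ y - x ∈ faceDirection C x} :=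
        ⟨h1, by rw [add_sub_cancel_left]; exact Submodule.smul_mem _ _ hv⟩
      have hmem' : x ∈ {y | y ∈ C ∧ y - x ∈ faceDirection C x} := ⟨hx, by simp⟩
      have := vsub_mem_vectorSpan ℝ hmem hmem'
      rw [vsub_eq_sub, add_sub_cancel_left] at this
      exact (Submodule.smul_mem_iff _ hε.ne').1 this
  · simp

end Skeleton

/-! ### Measurability of skeletons -/

section SkeletonMeasurability

variable {d : ℕ}

/-- The `k`-skeleton of a polytope is the union of finitely many convex bodies of dimension at most
`k`, namely of the convex hulls of certain sets of vertices. -/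
lemma exists_skeleton_eq_iUnion (k : ℕ) {C : ConvexBody (Euc d)} (hC : IsPolytope C) :
    ∃ 𝓕 : Finset (ConvexBody (Euc d)),
      (∀ A ∈ 𝓕, Module.finrank ℝ (vectorSpan ℝ (A : Set (Euc d))) ≤ k) ∧
      skeleton k C = ⋃ A ∈ 𝓕, (A : Set (Euc d)) := by
  classical
  obtain ⟨n, p, rfl⟩ := isPolytope_iff_exists_hullBody.1 hC
  let H : Finset (Fin (n + 1)) → ConvexBody (Euc d) := fun I =>
    if h : I.Nonempty then
      haveI : Nonempty I := h.to_subtype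
      hullBody fun i : I => p i
    else hullBody p
  have hH : ∀ I : Finset (Fin (n + 1)), I.Nonempty →
      (H I : Set (Euc d)) = convexHull ℝ (p '' (I : Set (Fin (n + 1)))) := by
    intro I hI
    simp only [H, hI, dif_pos]
    change convexHull ℝ (range fun i : I => p i) = _
    congr 1
    ext x
    simp
  refine ⟨(Finset.univ.image H).filter fun A =>
    Module.finrank ℝ (vectorSpan ℝ (A : Set (Euc d))) ≤ k ∧
      (A : Set (Euc d)) ⊆ skeleton k (hullBody p), fun A hA => (Finset.mem_filter.1 hA).2.1, ?_⟩
  apply Subset.antisymm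
  swap
  · exact iUnion₂_subset fun A hA => (Finset.mem_filter.1 hA).2.2
  rintro x ⟨-, hx, hdim⟩
  obtain ⟨w, hw, hwx⟩ := mem_hullBody_iff.1 hx
  set I := Finset.univ.filter fun i => 0 < w i with hI
  have hw0 : ∀ i, i ∉ I → w i = 0 := fun i hi =>
    le_antisymm (not_lt.1 fun h => hi (by simp [hI, h])) (hw.1 i)
  have hsumI : ∑ i ∈ I, w i = 1 := by
    rw [← hw.2]
    exact Finset.sum_subset (Finset.subset_univ _) fun i _ hi => hw0 i hi
  have hsumx : ∑ i ∈ I, w i • p i = x := by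
    rw [← hwx]
    exact Finset.sum_subset (Finset.subset_univ _) fun i _ hi => by rw [hw0 i hi, zero_smul]
  have hIne : I.Nonempty := by
    rw [Finset.nonempty_iff_ne_empty]
    rintro h
    rw [h] at hsumI
    simp at hsumI
  have hp : ∀ i, p i ∈ hullBody p := fun i => subset_convexHull ℝ _ ⟨i, rfl⟩
  have hxH : x ∈ (H I : Set (Euc d)) := by
    rw [hH I hIne, ← hsumx]
    exact (convex_convexHull ℝ _).sum_mem (fun i _ => hw.1 i) hsumI
      fun i hi => subset_convexHull ℝ _ ⟨i, hi, rfl⟩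
  have hdir : ∀ i ∈ I, p i - x ∈ faceDirection (hullBody p) x := by
    intro i hi
    have hwi : 0 < w i := (Finset.mem_filter.1 hi).2
    have hwi1 : w i ≤ 1 := hsumI ▸ Finset.single_le_sum (fun j _ => hw.1 j) hi
    rcases hwi1.eq_or_lt with h1 | h1
    · have hx' : x = p i := by
        rw [← hwx, Finset.sum_eq_single i, h1, one_smul]
        · intro j _ hji
          have := Finset.add_sum_erase Finset.univ w (Finset.mem_univ i)
          have h0 : ∑ j ∈ Finset.univ.erase i, w j = 0 := by
            have := hw.2
            linarith
          rw [(Finset.sum_eq_zero_iff_of_nonneg fun j _ => hw.1 j).1 h0 j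
            (Finset.mem_erase.2 ⟨hji, Finset.mem_univ _⟩), zero_smul]
        · simp
      rw [hx', sub_self]
      exact zero_mem _
    · -- `x` lies strictly between `p i` and the barycentre `z` of the other vertices.
      have hc : 0 < 1 - w i := by linarith
      have hsum1 : ∑ j ∈ Finset.univ.erase i, w j = 1 - w i := by
        have := Finset.add_sum_erase Finset.univ w (Finset.mem_univ i)
        have := hw.2
        linarith
      have hz : ∑ j ∈ Finset.univ.erase i, ((1 - w i)⁻¹ * w j) • p j ∈ hullBody p := by
        refine (hullBody p).convex.sum_mem (fun j _ => mul_nonneg (by positivity) (hw.1 j)) ?_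
          fun j _ => hp j
        rw [← Finset.mul_sum, hsum1, inv_mul_cancel₀ hc.ne']
      refine sub_mem_faceDirection hx (hp i) hz hwi h1 ?_
      simp only [mul_smul]
      rw [← Finset.smul_sum, smul_smul, mul_inv_cancel₀ hc.ne', one_smul,
        Finset.add_sum_erase _ (fun j => w j • p j) (Finset.mem_univ i), hwx]
  have hdirH : ∀ y ∈ (H I : Set (Euc d)), y - x ∈ faceDirection (hullBody p) x := by
    intro y hy
    rw [hH I hIne] at hy
    have : convexHull ℝ (p '' (I : Set (Fin (n + 1)))) ⊆
        (fun y => y - x) ⁻¹' (faceDirection (hullBody p) x : Set (Euc d)) := by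
      refine convexHull_min ?_ ?_
      · rintro _ ⟨i, hi, rfl⟩
        exact hdir i hi
      · intro y hy z hz a b _ _ hab
        have : a • y + b • z - x = a • (y - x) + b • (z - x) := by
          have : x = (a + b) • x := by rw [hab, one_smul]
          conv_lhs => rw [this]
          module
        change a • y + b • z - x ∈ faceDirection (hullBody p) x
        rw [this]
        exact add_mem (Submodule.smul_mem _ _ hy) (Submodule.smul_mem _ _ hz)
    exact this hy
  have hHC : (H I : Set (Euc d)) ⊆ hullBody p := by
    rw [hH I hIne]
    exact convexHull_mono (image_subset_range _ _)
  refine mem_iUnion₂.2 ⟨H I, Finset.mem_filter.2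
    ⟨Finset.mem_image_of_mem _ (Finset.mem_univ _), ?_, fun y hy => ⟨hC, hHC hy, ?_⟩⟩, hxH⟩
  · refine (Submodule.finrank_mono ?_).trans hdim
    rw [vectorSpan_def, Submodule.span_le]
    rintro _ ⟨y, hy, z, hz, rfl⟩
    have := sub_mem (hdirH y hy) (hdirH z hz)
    rw [sub_sub_sub_cancel_right] at this
    exact this
  · exact (Submodule.finrank_mono (faceDirection_le hx (hHC hy) (hdirH y hy))).trans hdim

lemma isCompact_skeleton (k : ℕ) (C : ConvexBody (Euc d)) : IsCompact (skeleton k C) := by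
  by_cases hC : IsPolytope C
  · obtain ⟨𝓕, -, h⟩ := exists_skeleton_eq_iUnion k hC
    rw [h]
    exact 𝓕.isCompact_biUnion fun A _ => A.isCompact
  · have : skeleton k C = ∅ := eq_empty_of_forall_notMem fun x hx => hC hx.1
    rw [this]
    exact isCompact_empty

/-- The point `x` is the centre of a `k`-dimensional cross-polytope of radius `1 / (n + 1)` that is
contained in `C`. -/
def HasFrame (k n : ℕ) (C : ConvexBody (Euc d)) (x : Euc d) : Prop :=
  ∃ e : Fin k → Euc d, Orthonormal ℝ e ∧
    ∀ i, x + ((n : ℝ) + 1)⁻¹ • e i ∈ C ∧ x - ((n : ℝ) + 1)⁻¹ • e i ∈ C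

lemma exists_hasFrame_iff {k : ℕ} {C : ConvexBody (Euc d)} {x : Euc d} (hx : x ∈ C) :
    (∃ n, HasFrame (k + 1) n C x) ↔ k < Module.finrank ℝ (faceDirection C x) := by
  constructor
  · rintro ⟨n, e, he, hC⟩
    have hmem : ∀ i, e i ∈ faceDirection C x := fun i =>
      (mem_faceDirection hx).2 ⟨_, by positivity, (hC i).1, (hC i).2⟩
    have hli : LinearIndependent ℝ fun i => (⟨e i, hmem i⟩ : faceDirection C x) :=
      LinearIndependent.of_comp (faceDirection C x).subtype he.linearIndependent
    have := hli.fintype_card_le_finrank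
    simpa [Nat.succ_le_iff] using this
  · intro h
    let b := stdOrthonormalBasis ℝ (faceDirection C x)
    let e : Fin (k + 1) → Euc d := fun i => (b (Fin.castLE h i) : Euc d)
    have he : Orthonormal ℝ e :=
      (b.orthonormal.comp _ (Fin.castLE_injective h)).comp_linearIsometry
        (faceDirection C x).subtypeₗᵢ
    have hε : ∀ i, ∃ ε : ℝ, 0 < ε ∧ x + ε • e i ∈ C ∧ x - ε • e i ∈ C := fun i =>
      (mem_faceDirection hx).1 (b (Fin.castLE h i)).2
    choose ε hε h1 h2 using hε
    have hlim : ∀ᶠ n : ℕ in atTop, ∀ i, ((n : ℝ) + 1)⁻¹ < ε i := by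
      refine eventually_all.2 fun i => ?_
      have := (tendsto_one_div_add_atTop_nhds_zero_nat (𝕜 := ℝ)).eventually (gt_mem_nhds (hε i))
      simpa using this
    obtain ⟨n, hn⟩ := hlim.exists
    exact ⟨n, e, he, fun i => segment_shrink C.convex (by positivity) (hn i).le (h1 i) (h2 i)⟩

lemma HasFrame.mono {k n m : ℕ} {C : ConvexBody (Euc d)} {x : Euc d} (h : HasFrame k n C x)
    (hnm : n ≤ m) : HasFrame k m C x := by
  obtain ⟨e, he, hC⟩ := h
  refine ⟨e, he, fun i => segment_shrink C.convex (by positivity) ?_ (hC i).1 (hC i).2⟩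
  have : (n : ℝ) ≤ m := by exact_mod_cast hnm
  gcongr

lemma HasFrame.of_reflect {k n : ℕ} {C : ConvexBody (Euc d)} {x y : Euc d} (h : HasFrame k n C x)
    (hy : (2 : ℝ) • y - x ∈ C) : HasFrame k (2 * n + 1) C y := by
  obtain ⟨e, he, hC⟩ := h
  have hn : (((2 * n + 1 : ℕ) : ℝ) + 1)⁻¹ = 1 / 2 * ((n : ℝ) + 1)⁻¹ := by
    push_cast
    rw [one_div, ← mul_inv]
    ring_nf
  refine ⟨e, he, fun i => ⟨?_, ?_⟩⟩
  · have := C.convex (hC i).1 hy (a := 1 / 2) (b := 1 / 2) (by norm_num) (by norm_num)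
      (by norm_num)
    rw [hn]
    change _ ∈ (C : Set (Euc d))
    convert this using 1
    module
  · have := C.convex (hC i).2 hy (a := 1 / 2) (b := 1 / 2) (by norm_num) (by norm_num)
      (by norm_num)
    rw [hn]
    change _ ∈ (C : Set (Euc d))
    convert this using 1
    module

/-- On a compact set that misses the `k`-skeleton of a polytope, the radius of the
`(k + 1)`-dimensional cross-polytopes is bounded below. -/
lemma IsPolytope.exists_forall_hasFrame {k : ℕ} {C : ConvexBody (Euc d)} (hC : IsPolytope C)
    {K : Set (Euc d)} (hK : IsCompact K) (hKC : K ⊆ C) (hdisj : Disjoint K (skeleton k C)) :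
    ∃ n, ∀ x ∈ K, HasFrame (k + 1) n C x := by
  refine hK.induction_on (p := fun s => ∃ n, ∀ x ∈ s, HasFrame (k + 1) n C x)
    ⟨0, fun x hx => hx.elim⟩ (fun s t hst ⟨n, hn⟩ => ⟨n, fun x hx => hn x (hst hx)⟩) ?_ ?_
  · rintro s t ⟨n, hn⟩ ⟨m, hm⟩
    exact ⟨max n m, fun x hx => hx.elim (fun h => (hn x h).mono (le_max_left _ _))
      fun h => (hm x h).mono (le_max_right _ _)⟩
  · intro x hx
    have hlt : k < Module.finrank ℝ (faceDirection C x) := by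
      by_contra hle
      exact disjoint_left.1 hdisj hx ⟨hC, hKC hx, not_lt.1 hle⟩
    obtain ⟨n, hn⟩ := (exists_hasFrame_iff (hKC hx)).2 hlt
    refine ⟨{y | HasFrame (k + 1) (2 * n + 1) C y}, ?_, 2 * n + 1, fun y hy => hy⟩
    have := (hC.eventually_reflect_mem (hKC hx)).filter_mono (nhdsWithin_mono x hKC)
    filter_upwards [this] with y hy using hn.of_reflect hy

lemma isClosed_orthonormal {k : ℕ} : IsClosed {e : Fin k → Euc d | Orthonormal ℝ e} := by
  simp only [orthonormal_iff_ite, ofPred_forall]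
  exact isClosed_iInter fun i => isClosed_iInter fun j => isClosed_eq (by fun_prop) continuous_const

lemma isClosed_hasFrame (k n : ℕ) :
    IsClosed {p : ConvexBody (Euc d) × Euc d | HasFrame k n p.1 p.2} := by
  have hS : IsClosed {q : (ConvexBody (Euc d) × Euc d) × (Fin k → Euc d) | Orthonormal ℝ q.2 ∧
      ∀ i, q.1.2 + ((n : ℝ) + 1)⁻¹ • q.2 i ∈ q.1.1 ∧ q.1.2 - ((n : ℝ) + 1)⁻¹ • q.2 i ∈ q.1.1} := by
    have : {q : (ConvexBody (Euc d) × Euc d) × (Fin k → Euc d) | Orthonormal ℝ q.2 ∧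
        ∀ i, q.1.2 + ((n : ℝ) + 1)⁻¹ • q.2 i ∈ q.1.1 ∧
          q.1.2 - ((n : ℝ) + 1)⁻¹ • q.2 i ∈ q.1.1} =
        (Prod.snd ⁻¹' {e | Orthonormal ℝ e}) ∩
        ⋂ i, {q | q.1.2 + ((n : ℝ) + 1)⁻¹ • q.2 i ∈ q.1.1} ∩
          {q | q.1.2 - ((n : ℝ) + 1)⁻¹ • q.2 i ∈ q.1.1} := by ext; simp
    rw [this]
    refine (isClosed_orthonormal.preimage continuous_snd).inter ?_
    refine isClosed_iInter fun i => IsClosed.inter ?_ ?_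
    · exact isClosed_mem_body.preimage
        (f := fun q : (ConvexBody (Euc d) × Euc d) × (Fin k → Euc d) =>
          (q.1.1, q.1.2 + ((n : ℝ) + 1)⁻¹ • q.2 i)) (by fun_prop)
    · exact isClosed_mem_body.preimage
        (f := fun q : (ConvexBody (Euc d) × Euc d) × (Fin k → Euc d) =>
          (q.1.1, q.1.2 - ((n : ℝ) + 1)⁻¹ • q.2 i)) (by fun_prop)
  have h := isClosed_exists_mem_compact hS (isCompact_closedBall (0 : Fin k → Euc d) 1)
  refine (congrArg IsClosed ?_).mp h
  ext p
  symm
  constructor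
  · rintro ⟨e, he, h⟩
    refine ⟨e, ?_, he, h⟩
    rw [mem_closedBall_zero_iff, pi_norm_le_iff_of_nonneg zero_le_one]
    exact fun i => (he.norm_eq_one i).le
  · rintro ⟨e, -, he, h⟩
    exact ⟨e, he, h⟩

lemma isClosed_inter_diff {U : Set (Euc d)} (hU : IsOpen U) :
    IsClosed {q : (ConvexBody (Euc d) × ConvexBody (Euc d)) × Euc d |
      q.2 ∈ q.1.1 ∧ q.2 ∈ q.1.2 ∧ q.2 ∉ U} := by
  refine IsClosed.inter ?_ (IsClosed.inter ?_ (hU.isClosed_compl.preimage continuous_snd))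
  · exact isClosed_mem_body.preimage
      (f := fun q : (ConvexBody (Euc d) × ConvexBody (Euc d)) × Euc d => (q.1.1, q.2)) (by fun_prop)
  · exact isClosed_mem_body.preimage
      (f := fun q : (ConvexBody (Euc d) × ConvexBody (Euc d)) × Euc d => (q.1.2, q.2)) (by fun_prop)

lemma measurableSet_inter_subset {U : Set (Euc d)} (hU : IsOpen U) :
    MeasurableSet {p : ConvexBody (Euc d) × ConvexBody (Euc d) |
      (p.1 : Set (Euc d)) ∩ p.2 ⊆ U} := by
  have h := (measurableSet_exists_closed_open (isClosed_inter_diff (d := d) hU) isOpen_univ).compl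
  convert h using 1
  ext p
  simp only [mem_ofPred_eq, mem_compl_iff, mem_univ, and_true, not_exists, not_and, not_not,
    subset_def, mem_inter_iff, SetLike.mem_coe, and_imp]

lemma measurableSet_skeleton_inter_subset (k : ℕ) {U : Set (Euc d)} (hU : IsOpen U) :
    MeasurableSet {p : ConvexBody (Euc d) × ConvexBody (Euc d) | skeleton k p.1 ∩ p.2 ⊆ U} := by
  have hframe : ∀ n, MeasurableSet {p : ConvexBody (Euc d) × ConvexBody (Euc d) |
      ∀ x, x ∈ p.1 → x ∈ p.2 → x ∉ U → HasFrame (k + 1) n p.1 x} := by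
    intro n
    have hopen : IsOpen {q : (ConvexBody (Euc d) × ConvexBody (Euc d)) × Euc d |
        ¬ HasFrame (k + 1) n q.1.1 q.2} :=
      ((isClosed_hasFrame (k + 1) n).preimage
        (f := fun q : (ConvexBody (Euc d) × ConvexBody (Euc d)) × Euc d => (q.1.1, q.2))
        (by fun_prop)).isOpen_compl
    have h := (measurableSet_exists_closed_open (isClosed_inter_diff (d := d) hU) hopen).compl
    convert h using 1
    ext p
    simp only [mem_ofPred_eq, mem_compl_iff, not_exists, not_and, not_not, and_imp]
  have h : {p : ConvexBody (Euc d) × ConvexBody (Euc d) | skeleton k p.1 ∩ p.2 ⊆ U} =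
      (Prod.fst ⁻¹' {C : ConvexBody (Euc d) | IsPolytope C})ᶜ ∪
      ⋃ n, {p : ConvexBody (Euc d) × ConvexBody (Euc d) |
        ∀ x, x ∈ p.1 → x ∈ p.2 → x ∉ U → HasFrame (k + 1) n p.1 x} := by
    ext p
    constructor
    · intro hp
      by_cases hC : IsPolytope p.1
      · obtain ⟨n, hn⟩ := hC.exists_forall_hasFrame (k := k)
          (K := ((p.1 : Set (Euc d)) ∩ p.2) \ U)
          ((p.1.isCompact.inter_right p.2.isClosed).diff hU) (fun x hx => hx.1.1)
          (disjoint_left.2 fun x hx hs => hx.2 (hp ⟨hs, hx.1.2⟩))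
        exact Or.inr (mem_iUnion.2 ⟨n, fun x h1 h2 h3 => hn x ⟨⟨h1, h2⟩, h3⟩⟩)
      · exact Or.inl hC
    · rintro (hC | hp) x ⟨hx, hxW⟩
      · exact absurd hx.1 hC
      · obtain ⟨n, hn⟩ := mem_iUnion.1 hp
        by_contra hxU
        have := (exists_hasFrame_iff hx.2.1).1 ⟨n, hn x hx.2.1 hxW hxU⟩
        exact absurd hx.2.2 (not_le.2 this)
  rw [h]
  exact (measurable_fst measurableSet_isPolytope).compl.union (MeasurableSet.iUnion hframe)

lemma measurable_vol_skeleton (j k : ℕ) :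
    Measurable fun p : ConvexBody (Euc d) × ConvexBody (Euc d) => vol j (skeleton k p.1 ∩ p.2) :=
  measurable_vol_of_compact j (fun p => (isCompact_skeleton k p.1).inter_right p.2.isClosed)
    fun _ hU => measurableSet_skeleton_inter_subset k hU

end SkeletonMeasurability

/-! ### Coding the union of the cell boundaries -/

section Coding

variable {d : ℕ}

/-- The centre of the `j`-th ball of a countable base of balls. -/
noncomputable def ballCenter (d : ℕ) (j : ℕ × ℕ) : Euc d := TopologicalSpace.denseSeq (Euc d) j.1

/-- The radius of the `j`-th ball of the countable base. -/
noncomputable def ballRadius (j : ℕ × ℕ) : ℝ := ((j.2 : ℝ) + 1)⁻¹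

/-- A code selects balls from the countable base. -/
abbrev Code : Type := ℕ × ℕ → Prop

/-- The closed set coded by `t`: the complement of the union of the balls selected by `t`. -/
def codedSet (d : ℕ) (t : Code) : Set (Euc d) :=
  (⋃ j ∈ {j | t j}, Metric.ball (ballCenter d j) (ballRadius j))ᶜ

/-- The code of a measure on convex bodies selects the balls that are contained in a set of bodies
of positive measure. For the point process of cells of a tessellation, these are the balls that are
contained in some cell, so that the coded set is the union of the cell boundaries. -/
def code (μ : Measure (ConvexBody (Euc d))) : Code := fun j =>
  μ {C | Metric.closedBall (ballCenter d j) (ballRadius j) ⊆ C} ≠ 0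

lemma isClosed_codedSet (t : Code) : IsClosed (codedSet d t) :=
  (isOpen_biUnion fun _ _ => Metric.isOpen_ball).isClosed_compl

lemma measurableSet_subset_body (S : Set (Euc d)) :
    MeasurableSet {C : ConvexBody (Euc d) | S ⊆ C} := by
  have : {C : ConvexBody (Euc d) | S ⊆ C} = ⋂ x ∈ S, {C | x ∈ C} := by
    ext C
    simp [subset_def]
  rw [this]
  exact (isClosed_biInter fun x _ => isClosed_mem_body_left x).measurableSet

lemma measurable_code : Measurable (code (d := d)) := by
  refine measurable_pi_iff.2 fun j => ?_
  have h : MeasurableSet {μ : Measure (ConvexBody (Euc d)) |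
      μ {C | Metric.closedBall (ballCenter d j) (ballRadius j) ⊆ C} ≠ 0} :=
    (Measure.measurable_coe (measurableSet_subset_body _)) (measurableSet_singleton 0).compl
  exact measurableSet_setOfPred.1 h

lemma code_cellMeasure (C : ℕ → ConvexBody (Euc d)) (j : ℕ × ℕ) :
    code (cellMeasure C) j ↔
      ∃ n, Metric.closedBall (ballCenter d j) (ballRadius j) ⊆ (C n : Set (Euc d)) := by
  have hS := measurableSet_subset_body (Metric.closedBall (ballCenter d j) (ballRadius j))
  simp only [code, cellMeasure]
  rw [Measure.sum_apply _ hS]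
  simp [ENNReal.tsum_eq_zero, Measure.dirac_apply' _ hS, indicator]

lemma codedSet_code_cellMeasure (C : ℕ → ConvexBody (Euc d)) :
    codedSet d (code (cellMeasure C)) = (⋃ n, interior (C n : Set (Euc d)))ᶜ := by
  rw [codedSet, compl_inj_iff]
  apply Subset.antisymm
  · refine iUnion₂_subset fun j hj => ?_
    obtain ⟨n, hn⟩ := (code_cellMeasure C j).1 hj
    exact (interior_maximal (Metric.ball_subset_closedBall.trans hn) Metric.isOpen_ball).trans
      (subset_iUnion (fun n => interior (C n : Set (Euc d))) n)
  · refine iUnion_subset fun n x hx => ?_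
    obtain ⟨ε, hε, hball⟩ := Metric.isOpen_iff.1 isOpen_interior x hx
    obtain ⟨m, hm⟩ := exists_nat_one_div_lt (half_pos hε)
    have hm0 : (0 : ℝ) < 1 / ((m : ℝ) + 1) := by positivity
    obtain ⟨i, hi⟩ := (TopologicalSpace.denseRange_denseSeq (Euc d)).exists_dist_lt x hm0
    have hr : ballRadius (i, m) = 1 / ((m : ℝ) + 1) := by simp [ballRadius]
    refine mem_iUnion₂.2 ⟨(i, m), (code_cellMeasure C _).2 ⟨n, fun y hy => ?_⟩, ?_⟩
    · refine interior_subset (hball ?_)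
      rw [Metric.mem_closedBall, hr] at hy
      rw [Metric.mem_ball]
      have := dist_triangle y (ballCenter d (i, m)) x
      have h2 : dist (ballCenter d (i, m)) x < 1 / ((m : ℝ) + 1) := by rw [dist_comm]; exact hi
      linarith
    · rw [Metric.mem_ball, hr]
      exact hi

/-- Intersecting a measurable random compact set with the coded set of a random code yields a
random compact set whose `k`-volume is measurable. -/
lemma measurable_vol_codedSet_inter {p : Type*} [MeasurableSpace p] (k : ℕ)
    {K : p → Set (Euc d)} (hK : ∀ a, IsCompact (K a))
    (hmeas : ∀ U : Set (Euc d), IsOpen U → MeasurableSet {a | K a ⊆ U}) :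
    Measurable fun q : Code × p => vol k (codedSet d q.1 ∩ K q.2) := by
  refine measurable_vol_of_compact k (fun q => (hK q.2).inter_left (isClosed_codedSet q.1))
    fun U hU => ?_
  have h : {q : Code × p | codedSet d q.1 ∩ K q.2 ⊆ U} = ⋃ J : Finset (ℕ × ℕ),
      (⋂ j ∈ J, {q : Code × p | q.1 j}) ∩
        Prod.snd ⁻¹' {a | K a ⊆ U ∪ ⋃ j ∈ J, Metric.ball (ballCenter d j) (ballRadius j)} := by
    ext q
    simp only [mem_ofPred_eq, mem_iUnion, mem_inter_iff, mem_iInter, mem_preimage]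
    constructor
    · intro hq
      have hcov : K q.2 \ U ⊆ ⋃ j : {j // q.1 j}, Metric.ball (ballCenter d j) (ballRadius j) := by
        intro x hx
        by_contra hxj
        refine hx.2 (hq ⟨fun hmem => hxj ?_, hx.1⟩)
        obtain ⟨j, hj, hxj⟩ := mem_iUnion₂.1 hmem
        exact mem_iUnion.2 ⟨⟨j, hj⟩, hxj⟩
      obtain ⟨J, hJ⟩ := ((hK q.2).diff hU).elim_finite_subcover _ (fun _ => Metric.isOpen_ball) hcov
      classical
      refine ⟨J.image Subtype.val, ?_, fun x hx => ?_⟩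
      · intro j hj
        obtain ⟨j', -, rfl⟩ := Finset.mem_image.1 hj
        exact j'.2
      · by_cases hxU : x ∈ U
        · exact Or.inl hxU
        · obtain ⟨j, hj, hxj⟩ := mem_iUnion₂.1 (hJ ⟨hx, hxU⟩)
          exact Or.inr (mem_iUnion₂.2 ⟨j, Finset.mem_image_of_mem _ hj, hxj⟩)
    · rintro ⟨J, hJ, hK⟩ x ⟨hxF, hxK⟩
      rcases hK hxK with hxU | hx
      · exact hxU
      · obtain ⟨j, hj, hxj⟩ := mem_iUnion₂.1 hx
        exact absurd (mem_iUnion₂.2 ⟨j, hJ j hj, hxj⟩) hxF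
  rw [h]
  refine MeasurableSet.iUnion fun J => MeasurableSet.inter ?_ ?_
  · refine J.measurableSet_biInter fun j _ => ?_
    exact measurableSet_setOfPred.2 ((measurable_pi_apply j).comp measurable_fst)
  · exact measurable_snd (hmeas _ (hU.union (isOpen_biUnion fun _ _ => Metric.isOpen_ball)))

lemma measurable_vol_codedSet_skeleton (j k : ℕ) :
    Measurable fun q : Code × (ConvexBody (Euc d) × ConvexBody (Euc d)) =>
      vol j (codedSet d q.1 ∩ (skeleton k q.2.1 ∩ q.2.2)) := by
  have h := measurable_vol_codedSet_inter j
    (K := fun p : ConvexBody (Euc d) × ConvexBody (Euc d) => skeleton k p.1 ∩ p.2)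
    (fun p => (isCompact_skeleton k p.1).inter_right p.2.isClosed)
    fun _ hU => measurableSet_skeleton_inter_subset k hU
  exact h

lemma measurable_vol_codedSet_bodies (j : ℕ) :
    Measurable fun q : Code × (ConvexBody (Euc d) × ConvexBody (Euc d)) =>
      vol j (codedSet d q.1 ∩ ((q.2.1 : Set (Euc d)) ∩ q.2.2)) := by
  have h := measurable_vol_codedSet_inter j
    (K := fun p : ConvexBody (Euc d) × ConvexBody (Euc d) => (p.1 : Set (Euc d)) ∩ p.2)
    (fun p => p.1.isCompact.inter_right p.2.isClosed)
    fun _ hU => measurableSet_inter_subset hU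
  exact h

end Coding

/-! ### Geometry of deterministic tessellations -/

section Tessellation

variable {d : ℕ}

/-- The last point of a segment in a closed set. -/
lemma exists_last_mem_segment {s : Set (Euc d)} (hs : IsClosed s) {p q : Euc d} (hp : p ∈ s)
    (hq : q ∉ s) : ∃ t : ℝ, 0 ≤ t ∧ t < 1 ∧ p + t • (q - p) ∈ s ∧
      ∀ r, t < r → r ≤ 1 → p + r • (q - p) ∉ s := by
  have hcl : IsClosed {t : ℝ | p + t • (q - p) ∈ s} :=
    hs.preimage (f := fun t : ℝ => p + t • (q - p)) (by fun_prop)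
  have hne : (Icc (0 : ℝ) 1 ∩ {t : ℝ | p + t • (q - p) ∈ s}).Nonempty :=
    ⟨0, ⟨le_rfl, zero_le_one⟩, by simpa using hp⟩
  obtain ⟨t, ⟨⟨h0, h1⟩, ht⟩, hmax⟩ := (isCompact_Icc.inter_right hcl).exists_isGreatest hne
  refine ⟨t, h0, lt_of_le_of_ne h1 ?_, ht, fun r htr hr1 hr => ?_⟩
  · rintro rfl
    exact hq (by simpa using ht)
  · exact absurd (hmax ⟨⟨h0.trans htr.le, hr1⟩, hr⟩) (not_le.2 htr)

variable {C : ℕ → ConvexBody (Euc d)}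

lemma IsTessellation.closure_interior (hC : IsTessellation C) (i : ℕ) :
    closure (interior (C i : Set (Euc d))) = C i := by
  rw [(C i).convex.closure_interior_eq_closure_of_nonempty_interior (hC.interior_nonempty i),
    (C i).isClosed.closure_eq]

lemma IsTessellation.disjoint_interior (hC : IsTessellation C) {i j : ℕ} (hij : i ≠ j) :
    Disjoint (interior (C i : Set (Euc d))) (C j : Set (Euc d)) := by
  rw [← hC.closure_interior j]
  exact (hC.interior_disjoint i j hij).closure_right isOpen_interior

lemma IsTessellation.exists_separation (hC : IsTessellation C) {i j : ℕ} (hij : i ≠ j) :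
    ∃ (f : StrongDual ℝ (Euc d)) (u : ℝ), (∀ a ∈ interior (C i : Set (Euc d)), f a < u) ∧
      (∀ a ∈ (C i : Set (Euc d)), f a ≤ u) ∧ ∀ b ∈ (C j : Set (Euc d)), u ≤ f b := by
  obtain ⟨f, u, h1, h2⟩ := geometric_hahn_banach_open (C i).convex.interior isOpen_interior
    (C j).convex (hC.disjoint_interior hij)
  refine ⟨f, u, h1, fun a ha => ?_, h2⟩
  rw [← hC.closure_interior i] at ha
  exact closure_minimal (fun a ha => (h1 a ha).le)
    (isClosed_le f.continuous continuous_const : IsClosed {a | f a ≤ u}) ha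

/-- A cell of a tessellation is the intersection of finitely many half-spaces: those which separate
it from the cells in its neighbourhood. -/
lemma IsTessellation.exists_halfspaces (hC : IsTessellation C) (i : ℕ) :
    ∃ (N : Finset ℕ) (f : ℕ → StrongDual ℝ (Euc d)) (u : ℕ → ℝ),
      (C i : Set (Euc d)) = {x | ∀ j ∈ N, f j x ≤ u j} := by
  have hsep : ∀ j, ∃ (f : StrongDual ℝ (Euc d)) (u : ℝ), i ≠ j →
      (∀ a ∈ interior (C i : Set (Euc d)), f a < u) ∧
      (∀ a ∈ (C i : Set (Euc d)), f a ≤ u) ∧ ∀ b ∈ (C j : Set (Euc d)), u ≤ f b := by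
    intro j
    by_cases hij : i = j
    · exact ⟨0, 0, fun h => absurd hij h⟩
    · obtain ⟨f, u, h⟩ := hC.exists_separation hij
      exact ⟨f, u, fun _ => h⟩
  choose f u hfu using hsep
  set K := Metric.cthickening 1 (C i : Set (Euc d))
  have hfin := hC.locally_finite K (C i).isCompact.cthickening
  refine ⟨hfin.toFinset.erase i, f, u, Subset.antisymm ?_ ?_⟩
  · intro x hx j hj
    exact (hfu j (Finset.ne_of_mem_erase hj).symm).2.1 x hx
  · intro x hx
    by_contra hxC
    obtain ⟨p, hp⟩ := hC.interior_nonempty i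
    obtain ⟨t, ht0, ht1, htC, hlast⟩ :=
      exists_last_mem_segment (C i).isClosed (interior_subset hp) hxC
    -- Points slightly beyond the last point of the segment are in a neighbouring cell.
    have hev : ∀ᶠ r in 𝓝[>] t, p + r • (x - p) ∈ Metric.thickening 1 (C i : Set (Euc d)) := by
      have hcont : Continuous fun r : ℝ => p + r • (x - p) := by fun_prop
      exact nhdsWithin_le_nhds (hcont.continuousAt.preimage_mem_nhds
        (Metric.isOpen_thickening.mem_nhds (Metric.self_subset_thickening one_pos _ htC)))
    obtain ⟨r, hr, hr1⟩ := (hev.and (Ioo_mem_nhdsGT ht1)).exists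
    have hrC := hlast r hr1.1 hr1.2.le
    obtain ⟨j, hj⟩ := mem_iUnion.1 (hC.covers.symm ▸ mem_univ (p + r • (x - p)))
    have hij : i ≠ j := by
      rintro rfl
      exact hrC hj
    have hjN : j ∈ hfin.toFinset.erase i := Finset.mem_erase.2 ⟨hij.symm,
      hfin.mem_toFinset.2 ⟨_, hj, Metric.thickening_subset_cthickening _ _ hr⟩⟩
    have h1 := (hfu j hij).2.2 _ hj
    have h2 := (hfu j hij).1 p hp
    have h3 : f j x ≤ u j := hx j hjN
    have h4 : f j (p + r • (x - p)) = (1 - r) * f j p + r * f j x := by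
      simp only [map_add, map_smul, map_sub, smul_eq_mul]
      ring
    have h5 : 0 < r := ht0.trans_lt hr1.1
    have h6 : r < 1 := hr1.2
    nlinarith

lemma IsTessellation.isPolytope (hC : IsTessellation C) (i : ℕ) : IsPolytope (C i) := by
  classical
  obtain ⟨N, f, u, hN⟩ := hC.exists_halfspaces i
  -- Extreme points with the same active constraints coincide.
  have hinj : InjOn (fun x => N.filter fun j => f j x = u j)
      ((C i : Set (Euc d)).extremePoints ℝ) := by
    intro x hx y hy hxy
    by_contra hne
    have hxy' : (N.filter fun j => f j x = u j) = N.filter fun j => f j y = u j := hxy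
    have hxC := hx.1
    have hyC := hy.1
    have hle : ∀ z ∈ (C i : Set (Euc d)), ∀ j ∈ N, f j z ≤ u j := fun z hz => by
      rw [hN] at hz
      exact hz
    have hev : ∀ᶠ ε in 𝓝[>] (0 : ℝ), ∀ j ∈ N, f j (x - ε • (y - x)) ≤ u j := by
      refine (Filter.eventually_all_finset N).2 fun j hj => ?_
      by_cases hact : f j x = u j
      · have hmem : j ∈ N.filter fun j => f j y = u j := by
          have h : j ∈ N.filter fun j => f j x = u j := by
            simp [hj, hact]
          rwa [hxy'] at h
        have hy' := (Finset.mem_filter.1 hmem).2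
        refine Eventually.of_forall fun ε => ?_
        simp [hact, hy']
      · have hlt : f j (x - (0 : ℝ) • (y - x)) < u j := by
          simpa using lt_of_le_of_ne (hle x hxC j hj) hact
        have hcont : Continuous fun ε : ℝ => f j (x - ε • (y - x)) := by fun_prop
        exact nhdsWithin_le_nhds ((hcont.continuousAt.eventually (gt_mem_nhds hlt)).mono
          fun ε h => h.le)
    obtain ⟨ε, hε, hε0⟩ := (hev.and self_mem_nhdsWithin).exists
    have hε0 : 0 < ε := hε0
    have hz : x - ε • (y - x) ∈ (C i : Set (Euc d)) := by
      rw [hN]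
      exact hε
    have hseg : x ∈ openSegment ℝ y (x - ε • (y - x)) := by
      refine ⟨ε / (1 + ε), 1 / (1 + ε), by positivity, by positivity, by field_simp; ring, ?_⟩
      have h1 : (1 : ℝ) / (1 + ε) * ε = ε / (1 + ε) := by ring
      have h2 : (1 : ℝ) / (1 + ε) = 1 - ε / (1 + ε) := by field_simp; ring
      have h3 : (1 / (1 + ε)) • (x - ε • (y - x)) =
        (1 / (1 + ε)) • x - ((1 / (1 + ε)) * ε) • (y - x) := by module
      rw [h3, h1, h2]
      module
    exact hne (hx.2 hyC hz hseg).symm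
  have hfin : ((C i : Set (Euc d)).extremePoints ℝ).Finite := by
    refine Set.Finite.of_finite_image ((N.powerset.finite_toSet).subset ?_) hinj
    rintro _ ⟨x, -, rfl⟩
    exact Finset.mem_coe.2 (Finset.mem_powerset.2 (Finset.filter_subset _ _))
  refine ⟨hfin.toFinset, ?_⟩
  rw [hfin.coe_toFinset, ← (hfin.isCompact_convexHull ℝ).isClosed.closure_eq,
    closure_convexHull_extremePoints (C i).isCompact (C i).convex]

lemma IsTessellation.vectorSpan_eq_top (hC : IsTessellation C) (i : ℕ) :
    vectorSpan ℝ (C i : Set (Euc d)) = ⊤ := by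
  have h := (C i).convex.interior_nonempty_iff_affineSpan_eq_top.1 (hC.interior_nonempty i)
  rw [← direction_affineSpan, h, AffineSubspace.direction_top]

/-- The union of the `(d - 1)`-facets of a tessellation is the complement of the union of the
interiors of the cells. A point `x` outside the interiors is in a cell `C i`; a generic segment near
`x` that leaves `C i` avoids the intersections `C i ∩ C j` of dimension at most `d - 2`, so it
leaves `C i` through a `(d - 1)`-facet. -/
theorem IsTessellation.facetUnion_eq (hC : IsTessellation C) (hd : 1 ≤ d) :
    facetUnion (d - 1) C = (⋃ n, interior (C n : Set (Euc d)))ᶜ := by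
  classical
  apply Subset.antisymm
  · rintro x ⟨F, ⟨I, hI, rfl, hdim⟩, hxF⟩ hx
    obtain ⟨n, hn⟩ := mem_iUnion.1 hx
    have hxI : ∀ i ∈ I, x ∈ C i := fun i hi => mem_iInter₂.1 hxF i hi
    have hall : ∀ i ∈ I, i = n := fun i hi => by
      by_contra hne
      exact disjoint_left.1 (hC.disjoint_interior (Ne.symm hne)) hn (hxI i hi)
    have hIn : I = {n} := Finset.eq_singleton_iff_nonempty_unique_mem.2 ⟨hI, hall⟩
    have h1 := hdim.2
    rw [hIn] at h1
    rw [Finset.set_biInter_singleton, hC.vectorSpan_eq_top n, finrank_top, finrank_euclideanSpace_fin] at h1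
    omega
  · intro x hx
    have hxint : ∀ n, x ∉ interior (C n : Set (Euc d)) := fun n hn => hx (mem_iUnion.2 ⟨n, hn⟩)
    obtain ⟨i, hi⟩ := mem_iUnion.1 (hC.covers.symm ▸ mem_univ x)
    -- A ball around `x` that meets only cells containing `x`.
    have hfin := hC.locally_finite _ (isCompact_closedBall x 1)
    obtain ⟨r, hr, hball⟩ : ∃ r > 0, ∀ y ∈ Metric.ball x r, ∀ j, y ∈ C j →
        x ∈ C j ∧ j ∈ hfin.toFinset := by
      have hev : ∀ᶠ y in 𝓝 x, ∀ j ∈ hfin.toFinset, x ∉ C j → y ∉ C j := by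
        refine (Filter.eventually_all_finset _).2 fun j _ => ?_
        by_cases hxj : x ∈ C j
        · exact Eventually.of_forall fun y h => absurd hxj h
        · exact Filter.mem_of_superset ((C j).isClosed.isOpen_compl.mem_nhds hxj)
            fun y hy _ => hy
      obtain ⟨r, hr, h⟩ := Metric.eventually_nhds_iff_ball.1
        (hev.and (Metric.ball_mem_nhds x one_pos))
      refine ⟨r, hr, fun y hy j hyj => ?_⟩
      have hj : j ∈ hfin.toFinset :=
        hfin.mem_toFinset.2 ⟨y, hyj, Metric.ball_subset_closedBall (h y hy).2⟩
      exact ⟨by_contra fun hxj => (h y hy).1 j hj hxj hyj, hj⟩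
    obtain ⟨p, hpb, hp⟩ : (Metric.ball x r ∩ interior (C i : Set (Euc d))).Nonempty := by
      have : x ∈ closure (interior (C i : Set (Euc d))) := by
        rw [hC.closure_interior]
        exact hi
      exact mem_closure_iff.1 this _ Metric.isOpen_ball (Metric.mem_ball_self hr)
    have hO : IsOpen (Metric.ball x r \ (C i : Set (Euc d))) :=
      Metric.isOpen_ball.sdiff (C i).isClosed
    have hOne : (Metric.ball x r \ (C i : Set (Euc d))).Nonempty := by
      rw [Set.nonempty_iff_ne_empty, Ne, Set.sdiff_eq_empty]
      exact fun hsub => hxint i (mem_interior.2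
        ⟨_, hsub, Metric.isOpen_ball, Metric.mem_ball_self hr⟩)
    let A : ℕ → AffineSubspace ℝ (Euc d) := fun j =>
      affineSpan ℝ (insert p ((C i : Set (Euc d)) ∩ C j))
    have hA : ∀ j, Module.finrank ℝ (vectorSpan ℝ ((C i : Set (Euc d)) ∩ C j)) + 1 < d →
        volume (A j : Set (Euc d)) = 0 := by
      intro j hj
      refine Measure.addHaar_affineSubspace _ _ fun htop => ?_
      have h1 := finrank_vectorSpan_insert_le_set ℝ ((C i : Set (Euc d)) ∩ C j) p
      rw [← direction_affineSpan, show affineSpan ℝ (insert p ((C i : Set (Euc d)) ∩ C j)) = ⊤ from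
        htop, AffineSubspace.direction_top, finrank_top, finrank_euclideanSpace_fin] at h1
      omega
    obtain ⟨q, hq, hqA⟩ : ∃ q ∈ Metric.ball x r \ (C i : Set (Euc d)), ∀ j ∈ hfin.toFinset,
        Module.finrank ℝ (vectorSpan ℝ ((C i : Set (Euc d)) ∩ C j)) + 1 < d → q ∉ A j := by
      by_contra! hcon
      have hsub : Metric.ball x r \ (C i : Set (Euc d)) ⊆ ⋃ j ∈ hfin.toFinset.filter (fun j =>
          Module.finrank ℝ (vectorSpan ℝ ((C i : Set (Euc d)) ∩ C j)) + 1 < d),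
          (A j : Set (Euc d)) := by
        intro q hq
        obtain ⟨j, hj, hjd, hqj⟩ := hcon q hq
        exact mem_iUnion₂.2 ⟨j, Finset.mem_filter.2 ⟨hj, hjd⟩, hqj⟩
      have hnull : volume (⋃ j ∈ hfin.toFinset.filter (fun j =>
          Module.finrank ℝ (vectorSpan ℝ ((C i : Set (Euc d)) ∩ C j)) + 1 < d),
          (A j : Set (Euc d))) = 0 :=
        (measure_biUnion_null_iff (Finset.countable_toSet _)).2 fun j hj =>
          hA j (Finset.mem_filter.1 hj).2
      exact (hO.measure_pos volume hOne).ne' (measure_mono_null hsub hnull)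
    obtain ⟨t, ht0, ht1, hyC, hlast⟩ :=
      exists_last_mem_segment (C i).isClosed (interior_subset hp) hq.2
    set y := p + t • (q - p) with hy
    -- The points beyond `y` are in finitely many other cells around `x`, hence so is `y`.
    have hD : IsClosed (⋃ j ∈ hfin.toFinset.filter (fun j => j ≠ i ∧ x ∈ C j),
        (C j : Set (Euc d))) :=
      isClosed_biUnion_finset fun j _ => (C j).isClosed
    have hyD : y ∈ ⋃ j ∈ hfin.toFinset.filter (fun j => j ≠ i ∧ x ∈ C j),
        (C j : Set (Euc d)) := by
      have hlim : Tendsto (fun s : ℝ => p + s • (q - p)) (𝓝[>] t) (𝓝 y) := by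
        have hcont : Continuous fun s : ℝ => p + s • (q - p) := by fun_prop
        exact hcont.continuousAt.mono_left nhdsWithin_le_nhds
      refine hD.mem_of_tendsto hlim ?_
      filter_upwards [Ioo_mem_nhdsGT ht1] with s hs
      have hsC := hlast s hs.1 hs.2.le
      have hsb : p + s • (q - p) ∈ Metric.ball x r :=
        (convex_ball x r).add_smul_sub_mem hpb hq.1 ⟨ht0.trans hs.1.le, hs.2.le⟩
      obtain ⟨j, hj⟩ := mem_iUnion.1 (hC.covers.symm ▸ mem_univ (p + s • (q - p)))
      refine mem_iUnion₂.2 ⟨j, Finset.mem_filter.2 ⟨(hball _ hsb j hj).2, ?_, (hball _ hsb j hj).1⟩,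
        hj⟩
      rintro rfl
      exact hsC hj
    obtain ⟨j, hj, hyj⟩ := mem_iUnion₂.1 hyD
    obtain ⟨hjN, hji, hxj⟩ := Finset.mem_filter.1 hj
    have ht : 0 < t := by
      refine lt_of_le_of_ne ht0 ?_
      rintro rfl
      have : p ∈ (C j : Set (Euc d)) := by simpa [hy] using hyj
      exact disjoint_left.1 (hC.disjoint_interior hji.symm) hp this
    have hqAj : q ∈ A j := by
      have h1 : p ∈ A j := subset_affineSpan ℝ _ (mem_insert _ _)
      have h2 : y ∈ A j := subset_affineSpan ℝ _ (mem_insert_of_mem _ ⟨hyC, hyj⟩)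
      have h3 := AffineMap.lineMap_mem (t⁻¹ : ℝ) h1 h2
      have h4 : AffineMap.lineMap p y (t⁻¹ : ℝ) = q := by
        rw [AffineMap.lineMap_apply, hy, vsub_eq_sub, add_sub_cancel_left, smul_smul,
          inv_mul_cancel₀ ht.ne', one_smul, vadd_eq_add, sub_add_cancel]
      rwa [h4] at h3
    have hge : ¬ Module.finrank ℝ (vectorSpan ℝ ((C i : Set (Euc d)) ∩ C j)) + 1 < d :=
      fun h => hqA j hjN h hqAj
    have hlt : Module.finrank ℝ (vectorSpan ℝ ((C i : Set (Euc d)) ∩ C j)) < d := by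
      by_contra hnlt
      have htop : vectorSpan ℝ ((C i : Set (Euc d)) ∩ C j) = ⊤ := by
        refine Submodule.eq_top_of_finrank_eq (le_antisymm (Submodule.finrank_le _) ?_)
        rw [finrank_euclideanSpace_fin]
        exact not_lt.1 hnlt
      have haff : affineSpan ℝ ((C i : Set (Euc d)) ∩ C j) = ⊤ :=
        (AffineSubspace.affineSpan_eq_top_iff_vectorSpan_eq_top_of_nonempty ℝ _ _
          (show (((C i : Set (Euc d)) ∩ C j)).Nonempty from ⟨x, hi, hxj⟩)).2 htop
      obtain ⟨z, hz⟩ :=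
        ((C i).convex.inter (C j).convex).interior_nonempty_iff_affineSpan_eq_top.2 haff
      rw [interior_inter] at hz
      exact disjoint_left.1 (hC.disjoint_interior hji.symm) hz.1 (interior_subset hz.2)
    have hset : (⋂ l ∈ ({i, j} : Finset ℕ), (C l : Set (Euc d))) = (C i : Set (Euc d)) ∩ C j := by
      simp
    have hfacet : IsFacet (d - 1) C ((C i : Set (Euc d)) ∩ C j) :=
      ⟨{i, j}, by simp, hset.symm, ⟨x, hi, hxj⟩, by omega⟩
    exact mem_sUnion.2 ⟨_, hfacet, hi, hxj⟩

lemma IsTessellation.codedSet_eq (hC : IsTessellation C) (hd : 1 ≤ d) :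
    codedSet d (code (cellMeasure C)) = facetUnion (d - 1) C := by
  rw [hC.facetUnion_eq hd, codedSet_code_cellMeasure]

end Tessellation

/-! ### Volumes and flats -/

section Volumes

variable {d : ℕ}

lemma vol_mono (k : ℕ) {S T : Set (Euc d)} (h : S ⊆ T) : vol k S ≤ vol k T := measure_mono h

lemma vol_image_isometry (k : ℕ) {n : ℕ} {g : Euc n → Euc d} (hg : Isometry g) (S : Set (Euc n)) :
    vol k (g '' S) = vol k S :=
  hg.euclideanHausdorffMeasure_image S

lemma vol_self (S : Set (Euc d)) : vol d S = volume S := by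
  rw [vol, EuclideanSpace.euclideanHausdorffMeasure_eq_volume]

/-- The embedding of the `n`-dimensional space as the flat spanned by the first `n` coordinate
directions. -/
def firstCoords {n : ℕ} (h : n ≤ d) : Euc n →ₗᵢ[ℝ] Euc d where
  toFun x := WithLp.toLp 2 fun i => if hi : (i : ℕ) < n then x ⟨i, hi⟩ else 0
  map_add' x y := by
    ext i
    by_cases hi : (i : ℕ) < n <;> simp [hi]
  map_smul' c x := by
    ext i
    by_cases hi : (i : ℕ) < n <;> simp [hi]
  norm_map' x := by
    simp only [LinearMap.coe_mk, AddHom.coe_mk, EuclideanSpace.norm_eq]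
    congr 1
    symm
    have hinj : Function.Injective (Fin.castLE h) := Fin.castLE_injective h
    rw [← Finset.sum_subset (Finset.subset_univ (Finset.univ.map ⟨_, hinj⟩)), Finset.sum_map]
    · simp
    · intro i _ hi
      have : ¬ (i : ℕ) < n := fun hlt => hi (by
        simp only [Finset.mem_map, Finset.mem_univ, Function.Embedding.coeFn_mk, true_and]
        exact ⟨⟨i, hlt⟩, rfl⟩)
      simp [this]

lemma firstCoords_apply {n : ℕ} (h : n ≤ d) (x : Euc n) (i : Fin d) :
    firstCoords h x i = if hi : (i : ℕ) < n then x ⟨i, hi⟩ else 0 := rfl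

lemma mem_range_firstCoords {n : ℕ} (h : n ≤ d) {y : Euc d} :
    y ∈ range (firstCoords h) ↔ ∀ i : Fin d, n ≤ (i : ℕ) → y i = 0 := by
  constructor
  · rintro ⟨x, rfl⟩ i hi
    rw [firstCoords_apply, dif_neg (not_lt.2 hi)]
  · intro hy
    refine ⟨WithLp.toLp 2 fun j => y (Fin.castLE h j), ?_⟩
    ext i
    rw [firstCoords_apply]
    split_ifs with hi
    · rfl
    · exact (hy i (not_lt.1 hi)).symm

lemma halfOpenSubcube_eq {k : ℕ} (h : k ≤ d) :
    halfOpenSubcube d k = firstCoords h '' halfOpenCube k := by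
  ext y
  constructor
  · intro hy
    have hy' : ∀ i : Fin d, if (i : ℕ) < k then y i ∈ Ico (0 : ℝ) 1 else y i = 0 := hy
    obtain ⟨x, rfl⟩ := (mem_range_firstCoords h).2 fun i hi => by
      have := hy' i
      rwa [if_neg (not_lt.2 hi)] at this
    refine ⟨x, fun j => ?_, rfl⟩
    have := hy' (Fin.castLE h j)
    simpa [firstCoords_apply] using this
  · rintro ⟨x, hx, rfl⟩ i
    have hx' : ∀ j, x j ∈ Ico (0 : ℝ) 1 := hx
    split_ifs with hi
    · rw [firstCoords_apply, dif_pos hi]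
      exact hx' _
    · rw [firstCoords_apply, dif_neg hi]

lemma det_linearIsometryEquiv (h : Euc d ≃ₗᵢ[ℝ] Euc d) :
    LinearMap.det (h.toLinearEquiv : Euc d →ₗ[ℝ] Euc d) = 1 ∨
      LinearMap.det (h.toLinearEquiv : Euc d →ₗ[ℝ] Euc d) = -1 := by
  let a := EuclideanSpace.basisFun (Fin d) ℝ
  have h1 := a.det_to_matrix_orthonormalBasis_real (a.map h)
  have h2 : a.toBasis.det (a.map h) = LinearMap.det (h.toLinearEquiv : Euc d →ₗ[ℝ] Euc d) := by
    have h3 := a.toBasis.det_comp (h.toLinearEquiv : Euc d →ₗ[ℝ] Euc d) a.toBasis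
    rw [Module.Basis.det_self, mul_one] at h3
    rw [← h3]
    congr 1
  rwa [h2] at h1

/-- Every subspace of dimension at most `k < d` is carried into the span of the first `k` coordinate
directions by a proper rotation; a reflection in the last coordinate corrects the determinant. -/
lemma exists_rotation_firstCoords {k : ℕ} (hkd : k < d) (V : Submodule ℝ (Euc d))
    (hV : Module.finrank ℝ V ≤ k) :
    ∃ h : Euc d ≃ₗᵢ[ℝ] Euc d, LinearMap.det (h.toLinearEquiv : Euc d →ₗ[ℝ] Euc d) = 1 ∧
      ∀ v ∈ V, h v ∈ range (firstCoords hkd.le) := by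
  let n := Module.finrank ℝ V
  have hn : n ≤ d := hV.trans hkd.le
  let L : V →ₗᵢ[ℝ] Euc d :=
    (firstCoords hn).comp (stdOrthonormalBasis ℝ V).repr.toLinearIsometry
  have hL : ∀ v : V, ∀ i : Fin d, k ≤ (i : ℕ) → L v i = 0 := fun v i hi =>
    (mem_range_firstCoords hn).1 ⟨_, rfl⟩ i (hV.trans hi)
  let h0 : Euc d ≃ₗᵢ[ℝ] Euc d := L.extend.toLinearIsometryEquiv rfl
  have hh0 : ∀ v ∈ V, ∀ i : Fin d, k ≤ (i : ℕ) → h0 v i = 0 := fun v hv i hi => by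
    have : h0 v = L ⟨v, hv⟩ := L.extend_apply ⟨v, hv⟩
    rw [this]
    exact hL _ i hi
  rcases det_linearIsometryEquiv h0 with hdet | hdet
  · exact ⟨h0, hdet, fun v hv => (mem_range_firstCoords _).2 (hh0 v hv)⟩
  · let e : Euc d := EuclideanSpace.single (⟨d - 1, by omega⟩ : Fin d) 1
    have he : e ≠ 0 := by simp [e]
    let r := (Submodule.span ℝ {e})ᗮ.reflection
    refine ⟨h0.trans r, ?_, fun v hv => ?_⟩
    · have h1 : ((h0.trans r).toLinearEquiv : Euc d →ₗ[ℝ] Euc d) =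
        (r.toLinearEquiv : Euc d →ₗ[ℝ] Euc d) ∘ₗ (h0.toLinearEquiv : Euc d →ₗ[ℝ] Euc d) := rfl
      rw [h1, LinearMap.det_comp, hdet]
      have h2 : LinearMap.det (r.toLinearEquiv : Euc d →ₗ[ℝ] Euc d) = -1 := by
        have := (Submodule.span ℝ {e})ᗮ.det_reflection
        rw [Submodule.orthogonal_orthogonal, finrank_span_singleton he, pow_one] at this
        exact this
      rw [h2]
      norm_num
    · have hfix : r (h0 v) = h0 v := by
        refine Submodule.reflection_mem_subspace_eq_self ?_
        rw [Submodule.mem_orthogonal_singleton_iff_inner_right]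
        simp only [e, EuclideanSpace.inner_single_left]
        rw [hh0 v hv _ (by simp; omega)]
        simp
      change r (h0 v) ∈ _
      rw [hfix]
      exact (mem_range_firstCoords _).2 (hh0 v hv)

/-- Every convex body of dimension at most `k < d` is the image under a proper rigid motion of a
convex body in the flat spanned by the first `k` coordinate directions. -/
lemma exists_motion_firstCoords {k : ℕ} (hkd : k < d) (A : ConvexBody (Euc d))
    (hA : Module.finrank ℝ (vectorSpan ℝ (A : Set (Euc d))) ≤ k) :
    ∃ g : Euc d ≃ᵃⁱ[ℝ] Euc d,
      LinearMap.det (g.linearIsometryEquiv.toLinearEquiv : Euc d →ₗ[ℝ] Euc d) = 1 ∧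
      ∃ A' : ConvexBody (Euc k), (A : Set (Euc d)) = g '' (firstCoords hkd.le '' A') := by
  obtain ⟨a, ha⟩ := A.nonempty
  obtain ⟨h, hdet, hV⟩ := exists_rotation_firstCoords hkd _ hA
  set ι := firstCoords hkd.le
  let g : Euc d ≃ᵃⁱ[ℝ] Euc d :=
    h.symm.toAffineIsometryEquiv.trans (AffineIsometryEquiv.constVAdd ℝ (Euc d) a)
  have hg : ∀ x, g x = a + h.symm x := fun x => rfl
  have himg : ∀ x ∈ (A : Set (Euc d)), ∃ y, g (ι y) = x := fun x hx => by
    obtain ⟨y, hy⟩ := hV (x - a) (vsub_mem_vectorSpan ℝ hx ha)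
    refine ⟨y, ?_⟩
    rw [hg, hy, h.symm_apply_apply, add_sub_cancel]
  have hiso : Isometry fun y => g (ι y) := g.isometry.comp ι.isometry
  refine ⟨g, ?_, ⟨(fun y => g (ι y)) ⁻¹' (A : Set (Euc d)), ?_, ?_, ?_⟩, ?_⟩
  · have h1 : (g.linearIsometryEquiv.toLinearEquiv : Euc d →ₗ[ℝ] Euc d) =
      (h.symm.toLinearEquiv : Euc d →ₗ[ℝ] Euc d) := by
      ext1 v
      have : g.linearIsometryEquiv v = h.symm v := by
        have := g.toAffineIsometry.map_vadd (0 : Euc d) v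
        have h2 : g (v + 0) = g.linearIsometryEquiv v + g 0 := this
        rw [hg, hg] at h2
        rw [map_zero, add_zero, add_zero, add_comm] at h2
        exact (add_right_cancel h2).symm
      exact this
    rw [h1]
    have h2 : (h.symm.toLinearEquiv : Euc d →ₗ[ℝ] Euc d) ∘ₗ
        (h.toLinearEquiv : Euc d →ₗ[ℝ] Euc d) = LinearMap.id := by
      ext1 v
      exact h.symm_apply_apply v
    have h3 := congrArg LinearMap.det h2
    rwa [LinearMap.det_comp, hdet, mul_one, LinearMap.det_id] at h3
  · have h1 : ((g.toAffineEquiv : Euc d →ᵃ[ℝ] Euc d).comp ι.toLinearMap.toAffineMap) =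
        (fun y => g (ι y)) := rfl
    rw [← h1]
    exact A.convex.affine_preimage _
  · exact hiso.isClosedEmbedding.isCompact_preimage A.isCompact
  · obtain ⟨y, hy⟩ := himg a ha
    exact ⟨y, by rw [mem_preimage, hy]; exact ha⟩
  · ext x
    constructor
    · intro hx
      obtain ⟨y, hy⟩ := himg x hx
      exact ⟨_, ⟨y, by simp [hy, hx], rfl⟩, hy⟩
    · rintro ⟨_, ⟨y, hy, rfl⟩, rfl⟩
      exact hy

/-! ### Cubes -/

/-- The cube `[0, s]^d` as a convex body (`0 ≤ s`). -/
def cubeBody (d : ℕ) (s : NNReal) : ConvexBody (Euc d) where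
  carrier := {x | ∀ i, x i ∈ Icc (0 : ℝ) s}
  convex' := by
    intro x hx y hy a b ha hb hab i
    exact (convex_Icc (0 : ℝ) s) (hx i) (hy i) ha hb hab
  isCompact' := by
    have h : {x : Euc d | ∀ i, x i ∈ Icc (0 : ℝ) s} =
        WithLp.toLp 2 '' (univ.pi fun _ => Icc (0 : ℝ) s) := by
      ext x
      constructor
      · intro hx
        exact ⟨fun i => x i, fun i _ => hx i, rfl⟩
      · rintro ⟨y, hy, rfl⟩ i
        exact hy i (mem_univ i)
    rw [h]
    exact (isCompact_univ_pi fun _ => isCompact_Icc).image (PiLp.continuous_toLp 2 _)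
  nonempty' := ⟨0, fun i => ⟨le_rfl, s.2⟩⟩

lemma mem_cubeBody {s : NNReal} {x : Euc d} : x ∈ cubeBody d s ↔ ∀ i, x i ∈ Icc (0 : ℝ) s :=
  Iff.rfl

lemma volume_cubeBody (s : NNReal) : volume (cubeBody d s : Set (Euc d)) = (s : ℝ≥0∞) ^ d := by
  have h : (cubeBody d s : Set (Euc d)) = WithLp.ofLp ⁻¹' (univ.pi fun _ => Icc (0 : ℝ) s) := by
    ext x
    exact ⟨fun hx i _ => hx i, fun hx i => hx i (mem_univ i)⟩
  rw [h, (PiLp.volume_preserving_ofLp (Fin d)).measure_preimage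
    (MeasurableSet.univ_pi fun _ => measurableSet_Icc).nullMeasurableSet, volume_pi_pi]
  simp

lemma measurableSet_halfOpenCube : MeasurableSet (halfOpenCube d) := by
  have h : halfOpenCube d = WithLp.ofLp ⁻¹' (univ.pi fun _ : Fin d => Ico (0 : ℝ) 1) := by
    ext x
    exact ⟨fun hx i _ => hx i, fun hx i => hx i (mem_univ i)⟩
  rw [h]
  exact (PiLp.volume_preserving_ofLp (Fin d)).measurable
    (MeasurableSet.univ_pi fun _ => measurableSet_Ico)

lemma volume_halfOpenCube : volume (halfOpenCube d) = 1 := by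
  have h : halfOpenCube d = WithLp.ofLp ⁻¹' (univ.pi fun _ : Fin d => Ico (0 : ℝ) 1) := by
    ext x
    exact ⟨fun hx i _ => hx i, fun hx i => hx i (mem_univ i)⟩
  rw [h, (PiLp.volume_preserving_ofLp (Fin d)).measure_preimage
    (MeasurableSet.univ_pi fun _ => measurableSet_Ico).nullMeasurableSet, volume_pi_pi]
  simp

/-- The side lengths `1 - 1 / (n + 2)` of closed cubes that exhaust the half-open unit cube. -/
noncomputable def cubeSide (n : ℕ) : NNReal := 1 - ((n : NNReal) + 2)⁻¹

lemma coe_cubeSide (n : ℕ) : (cubeSide n : ℝ) = 1 - ((n : ℝ) + 2)⁻¹ := by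
  have : ((n : NNReal) + 2)⁻¹ ≤ 1 := inv_le_one_of_one_le₀ (by
    have : (0 : NNReal) ≤ n := zero_le
    calc (1 : NNReal) ≤ 2 := by norm_num
      _ ≤ n + 2 := le_add_of_nonneg_left this)
  rw [cubeSide, NNReal.coe_sub this]
  simp

lemma cubeSide_pos (n : ℕ) : 0 < cubeSide n := by
  rw [← NNReal.coe_pos, coe_cubeSide, sub_pos]
  exact inv_lt_one_of_one_lt₀ (by have : (0 : ℝ) ≤ n := Nat.cast_nonneg n; linarith)

lemma cubeSide_lt_one (n : ℕ) : cubeSide n < 1 := by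
  rw [← NNReal.coe_lt_coe, coe_cubeSide, NNReal.coe_one]
  have : (0 : ℝ) < ((n : ℝ) + 2)⁻¹ := by positivity
  linarith

lemma monotone_cubeSide : Monotone cubeSide := by
  intro n m hnm
  rw [← NNReal.coe_le_coe, coe_cubeSide, coe_cubeSide]
  have : (n : ℝ) ≤ m := by exact_mod_cast hnm
  gcongr

lemma tendsto_cubeSide : Tendsto (fun n => (cubeSide n : ℝ)) atTop (𝓝 1) := by
  simp only [coe_cubeSide]
  have h1 : Tendsto (fun n : ℕ => (n : ℝ) + 2) atTop atTop :=
    tendsto_atTop_add_const_right _ _ tendsto_natCast_atTop_atTop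
  simpa using (tendsto_const_nhds (x := (1 : ℝ))).sub h1.inv_tendsto_atTop

lemma monotone_cubeBody : Monotone fun n => (cubeBody d (cubeSide n) : Set (Euc d)) := by
  intro n m hnm x hx i
  exact ⟨(hx i).1, (hx i).2.trans (NNReal.coe_le_coe.2 (monotone_cubeSide hnm))⟩

lemma iUnion_cubeBody : ⋃ n, (cubeBody d (cubeSide n) : Set (Euc d)) = halfOpenCube d := by
  apply Subset.antisymm
  · refine iUnion_subset fun n x hx i => ⟨(hx i).1, (hx i).2.trans_lt ?_⟩
    exact_mod_cast cubeSide_lt_one n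
  · intro x hx
    have hx' : ∀ i, x i ∈ Ico (0 : ℝ) 1 := hx
    have hev : ∀ᶠ n in atTop, ∀ i, x i ≤ cubeSide n :=
      eventually_all.2 fun i => (tendsto_cubeSide.eventually (lt_mem_nhds (hx' i).2)).mono
        fun n h => h.le
    obtain ⟨n, hn⟩ := hev.exists
    exact mem_iUnion.2 ⟨n, fun i => ⟨(hx' i).1, hn i⟩⟩

lemma iSup_volume_cubeBody : ⨆ n, volume (cubeBody d (cubeSide n) : Set (Euc d)) = 1 := by
  rw [← monotone_cubeBody.measure_iUnion, iUnion_cubeBody, volume_halfOpenCube]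

/-- Every bounded set is covered by finitely many translates of a given cube. -/
lemma exists_cover_cubes {S : Set (Euc d)} (hS : IsCompact S) {s : NNReal} (hs : 0 < s) :
    ∃ t : Finset (Euc d), S ⊆ ⋃ x ∈ t, (translate x (cubeBody d s) : Set (Euc d)) := by
  let c : Euc d := WithLp.toLp 2 fun _ => (s / 2 : ℝ)
  have hs' : (0 : ℝ) < s := hs
  have hnhds : (cubeBody d s : Set (Euc d)) ∈ 𝓝 c := by
    have : ∀ᶠ x : Euc d in 𝓝 c, ∀ i, x i ∈ Icc (0 : ℝ) s := eventually_all.2 fun i => by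
      have hcont : Continuous fun x : Euc d => x i := by fun_prop
      refine hcont.continuousAt.eventually (Icc_mem_nhds ?_ ?_)
      · simp [c, hs]
      · simp [c, hs]
    exact this
  obtain ⟨t, -, ht⟩ := hS.elim_nhds_subcover
    (fun x => (translate (x - c) (cubeBody d s) : Set (Euc d))) fun x _ => by
      have hcont : Continuous fun y : Euc d => y - (x - c) := by fun_prop
      have h0 : x - (x - c) = c := by abel
      have := hcont.continuousAt.preimage_mem_nhds (x := x) (by rw [h0]; exact hnhds)
      refine Filter.mem_of_superset this fun y hy => ?_
      exact mem_translate.2 hy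
  classical
  refine ⟨t.image fun x => x - c, fun y hy => ?_⟩
  obtain ⟨x, hx, hy⟩ := mem_iUnion₂.1 (ht hy)
  exact mem_iUnion₂.2 ⟨x - c, Finset.mem_image_of_mem _ hx, hy⟩

/-! ### Finiteness and translation integrals -/

lemma vol_convexBody_lt_top {k : ℕ} (hkd : k < d) (A : ConvexBody (Euc d))
    (hA : Module.finrank ℝ (vectorSpan ℝ (A : Set (Euc d))) ≤ k) : vol k (A : Set (Euc d)) < ∞ := by
  obtain ⟨g, -, A', hA'⟩ := exists_motion_firstCoords hkd A hA
  rw [hA', vol_image_isometry k g.isometry, vol_image_isometry k (firstCoords hkd.le).isometry,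
    vol_self]
  exact A'.isCompact.measure_lt_top

lemma vol_skeleton_lt_top {k : ℕ} (hkd : k < d) {C : ConvexBody (Euc d)} (hC : IsPolytope C) :
    vol k (skeleton k C) < ∞ := by
  obtain ⟨𝓕, h𝓕, h⟩ := exists_skeleton_eq_iUnion k hC
  rw [h]
  exact (measure_biUnion_finset_le 𝓕 _).trans_lt
    (ENNReal.sum_lt_top.2 fun A hA => vol_convexBody_lt_top hkd A (h𝓕 A hA))

lemma vol_convexBody_eq_zero {k : ℕ} (hk : 1 ≤ k) (hkd : k < d) (A : ConvexBody (Euc d))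
    (hA : Module.finrank ℝ (vectorSpan ℝ (A : Set (Euc d))) ≤ k - 1) :
    vol k (A : Set (Euc d)) = 0 :=
  (Measure.euclideanHausdorffMeasure_zero_or_top (Nat.sub_lt hk one_pos)
    (A : Set (Euc d))).resolve_right (vol_convexBody_lt_top (by omega) A hA).ne

lemma vol_skeleton_pred {k : ℕ} (hk : 1 ≤ k) (hkd : k < d) (C : ConvexBody (Euc d)) :
    vol k (skeleton (k - 1) C) = 0 := by
  by_cases hC : IsPolytope C
  · obtain ⟨𝓕, h𝓕, h⟩ := exists_skeleton_eq_iUnion (k - 1) hC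
    rw [h]
    exact (measure_biUnion_null_iff 𝓕.countable_toSet).2 fun A hA =>
      vol_convexBody_eq_zero hk hkd A (h𝓕 A hA)
  · have : skeleton (k - 1) C = ∅ := eq_empty_of_forall_notMem fun x hx => hC hx.1
    rw [this]
    exact measure_empty

/-- Volumes of subsets of the union of the `k`-faces and of the `k`-skeleton agree as soon as the
`(k - 1)`-skeleton is negligible. -/
lemma vol_inter_faceUnion_inter {j k : ℕ} {C : ConvexBody (Euc d)} (hC : IsPolytope C)
    (S T : Set (Euc d)) (hnull : vol j (S ∩ skeleton (k - 1) C) = 0) :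
    vol j (S ∩ faceUnion k C ∩ T) = vol j (S ∩ (skeleton k C ∩ T)) := by
  refine le_antisymm (vol_mono j fun x hx => ⟨hx.1.1, faceUnion_subset_skeleton hC hx.1.2, hx.2⟩) ?_
  have hsub : S ∩ (skeleton k C ∩ T) ⊆
      (S ∩ faceUnion k C ∩ T) ∪ (S ∩ skeleton (k - 1) C) := by
    rintro x ⟨hS, hx, hT⟩
    by_cases hF : x ∈ faceUnion k C
    · exact Or.inl ⟨⟨hS, hF⟩, hT⟩
    · exact Or.inr ⟨hS, skeleton_diff_faceUnion_subset ⟨hx, hF⟩⟩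
  refine (vol_mono j hsub).trans ((measure_union_le _ _).trans ?_)
  exact (add_le_add le_rfl hnull.le).trans_eq (add_zero _)

lemma vol_faceUnion_inter {k : ℕ} (hk : 1 ≤ k) (hkd : k < d) {C : ConvexBody (Euc d)}
    (hC : IsPolytope C) (T : Set (Euc d)) :
    vol k (faceUnion k C ∩ T) = vol k (skeleton k C ∩ T) := by
  have h := vol_inter_faceUnion_inter (j := k) (k := k) hC univ T
    (by rw [univ_inter]; exact vol_skeleton_pred hk hkd C)
  rwa [univ_inter, univ_inter] at h

/-- The integral over all translates of the measure of a translated set. -/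
lemma lintegral_measure_translate {n : ℕ} (ν : Measure (Euc n)) [SFinite ν] {W : Set (Euc n)}
    (hW : MeasurableSet W) :
    ∫⁻ x, ν {y | y + x ∈ W} = ν univ * volume W := by
  have hmeas : MeasurableSet {p : Euc n × Euc n | p.2 + p.1 ∈ W} :=
    (measurable_snd.add measurable_fst) hW
  have h1 : ∀ x, ν {y | y + x ∈ W} =
      ∫⁻ y, indicator {p : Euc n × Euc n | p.2 + p.1 ∈ W} 1 (x, y) ∂ν := fun x => by
    have hx : MeasurableSet {y : Euc n | y + x ∈ W} := (measurable_id.add_const x) hW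
    rw [← lintegral_indicator_one hx]
    rfl
  simp_rw [h1]
  rw [lintegral_lintegral_swap]
  · have h2 : ∀ y, ∫⁻ x, indicator {p : Euc n × Euc n | p.2 + p.1 ∈ W} 1 (x, y) = volume W := by
      intro y
      have hy : MeasurableSet ((fun x => y + x) ⁻¹' W) := (measurable_const_add y) hW
      rw [← measure_preimage_add volume y W, ← lintegral_indicator_one hy]
      rfl
    simp_rw [h2]
    rw [lintegral_const, mul_comm]
  · exact (measurable_one.indicator hmeas).aemeasurable

end Volumes

/-! ### Flat sections of a motion-invariant random closed set -/

section FlatSections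

variable {d : ℕ}

/-- The law `Q` of a random code is invariant in the sense that the volumes of the coded random set
in congruent compact sets have the same law. -/
def IsInvariantLaw (d : ℕ) (Q : Measure Code) : Prop :=
  ∀ g : Euc d ≃ᵃⁱ[ℝ] Euc d,
    LinearMap.det (g.linearIsometryEquiv.toLinearEquiv : Euc d →ₗ[ℝ] Euc d) = 1 →
    ∀ (j : ℕ) (K : Set (Euc d)), IsCompact K →
      IdentDistrib (fun t => vol j (codedSet d t ∩ g '' K)) (fun t => vol j (codedSet d t ∩ K)) Q Q

/-- The mean `j`-volume of the coded random set in a compact set `K`. -/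
noncomputable def meanVol (Q : Measure Code) (j : ℕ) (K : Set (Euc d)) : ℝ≥0∞ :=
  ∫⁻ t, vol j (codedSet d t ∩ K) ∂Q

lemma measurable_vol_codedSet_const (j : ℕ) {K : Set (Euc d)} (hK : IsCompact K) :
    Measurable fun t : Code => vol j (codedSet d t ∩ K) := by
  have h := measurable_vol_codedSet_inter (p := Unit) j (K := fun _ => K) (fun _ => hK)
    (fun _ _ => MeasurableSet.const _)
  have h2 : Measurable fun t : Code => (t, ()) := measurable_id.prodMk measurable_const
  have h3 := h.comp h2
  exact h3

lemma IsInvariantLaw.meanVol_image {Q : Measure Code} (hQ : IsInvariantLaw d Q)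
    (g : Euc d ≃ᵃⁱ[ℝ] Euc d)
    (hg : LinearMap.det (g.linearIsometryEquiv.toLinearEquiv : Euc d →ₗ[ℝ] Euc d) = 1)
    (j : ℕ) {K : Set (Euc d)} (hK : IsCompact K) : meanVol Q j (g '' K) = meanVol Q j K :=
  (hQ g hg j K hK).lintegral_eq

lemma det_constVAdd (x : Euc d) :
    LinearMap.det ((AffineIsometryEquiv.constVAdd ℝ (Euc d) x).linearIsometryEquiv.toLinearEquiv :
      Euc d →ₗ[ℝ] Euc d) = 1 := by
  have : ((AffineIsometryEquiv.constVAdd ℝ (Euc d) x).linearIsometryEquiv.toLinearEquiv :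
      Euc d →ₗ[ℝ] Euc d) = LinearMap.id := by
    ext1 v
    rfl
  rw [this, LinearMap.det_id]

lemma IsInvariantLaw.meanVol_translate {Q : Measure Code} (hQ : IsInvariantLaw d Q) (x : Euc d)
    (j : ℕ) {K : Set (Euc d)} (hK : IsCompact K) :
    meanVol Q j ((fun y => x + y) '' K) = meanVol Q j K :=
  hQ.meanVol_image (AffineIsometryEquiv.constVAdd ℝ (Euc d) x) (det_constVAdd x) j hK

/-- The convex body in the flat of the first `k` coordinates given by a convex body in the
`k`-dimensional space. -/
def embedBody {k : ℕ} (h : k ≤ d) (A : ConvexBody (Euc k)) : ConvexBody (Euc d) where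
  carrier := firstCoords h '' A
  convex' := A.convex.is_linear_image (firstCoords h).toLinearMap.isLinear
  isCompact' := A.isCompact.image (firstCoords h).continuous
  nonempty' := A.nonempty.image _

lemma embedBody_translate {k : ℕ} (h : k ≤ d) (x : Euc k) (A : ConvexBody (Euc k)) :
    embedBody h (translate x A) = translate (firstCoords h x) (embedBody h A) := by
  apply ConvexBody.ext
  change firstCoords h '' ((fun y => x + y) '' A) =
    (fun y => firstCoords h x + y) '' (firstCoords h '' A)
  simp only [image_image, map_add]

variable {k : ℕ} {Q : Measure Code}

lemma measurable_vol_codedSet_translate (h : k ≤ d) (j : ℕ) (A I : ConvexBody (Euc k)) :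
    Measurable fun q : Code × Euc k => vol j (codedSet d q.1 ∩
      ((embedBody h A : Set (Euc d)) ∩ embedBody h (translate (-q.2) I))) := by
  have h1 : Measurable fun z : Euc k => embedBody h (translate (-z) I) := by
    simp_rw [embedBody_translate]
    have : Continuous fun z : Euc k => translate (firstCoords h (-z)) (embedBody h I) :=
      continuous_translate.comp
        (((firstCoords h).continuous.comp continuous_neg).prodMk continuous_const)
    exact this.measurable
  have h2 : Measurable fun q : Code × Euc k =>
      (q.1, (embedBody h A, embedBody h (translate (-q.2) I))) :=
    measurable_fst.prodMk (measurable_const.prodMk (h1.comp measurable_snd))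
  have h3 := (measurable_vol_codedSet_bodies (d := d) j).comp h2
  exact h3

/-- Volumes in the flat of the first `k` coordinates may be computed in the `k`-dimensional
space. -/
lemma vol_inter_firstCoords (h : k ≤ d) (j : ℕ) (F : Set (Euc d)) (S : Set (Euc k)) :
    vol j (F ∩ firstCoords h '' S) = vol j (firstCoords h ⁻¹' F ∩ S) := by
  rw [← vol_image_isometry j (firstCoords h).isometry, image_preimage_inter]

lemma lintegral_meanVol_translate [SFinite Q] (h : k ≤ d) (j : ℕ) (A I : ConvexBody (Euc k))
    (hA : meanVol Q j (embedBody h A : Set (Euc d)) ≠ ∞) :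
    ∫⁻ z, meanVol Q j ((embedBody h A : Set (Euc d)) ∩ embedBody h (translate (-z) I)) =
      meanVol Q j (embedBody h A : Set (Euc d)) * volume (I : Set (Euc k)) := by
  have hm := measurable_vol_codedSet_translate h j A I
  have hm' := hm.comp measurable_swap
  have hswap := lintegral_lintegral_swap (μ := (volume : Measure (Euc k))) (ν := Q)
    (f := fun z t => vol j (codedSet d t ∩
      ((embedBody h A : Set (Euc d)) ∩ embedBody h (translate (-z) I)))) hm'.aemeasurable
  simp only [meanVol]
  rw [hswap, ← lintegral_mul_const]
  swap
  · exact measurable_vol_codedSet_const j (embedBody h A).isCompact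
  have hfin := ae_lt_top (measurable_vol_codedSet_const j (embedBody h A).isCompact) hA
  refine lintegral_congr_ae (hfin.mono fun t ht => ?_)
  -- For a fixed realization this is an integral over translates of a finite measure.
  have hset : ∀ S : Set (Euc k), vol j (codedSet d t ∩ firstCoords h '' S) =
      vol j (firstCoords h ⁻¹' codedSet d t ∩ S) := vol_inter_firstCoords h j _
  have hA' : vol j (codedSet d t ∩ (embedBody h A : Set (Euc d))) =
      vol j (firstCoords h ⁻¹' codedSet d t ∩ A) := hset A
  rw [hA'] at ht
  let ν : Measure (Euc k) :=
    (Measure.euclideanHausdorffMeasure j).restrict (firstCoords h ⁻¹' codedSet d t ∩ A)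
  have : IsFiniteMeasure ν := ⟨by rw [Measure.restrict_apply_univ]; exact ht⟩
  have hν := lintegral_measure_translate ν I.isClosed.measurableSet
  rw [Measure.restrict_apply_univ] at hν
  change _ = vol j (codedSet d t ∩ (embedBody h A : Set (Euc d))) * _
  rw [hA']
  refine Eq.trans (lintegral_congr fun z => ?_) hν
  have hmeas : MeasurableSet {y | y + z ∈ (I : Set (Euc k))} :=
    (measurable_id.add_const z) I.isClosed.measurableSet
  rw [Measure.restrict_apply hmeas]
  have hinter : (embedBody h A : Set (Euc d)) ∩ embedBody h (translate (-z) I) =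
      firstCoords h '' ((A : Set (Euc k)) ∩ translate (-z) I) :=
    (image_inter (firstCoords h).injective).symm
  rw [hinter, hset, coe_translate_neg]
  change vol j _ = vol j _
  congr 1
  ext y
  simp only [mem_inter_iff, SetLike.mem_coe]
  change _ ↔ (y + z ∈ I) ∧ _
  tauto

/-- The mean volume in a body `A` of the flat and the mean volume in a body `I` of the flat are in
the ratio of the volumes of the bodies: average over the translates of one body relative to the
other. -/
lemma IsInvariantLaw.meanVol_mul_volume [SFinite Q] (hQ : IsInvariantLaw d Q) (h : k ≤ d) (j : ℕ)
    (A I : ConvexBody (Euc k)) (hA : meanVol Q j (embedBody h A : Set (Euc d)) ≠ ∞)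
    (hI : meanVol Q j (embedBody h I : Set (Euc d)) ≠ ∞) :
    meanVol Q j (embedBody h A : Set (Euc d)) * volume (I : Set (Euc k)) =
      meanVol Q j (embedBody h I : Set (Euc d)) * volume (A : Set (Euc k)) := by
  rw [← lintegral_meanVol_translate h j A I hA, ← lintegral_meanVol_translate h j I A hI,
    ← lintegral_neg_eq_self]
  refine lintegral_congr fun z => ?_
  rw [neg_neg, ← hQ.meanVol_translate (firstCoords h (-z)) j
    ((embedBody h A).isCompact.inter (embedBody h (translate z I)).isCompact)]
  congr 1
  have h1 : ∀ B : ConvexBody (Euc k), (fun y => firstCoords h (-z) + y) '' (embedBody h B) =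
      (embedBody h (translate (-z) B) : Set (Euc d)) := fun B => by
    rw [embedBody_translate]
    rfl
  rw [image_inter (add_right_injective _), h1, h1, translate_translate, neg_add_cancel,
    translate_zero, inter_comm]

/-- The mean `j`-volume of the coded random set in the unit cube of the flat of the first `k`
coordinates. -/
noncomputable def flatIntensity (d : ℕ) (Q : Measure Code) (j k : ℕ) : ℝ≥0∞ :=
  ∫⁻ t, vol j (codedSet d t ∩ halfOpenSubcube d k) ∂Q

lemma monotone_embedBody_cubeBody (h : k ≤ d) :
    Monotone fun n => (embedBody h (cubeBody k (cubeSide n)) : Set (Euc d)) :=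
  fun _ _ hnm => image_mono (monotone_cubeBody hnm)

lemma vol_inter_halfOpenSubcube (h : k ≤ d) (j : ℕ) (F : Set (Euc d)) :
    vol j (F ∩ halfOpenSubcube d k) =
      ⨆ n, vol j (F ∩ embedBody h (cubeBody k (cubeSide n))) := by
  have hU : halfOpenSubcube d k = ⋃ n, (embedBody h (cubeBody k (cubeSide n)) : Set (Euc d)) := by
    rw [halfOpenSubcube_eq h, ← iUnion_cubeBody, image_iUnion]
    rfl
  rw [hU, inter_iUnion]
  exact Monotone.measure_iUnion fun n m hnm =>
    inter_subset_inter_right _ (monotone_embedBody_cubeBody h hnm)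

lemma measurable_vol_codedSet_halfOpenSubcube (h : k ≤ d) (j : ℕ) :
    Measurable fun t : Code => vol j (codedSet d t ∩ halfOpenSubcube d k) := by
  simp only [vol_inter_halfOpenSubcube h]
  exact Measurable.iSup fun n =>
    measurable_vol_codedSet_const j (embedBody h (cubeBody k (cubeSide n))).isCompact

lemma flatIntensity_eq_iSup (h : k ≤ d) (j : ℕ) :
    flatIntensity d Q j k =
      ⨆ n, meanVol Q j (embedBody h (cubeBody k (cubeSide n)) : Set (Euc d)) := by
  simp only [meanVol, flatIntensity, vol_inter_halfOpenSubcube h]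
  exact lintegral_iSup
    (fun n => measurable_vol_codedSet_const j (embedBody h (cubeBody k (cubeSide n))).isCompact)
    fun n m hnm t => vol_mono j (inter_subset_inter_right _ (monotone_embedBody_cubeBody h hnm))

lemma IsInvariantLaw.meanVol_embedBody_ne_top (hQ : IsInvariantLaw d Q) (h : k ≤ d) (j : ℕ)
    (hfin : flatIntensity d Q j k ≠ ∞) (A : ConvexBody (Euc k)) :
    meanVol Q j (embedBody h A : Set (Euc d)) ≠ ∞ := by
  obtain ⟨T, hT⟩ := exists_cover_cubes A.isCompact (cubeSide_pos 0)
  have hcube : ∀ x, meanVol Q j (embedBody h (translate x (cubeBody k (cubeSide 0))) :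
      Set (Euc d)) ≤ flatIntensity d Q j k := fun x => by
    rw [embedBody_translate, coe_translate, hQ.meanVol_translate _ _ (embedBody h _).isCompact,
      flatIntensity_eq_iSup h j]
    exact le_iSup (fun n => meanVol Q j (embedBody h (cubeBody k (cubeSide n)) : Set (Euc d))) 0
  have hle : meanVol Q j (embedBody h A : Set (Euc d)) ≤
      ∑ x ∈ T, meanVol Q j (embedBody h (translate x (cubeBody k (cubeSide 0))) :
        Set (Euc d)) := by
    simp only [meanVol]
    rw [← lintegral_finsetSum _ fun x _ =>
      measurable_vol_codedSet_const j (embedBody h (translate x _)).isCompact]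
    refine lintegral_mono fun t => ?_
    refine (vol_mono j (T := ⋃ x ∈ T, codedSet d t ∩
      (embedBody h (translate x (cubeBody k (cubeSide 0))) : Set (Euc d))) ?_).trans
      (measure_biUnion_finset_le _ _)
    rintro _ ⟨hF, y, hy, rfl⟩
    obtain ⟨x, hx, hyx⟩ := mem_iUnion₂.1 (hT hy)
    exact mem_iUnion₂.2 ⟨x, hx, hF, y, hyx, rfl⟩
  refine ((hle.trans (Finset.sum_le_sum fun x _ => hcube x)).trans_lt ?_).ne
  rw [Finset.sum_const, nsmul_eq_mul]
  exact ENNReal.mul_lt_top (ENNReal.natCast_lt_top _) hfin.lt_top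

lemma IsInvariantLaw.meanVol_embedBody [SFinite Q] (hQ : IsInvariantLaw d Q) (h : k ≤ d) (j : ℕ)
    (hfin : flatIntensity d Q j k ≠ ∞) (A : ConvexBody (Euc k)) :
    meanVol Q j (embedBody h A : Set (Euc d)) =
      flatIntensity d Q j k * volume (A : Set (Euc k)) := by
  have h1 := fun n => hQ.meanVol_mul_volume h j A (cubeBody k (cubeSide n))
    (hQ.meanVol_embedBody_ne_top h j hfin A) (hQ.meanVol_embedBody_ne_top h j hfin _)
  have h2 := congrArg iSup (funext h1)
  rwa [← ENNReal.mul_iSup, iSup_volume_cubeBody, mul_one, ← ENNReal.iSup_mul,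
    ← flatIntensity_eq_iSup h j] at h2

/-- **Mean section formula**, for a convex body in a `k`-flat. -/
lemma IsInvariantLaw.meanVol_convexBody [SFinite Q] (hQ : IsInvariantLaw d Q) (hkd : k < d) (j : ℕ)
    (hfin : flatIntensity d Q j k ≠ ∞) (A : ConvexBody (Euc d))
    (hA : Module.finrank ℝ (vectorSpan ℝ (A : Set (Euc d))) ≤ k) :
    meanVol Q j (A : Set (Euc d)) = flatIntensity d Q j k * vol k (A : Set (Euc d)) := by
  obtain ⟨g, hg, A', hA'⟩ := exists_motion_firstCoords hkd A hA
  rw [hA', vol_image_isometry k g.isometry, vol_image_isometry k (firstCoords hkd.le).isometry,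
    vol_self, ← hQ.meanVol_embedBody hkd.le j hfin A']
  exact hQ.meanVol_image g hg j (embedBody hkd.le A').isCompact

/-- The mean section formula for finite unions of compact convex sets in `k`-flats, by
inclusion-exclusion. -/
lemma IsInvariantLaw.meanVol_biUnion [SFinite Q] (hQ : IsInvariantLaw d Q) (hkd : k < d) (j : ℕ)
    (hfin : flatIntensity d Q j k ≠ ∞) {ι : Type*} (s : Finset ι) :
    ∀ S : ι → Set (Euc d), (∀ i, Convex ℝ (S i) ∧ IsCompact (S i) ∧
        Module.finrank ℝ (vectorSpan ℝ (S i)) ≤ k) →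
      meanVol Q j (⋃ i ∈ s, S i) = flatIntensity d Q j k * vol k (⋃ i ∈ s, S i) := by
  classical
  have hone : ∀ S : Set (Euc d), Convex ℝ S → IsCompact S →
      Module.finrank ℝ (vectorSpan ℝ S) ≤ k →
      meanVol Q j S = flatIntensity d Q j k * vol k S ∧ vol k S < ∞ := by
    intro S h1 h2 h3
    rcases S.eq_empty_or_nonempty with rfl | hne
    · simp [meanVol, vol]
    · exact ⟨hQ.meanVol_convexBody hkd j hfin ⟨S, h1, h2, hne⟩ h3,
        vol_convexBody_lt_top hkd ⟨S, h1, h2, hne⟩ h3⟩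
  induction s using Finset.induction_on with
  | empty => intro S _; simp [meanVol, vol]
  | insert a s ha ih =>
    intro S hS
    obtain ⟨ha1, ha2, ha3⟩ := hS a
    have hU : IsCompact (⋃ i ∈ s, S i) := s.isCompact_biUnion fun i _ => (hS i).2.1
    have hinter : S a ∩ (⋃ i ∈ s, S i) = ⋃ i ∈ s, S a ∩ S i := by
      rw [inter_iUnion₂]
    have hIH := ih (fun i => S a ∩ S i) fun i => ⟨ha1.inter (hS i).1, ha2.inter (hS i).2.1,
      (Submodule.finrank_mono (vectorSpan_mono ℝ inter_subset_left)).trans ha3⟩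
    rw [← hinter] at hIH
    have hadd : meanVol Q j (S a ∪ ⋃ i ∈ s, S i) + meanVol Q j (S a ∩ ⋃ i ∈ s, S i) =
        meanVol Q j (S a) + meanVol Q j (⋃ i ∈ s, S i) := by
      simp only [meanVol]
      rw [← lintegral_add_left (measurable_vol_codedSet_const j (ha2.union hU)),
        ← lintegral_add_left (measurable_vol_codedSet_const j ha2)]
      refine lintegral_congr fun t => ?_
      have := measure_union_add_inter (μ := Measure.euclideanHausdorffMeasure j)
        (codedSet d t ∩ S a)
        (((isClosed_codedSet (d := d) t).inter hU.isClosed).measurableSet)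
      rw [← inter_union_distrib_left, ← inter_inter_distrib_left] at this
      exact this
    have hvol : vol k (S a ∪ ⋃ i ∈ s, S i) + vol k (S a ∩ ⋃ i ∈ s, S i) =
        vol k (S a) + vol k (⋃ i ∈ s, S i) :=
      measure_union_add_inter _ hU.isClosed.measurableSet
    have hfin' : flatIntensity d Q j k * vol k (S a ∩ ⋃ i ∈ s, S i) ≠ ∞ :=
      ENNReal.mul_ne_top hfin
        ((vol_mono k inter_subset_left).trans_lt (hone _ ha1 ha2 ha3).2).ne
    rw [Finset.set_biUnion_insert]
    refine (ENNReal.add_left_inj hfin').1 ?_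
    rw [← mul_add, hvol, mul_add, ← (hone _ ha1 ha2 ha3).1, ← ih S hS, ← hadd, hIH]

/-- **Mean section formula**, for the part of the `k`-skeleton of a polytope in a convex body. -/
lemma IsInvariantLaw.meanVol_skeleton [SFinite Q] (hQ : IsInvariantLaw d Q) (hkd : k < d) (j : ℕ)
    (hfin : flatIntensity d Q j k ≠ ∞) {l : ℕ} (hl : l ≤ k) (C W : ConvexBody (Euc d)) :
    meanVol Q j (skeleton l C ∩ W) = flatIntensity d Q j k * vol k (skeleton l C ∩ W) := by
  by_cases hC : IsPolytope C
  · obtain ⟨𝓕, h𝓕, h⟩ := exists_skeleton_eq_iUnion l hC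
    have h' : skeleton l C ∩ W = ⋃ A ∈ 𝓕.attach, (A.1 : Set (Euc d)) ∩ W := by
      rw [h, iUnion₂_inter]
      ext x
      simp only [mem_iUnion, Finset.mem_attach, exists_prop, true_and, Subtype.exists]
    rw [h']
    exact hQ.meanVol_biUnion hkd j hfin 𝓕.attach (fun A => (A.1 : Set (Euc d)) ∩ W)
      fun A => ⟨A.1.convex.inter W.convex, A.1.isCompact.inter W.isCompact,
        (Submodule.finrank_mono (vectorSpan_mono ℝ inter_subset_left)).trans
          ((h𝓕 A.1 A.2).trans hl)⟩
  · have : skeleton l C = ∅ := eq_empty_of_forall_notMem fun x hx => hC hx.1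
    simp [this, meanVol, vol]

end FlatSections

/-! ### Second moments of marked sums -/

section Moments

variable {Ω : Type*} [MeasurableSpace Ω] {P : Measure Ω}

lemma lintegral_sq_le [IsProbabilityMeasure P] {f : Ω → ℝ≥0∞} (hf : AEMeasurable f P) :
    (∫⁻ ω, f ω ∂P) ^ 2 ≤ ∫⁻ ω, f ω ^ 2 ∂P := by
  have h := ENNReal.lintegral_mul_le_Lp_mul_Lq P Real.HolderConjugate.two_two hf
    (aemeasurable_const (b := (1 : ℝ≥0∞)))
  simp only [Pi.mul_apply, mul_one, ENNReal.one_rpow, lintegral_const, measure_univ] at h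
  calc (∫⁻ ω, f ω ∂P) ^ 2 ≤ ((∫⁻ ω, f ω ^ (2 : ℝ) ∂P) ^ (1 / (2 : ℝ))) ^ 2 := by
        gcongr
    _ = ∫⁻ ω, f ω ^ 2 ∂P := by
        rw [← ENNReal.rpow_natCast, ← ENNReal.rpow_mul]
        norm_num

/-- The variance is the second moment minus the square of the mean, in `[0,∞]`. -/
lemma var_add_sq [IsProbabilityMeasure P] {f : Ω → ℝ≥0∞} (hf : AEMeasurable f P)
    (hfin : ∫⁻ ω, f ω ∂P ≠ ∞) :
    var P f + (∫⁻ ω, f ω ∂P) ^ 2 = ∫⁻ ω, f ω ^ 2 ∂P := by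
  have hae : ∀ᵐ ω ∂P, f ω < ∞ := ae_lt_top' hf hfin
  rw [var, evariance_def' hf.ennreal_toReal.aestronglyMeasurable, integral_toReal hf hae,
    ENNReal.ofReal_pow ENNReal.toReal_nonneg, ENNReal.ofReal_toReal hfin]
  have h : ∫⁻ ω, ‖(f ω).toReal‖ₑ ^ 2 ∂P = ∫⁻ ω, f ω ^ 2 ∂P := by
    refine lintegral_congr_ae (hae.mono fun ω hω => ?_)
    change ‖(f ω).toReal‖ₑ ^ 2 = f ω ^ 2
    rw [Real.enorm_of_nonneg ENNReal.toReal_nonneg, ENNReal.ofReal_toReal hω.ne]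
  rw [h, tsub_add_cancel_of_le (lintegral_sq_le hf)]

lemma var_congr {f g : Ω → ℝ≥0∞} (h : f =ᵐ[P] g) : var P f = var P g :=
  evariance_congr (h.mono fun ω hω => by simp [hω])

lemma lintegral_indepFun {A B : Type*} [MeasurableSpace A] [MeasurableSpace B]
    [IsProbabilityMeasure P] {U : Ω → A} {V : Ω → B} (hU : Measurable U) (hV : Measurable V)
    (h : IndepFun U V P) {g : A → B → ℝ≥0∞} (hg : Measurable (Function.uncurry g)) :
    ∫⁻ ω, g (U ω) (V ω) ∂P = ∫⁻ ω, ∫⁻ b, g (U ω) b ∂(P.map V) ∂P := by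
  have hmap := (indepFun_iff_map_prod_eq_prod_map_map hU.aemeasurable hV.aemeasurable).1 h
  have : IsProbabilityMeasure (P.map V) := Measure.isProbabilityMeasure_map hV.aemeasurable
  have : IsProbabilityMeasure (P.map U) := Measure.isProbabilityMeasure_map hU.aemeasurable
  calc ∫⁻ ω, g (U ω) (V ω) ∂P
      = ∫⁻ p, Function.uncurry g p ∂(P.map fun ω => (U ω, V ω)) :=
        (lintegral_map hg (hU.prodMk hV)).symm
    _ = ∫⁻ a, ∫⁻ b, g a b ∂(P.map V) ∂(P.map U) := by
        rw [hmap, lintegral_prod _ hg.aemeasurable]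
        rfl
    _ = _ := lintegral_map hg.lintegral_prod_right' hU

variable {A B : Type*} [MeasurableSpace A] [MeasurableSpace B] {ξ : ℕ → Ω → A} {β : ℕ → Ω → B}
  {Q : Measure B} {Ψ : A → B → ℝ≥0∞}

lemma lintegral_mark [IsProbabilityMeasure P] (hξ : ∀ n, Measurable (ξ n))
    (hβ : ∀ n, Measurable (β n)) (hlaw : ∀ n, P.map (β n) = Q)
    (hind : IndepFun (fun ω n => ξ n ω) (fun ω n => β n ω) P)
    (hΨ : Measurable (Function.uncurry Ψ)) (n : ℕ) :
    ∫⁻ ω, Ψ (ξ n ω) (β n ω) ∂P = ∫⁻ ω, ∫⁻ b, Ψ (ξ n ω) b ∂Q ∂P := by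
  have h : IndepFun (ξ n) (β n) P := hind.comp (measurable_pi_apply n) (measurable_pi_apply n)
  rw [lintegral_indepFun (hξ n) (hβ n) h hΨ, hlaw]

/-- The mean of a sum over independently marked points. -/
lemma lintegral_tsum_mark [IsProbabilityMeasure P] (hξ : ∀ n, Measurable (ξ n))
    (hβ : ∀ n, Measurable (β n)) (hlaw : ∀ n, P.map (β n) = Q)
    (hind : IndepFun (fun ω n => ξ n ω) (fun ω n => β n ω) P)
    (hΨ : Measurable (Function.uncurry Ψ)) [SFinite Q] :
    ∫⁻ ω, ∑' n, Ψ (ξ n ω) (β n ω) ∂P = ∫⁻ ω, ∑' n, ∫⁻ b, Ψ (ξ n ω) b ∂Q ∂P := by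
  have hm1 : ∀ n, Measurable fun ω => Ψ (ξ n ω) (β n ω) := fun n =>
    hΨ.comp ((hξ n).prodMk (hβ n))
  have he : Measurable fun a => ∫⁻ b, Ψ a b ∂Q := hΨ.lintegral_prod_right'
  have hm2 : ∀ n, Measurable fun ω => ∫⁻ b, Ψ (ξ n ω) b ∂Q := fun n => he.comp (hξ n)
  rw [lintegral_tsum fun n => (hm1 n).aemeasurable, lintegral_tsum fun n => (hm2 n).aemeasurable]
  exact tsum_congr fun n => lintegral_mark hξ hβ hlaw hind hΨ n

/-- The second moment of a sum over points `ξ n` with independent and identically distributed marks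
`β n`: the conditional variances, given the points, of the summands add up. -/
lemma lintegral_tsum_mark_sq [IsProbabilityMeasure P] (hξ : ∀ n, Measurable (ξ n))
    (hβ : ∀ n, Measurable (β n)) (hlaw : ∀ n, P.map (β n) = Q) (hiid : iIndepFun β P)
    (hind : IndepFun (fun ω n => ξ n ω) (fun ω n => β n ω) P)
    (hΨ : Measurable (Function.uncurry Ψ)) [SFinite Q] {v : A → ℝ≥0∞} (hv : Measurable v)
    (hvΨ : ∀ a, v a + (∫⁻ b, Ψ a b ∂Q) ^ 2 = ∫⁻ b, Ψ a b ^ 2 ∂Q) :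
    ∫⁻ ω, (∑' n, Ψ (ξ n ω) (β n ω)) ^ 2 ∂P =
      (∫⁻ ω, (∑' n, ∫⁻ b, Ψ (ξ n ω) b ∂Q) ^ 2 ∂P) + ∫⁻ ω, ∑' n, v (ξ n ω) ∂P := by
  have hsq : ∀ f : ℕ → ℝ≥0∞, (∑' n, f n) ^ 2 = ∑' n, ∑' m, f n * f m := fun f => by
    rw [sq, ← ENNReal.tsum_mul_right]
    exact tsum_congr fun n => ENNReal.tsum_mul_left.symm
  have hm1 : ∀ n, Measurable fun ω => Ψ (ξ n ω) (β n ω) := fun n =>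
    hΨ.comp ((hξ n).prodMk (hβ n))
  have he : Measurable fun a => ∫⁻ b, Ψ a b ∂Q := hΨ.lintegral_prod_right'
  have hm2 : ∀ n, Measurable fun ω => ∫⁻ b, Ψ (ξ n ω) b ∂Q := fun n => he.comp (hξ n)
  have key : ∀ n m, ∫⁻ ω, Ψ (ξ n ω) (β n ω) * Ψ (ξ m ω) (β m ω) ∂P =
      (∫⁻ ω, (∫⁻ b, Ψ (ξ n ω) b ∂Q) * (∫⁻ b, Ψ (ξ m ω) b ∂Q) ∂P) +
        if m = n then ∫⁻ ω, v (ξ n ω) ∂P else 0 := by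
    intro n m
    by_cases hnm : m = n
    · subst hnm
      rw [if_pos rfl]
      have h1 := lintegral_mark (Ψ := fun a b => Ψ a b ^ 2) hξ hβ hlaw hind (hΨ.pow_const 2) m
      simp only [← sq]
      rw [h1, ← lintegral_add_left ((hm2 m).pow_const 2)]
      refine lintegral_congr fun ω => ?_
      rw [← hvΨ, add_comm]
    · rw [if_neg hnm, add_zero]
      have hnm' : n ≠ m := fun h => hnm h.symm
      have hU : Measurable fun ω => (ξ n ω, ξ m ω) := (hξ n).prodMk (hξ m)
      have hV : Measurable fun ω => (β n ω, β m ω) := (hβ n).prodMk (hβ m)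
      have hUV : IndepFun (fun ω => (ξ n ω, ξ m ω)) (fun ω => (β n ω, β m ω)) P :=
        hind.comp (φ := fun x : ℕ → A => (x n, x m)) (ψ := fun x : ℕ → B => (x n, x m))
          ((measurable_pi_apply n).prodMk (measurable_pi_apply m))
          ((measurable_pi_apply n).prodMk (measurable_pi_apply m))
      have hmap : P.map (fun ω => (β n ω, β m ω)) = Q.prod Q := by
        rw [(indepFun_iff_map_prod_eq_prod_map_map (hβ n).aemeasurable (hβ m).aemeasurable).1
          (hiid.indepFun hnm'), hlaw, hlaw]
      have hg : Measurable (Function.uncurry fun (a : A × A) (b : B × B) =>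
          Ψ a.1 b.1 * Ψ a.2 b.2) :=
        (hΨ.comp ((measurable_fst.comp measurable_fst).prodMk
          (measurable_fst.comp measurable_snd))).mul
        (hΨ.comp ((measurable_snd.comp measurable_fst).prodMk
          (measurable_snd.comp measurable_snd)))
      rw [lintegral_indepFun hU hV hUV hg, hmap]
      refine lintegral_congr fun ω => ?_
      exact lintegral_prod_mul (hΨ.comp measurable_prodMk_left).aemeasurable
        (hΨ.comp measurable_prodMk_left).aemeasurable
  have hexp : ∀ f : ℕ → Ω → ℝ≥0∞, (∀ n, Measurable (f n)) →
      ∫⁻ ω, (∑' n, f n ω) ^ 2 ∂P = ∑' n, ∑' m, ∫⁻ ω, f n ω * f m ω ∂P := fun f hf => by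
    simp only [hsq]
    have hmul : ∀ n m, Measurable fun ω => f n ω * f m ω := fun n m => (hf n).mul (hf m)
    have hmul' : ∀ n, Measurable fun ω => ∑' m, f n ω * f m ω := fun n => Measurable.tsum (hmul n)
    rw [lintegral_tsum fun n => (hmul' n).aemeasurable]
    exact tsum_congr fun n => lintegral_tsum fun m => (hmul n m).aemeasurable
  have hvξ : ∀ n, Measurable fun ω => v (ξ n ω) := fun n => hv.comp (hξ n)
  rw [hexp _ hm1, hexp _ hm2, lintegral_tsum fun n => (hvξ n).aemeasurable,
    ← ENNReal.tsum_add]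
  refine tsum_congr fun n => ?_
  simp only [key, ENNReal.tsum_add, tsum_ite_eq]

end Moments

/-! ### Campbell's theorem for the cells of a stationary tessellation -/

section Campbell

variable {d : ℕ} {Ω : Type*} [MeasurableSpace Ω] {P : Measure Ω} {X : ℕ → Ω → ConvexBody (Euc d)}

lemma lintegral_cellMeasure (C : ℕ → ConvexBody (Euc d)) {f : ConvexBody (Euc d) → ℝ≥0∞}
    (hf : Measurable f) : ∫⁻ K, f K ∂(cellMeasure C) = ∑' n, f (C n) := by
  rw [cellMeasure, lintegral_sum_measure]
  exact tsum_congr fun n => lintegral_dirac' _ hf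

lemma measurable_cellMeasure (hX : ∀ n, Measurable (X n)) :
    Measurable fun ω => cellMeasure fun n => X n ω := by
  refine Measure.measurable_of_measurable_coe _ fun S hS => ?_
  simp only [cellMeasure, Measure.sum_apply _ hS]
  exact Measurable.tsum fun n =>
    (Measure.measurable_coe hS).comp (Measure.measurable_dirac.comp (hX n))

/-- Stationarity, in terms of functionals of the sum of a function over the cells. -/
lemma IsStationary.lintegral_tsum (hstat : IsStationary P X)
    {f : ConvexBody (Euc d) → ℝ≥0∞} (hf : Measurable f) {φ : ℝ≥0∞ → ℝ≥0∞} (hφ : Measurable φ)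
    (x : Euc d) :
    ∫⁻ ω, φ (∑' n, f (translate x (X n ω))) ∂P = ∫⁻ ω, φ (∑' n, f (X n ω)) ∂P := by
  have hm : Measurable fun μ : Measure (ConvexBody (Euc d)) => φ (∫⁻ K, f K ∂μ) :=
    hφ.comp (Measure.measurable_lintegral hf)
  have h := ((hstat x).comp hm).lintegral_eq
  simpa only [Function.comp_def, lintegral_cellMeasure _ hf] using h

variable {α : ConvexBody (Euc d) → Euc d}

lemma measurable_centred (hα : Measurable α) : Measurable (centred α) :=
  continuous_translate.measurable.comp (hα.neg.prodMk measurable_id)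

lemma lintegral_palmMark (hX : ∀ n, Measurable (X n)) (hα : Measurable α)
    (hγ0 : cellIntensity P X α ≠ 0) (hγ : cellIntensity P X α ≠ ∞)
    {g : ConvexBody (Euc d) → ℝ≥0∞} (hg : Measurable g) :
    cellIntensity P X α * ∫⁻ C, g C ∂(palmMark P X α) =
      ∑' n, ∫⁻ ω in {ω | α (X n ω) ∈ halfOpenCube d}, g (centred α (X n ω)) ∂P := by
  rw [palmMark, lintegral_smul_measure, smul_eq_mul, ← mul_assoc, ENNReal.mul_inv_cancel hγ0 hγ,
    one_mul, lintegral_sum_measure]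
  exact tsum_congr fun n => lintegral_map hg ((measurable_centred hα).comp (hX n))

/-- **Campbell's theorem**: the mean of a sum over the cells of a stationary tessellation, in terms
of the typical cell. The indicator of the half-open unit cube at `α C - x` has integral `1` in `x`;
stationarity moves the translation by `x` to the summand. -/
theorem campbell [SFinite P] (hX : ∀ n, Measurable (X n)) (hstat : IsStationary P X)
    (hα : IsAssociatedPoint α)
    (hγ0 : cellIntensity P X α ≠ 0) (hγ : cellIntensity P X α ≠ ∞)
    {f : ConvexBody (Euc d) → ℝ≥0∞} (hf : Measurable f) :
    ∫⁻ ω, ∑' n, f (X n ω) ∂P =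
      cellIntensity P X α * ∫⁻ C, ∫⁻ x, f (translate x C) ∂volume ∂(palmMark P X α) := by
  set I := halfOpenCube d with hI
  have hIm : MeasurableSet I := measurableSet_halfOpenCube
  have hαm := hα.measurable
  have htr : Measurable fun p : ConvexBody (Euc d) × Euc d => translate p.2 p.1 :=
    continuous_translate.measurable.comp measurable_swap
  have hone : ∀ a : Euc d, ∫⁻ x, I.indicator (1 : Euc d → ℝ≥0∞) (a - x) = 1 := fun a => by
    rw [lintegral_sub_left_eq_self, lintegral_indicator_one hIm, volume_halfOpenCube]
  have hG : Measurable fun p : ConvexBody (Euc d) × Euc d =>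
      f p.1 * I.indicator (1 : Euc d → ℝ≥0∞) (α p.1 - p.2) :=
    (hf.comp measurable_fst).mul ((measurable_one.indicator hIm).comp
      ((hαm.comp measurable_fst).sub measurable_snd))
  have hH : Measurable fun p : ConvexBody (Euc d) × Euc d =>
      f (translate p.2 p.1) * I.indicator (1 : Euc d → ℝ≥0∞) (α p.1) :=
    (hf.comp htr).mul ((measurable_one.indicator hIm).comp (hαm.comp measurable_fst))
  have hXx : ∀ n, Measurable fun p : Ω × Euc d => (X n p.1, p.2) := fun n =>
    ((hX n).comp measurable_fst).prodMk measurable_snd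
  have hg : Measurable fun C : ConvexBody (Euc d) => ∫⁻ x, f (translate x C) :=
    (hf.comp htr).lintegral_prod_right'
  calc ∫⁻ ω, ∑' n, f (X n ω) ∂P
      = ∫⁻ ω, ∫⁻ x, ∑' n, f (X n ω) * I.indicator (1 : Euc d → ℝ≥0∞) (α (X n ω) - x) ∂volume ∂P := by
        refine lintegral_congr fun ω => ?_
        have hm : ∀ n, Measurable fun x =>
            f (X n ω) * I.indicator (1 : Euc d → ℝ≥0∞) (α (X n ω) - x) := fun n =>
          hG.comp (measurable_const.prodMk measurable_id)
        rw [MeasureTheory.lintegral_tsum fun n => (hm n).aemeasurable]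
        refine tsum_congr fun n => ?_
        rw [lintegral_const_mul]
        · rw [hone, mul_one]
        · exact (measurable_one.indicator hIm).comp (measurable_const.sub measurable_id)
    _ = ∫⁻ x, ∫⁻ ω, ∑' n, f (X n ω) * I.indicator (1 : Euc d → ℝ≥0∞) (α (X n ω) - x) ∂P :=
        lintegral_lintegral_swap
          (Measurable.tsum fun n => hG.comp (hXx n)).aemeasurable
    _ = ∫⁻ x, ∫⁻ ω, ∑' n, f (translate x (X n ω)) *
          I.indicator (1 : Euc d → ℝ≥0∞) (α (X n ω)) ∂P := by
        refine lintegral_congr fun x => ?_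
        have h := hstat.lintegral_tsum
          (f := fun C => f C * I.indicator (1 : Euc d → ℝ≥0∞) (α C - x))
          (hG.comp (measurable_id.prodMk measurable_const)) measurable_id x
        simp only [id_eq, hα.translate, add_sub_cancel_right] at h
        exact h.symm
    _ = ∫⁻ ω, ∫⁻ x, ∑' n, f (translate x (X n ω)) *
          I.indicator (1 : Euc d → ℝ≥0∞) (α (X n ω)) ∂volume ∂P :=
        (lintegral_lintegral_swap
          (Measurable.tsum fun n => hH.comp (hXx n)).aemeasurable).symm
    _ = ∫⁻ ω, ∑' n, (∫⁻ x, f (translate x (centred α (X n ω)))) *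
          I.indicator (1 : Euc d → ℝ≥0∞) (α (X n ω)) ∂P := by
        refine lintegral_congr fun ω => ?_
        have hm : ∀ n, Measurable fun x =>
            f (translate x (X n ω)) * I.indicator (1 : Euc d → ℝ≥0∞) (α (X n ω)) := fun n =>
          hH.comp (measurable_const.prodMk measurable_id)
        rw [MeasureTheory.lintegral_tsum fun n => (hm n).aemeasurable]
        refine tsum_congr fun n => ?_
        rw [lintegral_mul_const]
        · congr 1
          refine Eq.trans ?_ (lintegral_add_right_eq_self
            (fun x => f (translate x (centred α (X n ω)))) (α (X n ω)))
          refine lintegral_congr fun x => ?_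
          rw [centred, translate_translate, add_neg_cancel_right]
        · exact (hf.comp htr).comp (measurable_const.prodMk measurable_id)
    _ = ∑' n, ∫⁻ ω in {ω | α (X n ω) ∈ I},
          (∫⁻ x, f (translate x (centred α (X n ω)))) ∂P := by
        have hm : ∀ n, Measurable fun ω => (∫⁻ x, f (translate x (centred α (X n ω)))) *
            I.indicator (1 : Euc d → ℝ≥0∞) (α (X n ω)) := fun n =>
          ((hg.comp (measurable_centred hαm)).comp (hX n)).mul
            ((measurable_one.indicator hIm).comp (hαm.comp (hX n)))
        rw [MeasureTheory.lintegral_tsum fun n => (hm n).aemeasurable]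
        refine tsum_congr fun n => ?_
        have hS : MeasurableSet {ω | α (X n ω) ∈ I} := (hαm.comp (hX n)) hIm
        rw [← lintegral_indicator hS]
        refine lintegral_congr fun ω => ?_
        by_cases hω : α (X n ω) ∈ I
        · simp [indicator, hω]
        · simp [indicator, hω]
    _ = _ := (lintegral_palmMark hX hαm hγ0 hγ hg).symm

lemma ae_palmMark (hX : ∀ n, Measurable (X n)) (hα : Measurable α)
    {p : ConvexBody (Euc d) → Prop} (hp : MeasurableSet {C | p C})
    (h : ∀ᵐ ω ∂P, ∀ n, p (centred α (X n ω))) : ∀ᵐ C ∂(palmMark P X α), p C := by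
  rw [palmMark]
  refine Measure.ae_smul_measure ?_ _
  rw [Measure.ae_sum_iff' hp]
  intro n
  have hm : Measurable fun ω => centred α (X n ω) := (measurable_centred hα).comp (hX n)
  rw [ae_map_iff hm.aemeasurable hp]
  exact ae_restrict_of_ae (h.mono fun ω hω => hω n)

end Campbell

/-! ### The code of a motion-invariant tessellation -/

section CodeLaw

variable {d : ℕ} {Ω : Type*} [MeasurableSpace Ω] {P : Measure Ω} {X : ℕ → Ω → ConvexBody (Euc d)}

lemma measurable_code_cellMeasure (hX : ∀ n, Measurable (X n)) :
    Measurable fun ω => code (cellMeasure fun n => X n ω) :=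
  measurable_code.comp (measurable_cellMeasure hX)

lemma codedSet_moveBody (g : Euc d ≃ᵃⁱ[ℝ] Euc d) (C : ℕ → ConvexBody (Euc d)) :
    codedSet d (code (cellMeasure fun n => moveBody g (C n))) =
      g '' codedSet d (code (cellMeasure C)) := by
  simp only [codedSet_code_cellMeasure]
  rw [image_compl_eq g.bijective, image_iUnion]
  congr 2
  funext n
  exact (g.toHomeomorph.image_interior _).symm

lemma IsMotionInvariant.isInvariantLaw (hX : ∀ n, Measurable (X n)) (h : IsMotionInvariant P X) :
    IsInvariantLaw d (P.map fun ω => code (cellMeasure fun n => X n ω)) := by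
  intro g hg j K hK
  have hmK := measurable_vol_codedSet_const j hK
  have hmgK := measurable_vol_codedSet_const j (hK.image g.continuous)
  have hcode := measurable_code_cellMeasure hX
  have hm : Measurable fun μ : Measure (ConvexBody (Euc d)) =>
      vol j (codedSet d (code μ) ∩ g '' K) := by
    have h3 := hmgK.comp (measurable_code (d := d))
    exact h3
  have h1 := ((h g hg).comp hm).map_eq
  refine ⟨hmgK.aemeasurable, hmK.aemeasurable, ?_⟩
  rw [Measure.map_map hmgK hcode, Measure.map_map hmK hcode]
  refine Eq.trans h1.symm (congrArg (fun φ => Measure.map φ P) (funext fun ω => ?_))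
  change vol j (codedSet d (code (cellMeasure fun n => moveBody g (X n ω))) ∩ g '' K) =
    vol j (codedSet d (code (cellMeasure fun n => X n ω)) ∩ K)
  rw [codedSet_moveBody, ← image_inter g.injective, vol_image_isometry j g.isometry]

end CodeLaw

/-! ### Skeletons of translated bodies -/

section TranslatedSkeleton

variable {d : ℕ}

lemma faceDirection_translate (x : Euc d) (C : ConvexBody (Euc d)) (y : Euc d) :
    faceDirection (translate x C) (x + y) = faceDirection C y := by
  ext v
  change (x + y ∈ translate x C → _) ↔ (y ∈ C → _)
  have h : ∀ z : Euc d, x + z ∈ translate x C ↔ z ∈ C := fun z => by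
    rw [mem_translate, add_sub_cancel_left]
  simp only [h, add_assoc, add_sub_assoc]

lemma skeleton_translate (k : ℕ) (x : Euc d) (C : ConvexBody (Euc d)) :
    skeleton k (translate x C) = (fun y => x + y) '' skeleton k C := by
  have hpoly : IsPolytope (translate x C) ↔ IsPolytope C := by
    refine ⟨fun h => ?_, fun h => h.moveBody _⟩
    have h' : IsPolytope (translate (-x) (translate x C)) := h.moveBody _
    rwa [translate_translate, neg_add_cancel, translate_zero] at h'
  ext y
  obtain ⟨z, rfl⟩ : ∃ z, y = x + z := ⟨-x + y, by abel⟩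
  rw [(add_right_injective x).mem_set_image]
  change (IsPolytope (translate x C) ∧ x + z ∈ translate x C ∧ _) ↔ (IsPolytope C ∧ z ∈ C ∧ _)
  rw [hpoly, mem_translate, add_sub_cancel_left, faceDirection_translate]

lemma skeleton_translate_inter (k : ℕ) (x : Euc d) (C W : ConvexBody (Euc d)) :
    skeleton k (translate x C) ∩ W =
      (fun y => x + y) '' (skeleton k C ∩ translate (-x) W) := by
  rw [image_inter (add_right_injective x), skeleton_translate, ← coe_translate,
    translate_translate, add_neg_cancel, translate_zero]

lemma vol_skeleton_translate_inter (j k : ℕ) (x : Euc d) (C W : ConvexBody (Euc d)) :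
    vol j (skeleton k (translate x C) ∩ W) = vol j (skeleton k C ∩ translate (-x) W) := by
  rw [skeleton_translate_inter]
  exact vol_image_isometry j (isometry_add_left x) _

lemma vol_skeleton_ne_top {k : ℕ} (hkd : k < d) (C : ConvexBody (Euc d)) :
    vol k (skeleton k C) ≠ ∞ := by
  by_cases hC : IsPolytope C
  · exact (vol_skeleton_lt_top hkd hC).ne
  · have : skeleton k C = ∅ := eq_empty_of_forall_notMem fun x hx => hC hx.1
    simp [this, vol]

lemma measurable_vol_skeleton_inter (j k : ℕ) (W : ConvexBody (Euc d)) :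
    Measurable fun C : ConvexBody (Euc d) => vol j (skeleton k C ∩ W) := by
  have h := (measurable_vol_skeleton (d := d) j k).comp
    (measurable_id.prodMk (measurable_const (a := W)))
  exact h

lemma lintegral_vol_skeleton_translate {k : ℕ} (hkd : k < d) (C W : ConvexBody (Euc d)) :
    ∫⁻ x, vol k (skeleton k (translate x C) ∩ W) =
      vol k (skeleton k C) * volume (W : Set (Euc d)) := by
  have : IsFiniteMeasure ((Measure.euclideanHausdorffMeasure k : Measure (Euc d)).restrict
      (skeleton k C)) :=
    ⟨by rw [Measure.restrict_apply_univ]; exact (vol_skeleton_ne_top hkd C).lt_top⟩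
  have h := lintegral_measure_translate ((Measure.euclideanHausdorffMeasure k :
    Measure (Euc d)).restrict (skeleton k C)) W.isClosed.measurableSet
  rw [Measure.restrict_apply_univ] at h
  refine Eq.trans (lintegral_congr fun x => ?_) h
  rw [vol_skeleton_translate_inter,
    show {y : Euc d | y + x ∈ (W : Set (Euc d))} = translate (-x) W from
      (coe_translate_neg x W).symm,
    Measure.restrict_apply (translate (-x) W).isClosed.measurableSet, inter_comm]
  rfl

end TranslatedSkeleton

/-! ### Face content of the cells -/

section FaceContent

variable {d : ℕ} {Ω : Type*} [MeasurableSpace Ω] {P : Measure Ω} {X : ℕ → Ω → ConvexBody (Euc d)}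
  {α : ConvexBody (Euc d) → Euc d} {k m : ℕ}

/-- The total `k`-volume in `W` of the `k`-skeletons of the cells of `X`. -/
noncomputable def cellContent (X : ℕ → Ω → ConvexBody (Euc d)) (k : ℕ) (W : ConvexBody (Euc d))
    (ω : Ω) : ℝ≥0∞ :=
  ∑' n, vol k (skeleton k (X n ω) ∩ W)

lemma measurable_cellContent (hX : ∀ n, Measurable (X n)) (k : ℕ) (W : ConvexBody (Euc d)) :
    Measurable (cellContent X k W) :=
  Measurable.tsum fun n => by
    have h := (measurable_vol_skeleton_inter k k W).comp (hX n)
    exact h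

lemma IsRandomTessellation.ae_isPolytope (hX : IsRandomTessellation P X) :
    ∀ᵐ ω ∂P, ∀ n, IsPolytope (X n ω) :=
  hX.ae_tessellation.mono fun _ h n => h.isPolytope n

lemma ae_palmMark_isPolytope (hX : IsRandomTessellation P X) (hα : IsAssociatedPoint α) :
    ∀ᵐ C ∂(palmMark P X α), IsPolytope C :=
  ae_palmMark hX.measurable hα.measurable measurableSet_isPolytope
    (hX.ae_isPolytope.mono fun _ h n => (h n).moveBody _)

lemma lintegral_cellContent [SFinite P] (hX : ∀ n, Measurable (X n)) (hstat : IsStationary P X)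
    (hα : IsAssociatedPoint α)
    (hγ0 : cellIntensity P X α ≠ 0) (hγ : cellIntensity P X α ≠ ∞) (hkd : k < d)
    (W : ConvexBody (Euc d)) :
    ∫⁻ ω, cellContent X k W ω ∂P =
      cellIntensity P X α * (∫⁻ C, vol k (skeleton k C) ∂(palmMark P X α)) *
        volume (W : Set (Euc d)) := by
  have hmeas : Measurable fun C : ConvexBody (Euc d) => vol k (skeleton k C) := by
    have h := (measurable_vol_skeleton (d := d) k k).comp (measurable_id.prodMk measurable_id)
    have h' : (fun C : ConvexBody (Euc d) => vol k (skeleton k C)) =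
        fun C => vol k (skeleton k C ∩ C) :=
      funext fun C => by rw [inter_eq_left.2 (skeleton_subset k C)]
    rw [h']
    exact h
  have h := campbell hX hstat hα hγ0 hγ (measurable_vol_skeleton_inter k k W)
  simp only [lintegral_vol_skeleton_translate hkd] at h
  rw [lintegral_mul_const _ hmeas, ← mul_assoc] at h
  exact h

lemma ConditionF.ae_eq (hF : ConditionF P X k m) (hX : IsRandomTessellation P X) (hk : 1 ≤ k)
    (hkd : k < d) {W : ConvexBody (Euc d)} (hW : 0 < volume (W : Set (Euc d))) :
    ∀ᵐ ω ∂P, (m : ℝ≥0∞) * vol k (facetUnion k (fun n => X n ω) ∩ W) = cellContent X k W ω := by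
  filter_upwards [hF.2 W hW, hX.ae_isPolytope] with ω h1 h2
  rw [h1, cellContent]
  exact tsum_congr fun n => vol_faceUnion_inter hk hkd (h2 n) _

lemma ConditionF.natCast_ne_zero (hF : ConditionF P X k m) : (m : ℝ≥0∞) ≠ 0 := by
  have := hF.1
  exact_mod_cast (by omega : m ≠ 0)

/-- Condition F relates the mean `k`-volume of the `k`-facets to that of the typical cell. -/
lemma ConditionF.mul_facetIntensity [SFinite P] (hF : ConditionF P X k m)
    (hX : IsRandomTessellation P X) (hstat : IsStationary P X) (hα : IsAssociatedPoint α)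
    (hγ0 : cellIntensity P X α ≠ 0) (hγ : cellIntensity P X α ≠ ∞) (hk : 1 ≤ k) (hkd : k < d) :
    m * facetIntensity P X k =
      cellIntensity P X α * ∫⁻ C, vol k (skeleton k C) ∂(palmMark P X α) := by
  -- Condition F concerns compact bodies, so the half-open cube is exhausted by closed cubes.
  set D := fun n => cubeBody d (cubeSide n) with hD
  have hpos : ∀ n, 0 < volume (D n : Set (Euc d)) := fun n => by
    rw [volume_cubeBody]
    exact pos_iff_ne_zero.2 (pow_ne_zero d (ENNReal.coe_pos.2 (cubeSide_pos n)).ne')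
  have hae : ∀ᵐ ω ∂P, ∀ n, (m : ℝ≥0∞) * vol k (facetUnion k (fun n => X n ω) ∩ D n) =
      cellContent X k (D n) ω := ae_all_iff.2 fun n => hF.ae_eq hX hk hkd (hpos n)
  have hiSup : ∀ᵐ ω ∂P, (m : ℝ≥0∞) * vol k (facetUnion k (fun n => X n ω) ∩ halfOpenCube d) =
      ⨆ n, cellContent X k (D n) ω := hae.mono fun ω hω => by
    have hmono : Monotone fun n => facetUnion k (fun n => X n ω) ∩ (D n : Set (Euc d)) :=
      fun i j hij => inter_subset_inter_right _ (monotone_cubeBody hij)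
    rw [← iUnion_cubeBody, inter_iUnion, vol, hmono.measure_iUnion, ENNReal.mul_iSup]
    exact iSup_congr hω
  have hmono : Monotone fun n => cellContent X k (D n) := fun i j hij ω =>
    ENNReal.tsum_le_tsum fun n => vol_mono k (inter_subset_inter_right _ (monotone_cubeBody hij))
  rw [facetIntensity, ← lintegral_const_mul' _ _ (ENNReal.natCast_ne_top m),
    lintegral_congr_ae hiSup,
    lintegral_iSup (fun n => measurable_cellContent hX.measurable k (D n)) hmono]
  simp only [lintegral_cellContent hX.measurable hstat hα hγ0 hγ hkd]
  rw [← ENNReal.mul_iSup, iSup_volume_cubeBody, mul_one]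

lemma lintegral_vol_faceUnion (hX : IsRandomTessellation P X) (hα : IsAssociatedPoint α)
    (hk : 1 ≤ k) (hkd : k < d) :
    ∫⁻ C, vol k (faceUnion k C) ∂(palmMark P X α) =
      ∫⁻ C, vol k (skeleton k C) ∂(palmMark P X α) :=
  lintegral_congr_ae ((ae_palmMark_isPolytope hX hα).mono fun C hC => by
    have h := vol_faceUnion_inter hk hkd hC univ
    simpa only [inter_univ] using h)

/-- Condition F extends to bodies without interior points. -/
lemma ConditionF.ae_eq_of_facetIntensity_lt_top [SFinite P] (hF : ConditionF P X k m)
    (hX : IsRandomTessellation P X) (hstat : IsStationary P X) (hα : IsAssociatedPoint α)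
    (hγ0 : cellIntensity P X α ≠ 0) (hγ : cellIntensity P X α ≠ ∞) (hk : 1 ≤ k) (hkd : k < d)
    (hfin : facetIntensity P X k < ∞) (W : ConvexBody (Euc d)) :
    ∀ᵐ ω ∂P, (m : ℝ≥0∞) * vol k (facetUnion k (fun n => X n ω) ∩ W) = cellContent X k W ω := by
  rcases eq_or_ne (volume (W : Set (Euc d))) 0 with hW | hW
  swap
  · exact hF.ae_eq hX hk hkd (pos_iff_ne_zero.2 hW)
  have hmean : ∀ B : ConvexBody (Euc d), ∫⁻ ω, cellContent X k B ω ∂P =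
      m * facetIntensity P X k * volume (B : Set (Euc d)) := fun B => by
    rw [lintegral_cellContent hX.measurable hstat hα hγ0 hγ hkd,
      hF.mul_facetIntensity hX hstat hα hγ0 hγ hk hkd]
  have hm0 := measurable_cellContent hX.measurable k
  -- The body `W` is the intersection of parallel bodies whose volumes tend to zero.
  let B : ℕ → ConvexBody (Euc d) := fun n =>
    ⟨Metric.cthickening (1 / ((n : ℝ) + 1)) W, W.convex.cthickening _, W.isCompact.cthickening,
      W.nonempty.mono (Metric.self_subset_cthickening _)⟩
  have hBpos : ∀ n, 0 < volume (B n : Set (Euc d)) := fun n => by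
    obtain ⟨x, hx⟩ := W.nonempty
    have hpos : (0 : ℝ) < 1 / ((n : ℝ) + 1) := by positivity
    refine (Metric.measure_ball_pos volume x hpos).trans_le (measure_mono ?_)
    exact (Metric.ball_subset_thickening hx _).trans (Metric.thickening_subset_cthickening _ _)
  have hlim : Tendsto (fun n => volume (B n : Set (Euc d))) atTop (𝓝 0) := by
    rw [← hW]
    exact (tendsto_measure_cthickening_of_isCompact W.isCompact).comp
      tendsto_one_div_add_atTop_nhds_zero_nat
  have hlim' : Tendsto (fun n => ∫⁻ ω, cellContent X k (B n) ω ∂P) atTop (𝓝 0) := by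
    simp only [hmean]
    have h := ENNReal.Tendsto.const_mul (a := m * facetIntensity P X k) hlim
      (Or.inr (ENNReal.mul_ne_top (ENNReal.natCast_ne_top m) hfin.ne))
    rwa [mul_zero] at h
  have hinf : ∫⁻ ω, ⨅ n, cellContent X k (B n) ω ∂P = 0 :=
    le_antisymm (ge_of_tendsto' hlim' fun n => lintegral_mono fun ω => iInf_le _ n) zero_le
  have h1 := (lintegral_eq_zero_iff (Measurable.iInf fun n => hm0 (B n))).1 hinf
  have h2 := (lintegral_eq_zero_iff (hm0 W)).1 (by rw [hmean, hW, mul_zero])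
  have h3 : ∀ᵐ ω ∂P, ∀ n, (m : ℝ≥0∞) * vol k (facetUnion k (fun n => X n ω) ∩ B n) =
      cellContent X k (B n) ω := ae_all_iff.2 fun n => hF.ae_eq hX hk hkd (hBpos n)
  filter_upwards [h1, h2, h3] with ω h1 h2 h3
  rw [h2]
  change _ = (0 : ℝ≥0∞)
  refine le_antisymm ?_ zero_le
  calc (m : ℝ≥0∞) * vol k (facetUnion k (fun n => X n ω) ∩ W)
      ≤ ⨅ n, cellContent X k (B n) ω := le_iInf fun n => by
        rw [← h3]
        gcongr
        exact vol_mono k (inter_subset_inter_right _ (Metric.self_subset_cthickening _))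
    _ = 0 := h1

lemma add_sq_le_four_mul (a b : ℝ≥0∞) : (a + b) ^ 2 ≤ 4 * (a ^ 2 + b ^ 2) := by
  rcases le_total a b with h | h
  · calc (a + b) ^ 2 ≤ (b + b) ^ 2 := by gcongr
      _ = 4 * b ^ 2 := by ring
      _ ≤ _ := by gcongr; exact le_add_self
  · calc (a + b) ^ 2 ≤ (a + a) ^ 2 := by gcongr
      _ = 4 * a ^ 2 := by ring
      _ ≤ _ := by gcongr; exact le_self_add

lemma lintegral_sum_sq_lt_top {ι : Type*} (s : Finset ι) {f : ι → Ω → ℝ≥0∞}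
    (hf : ∀ i, Measurable (f i)) (h : ∀ i, ∫⁻ ω, f i ω ^ 2 ∂P < ∞) :
    ∫⁻ ω, (∑ i ∈ s, f i ω) ^ 2 ∂P < ∞ := by
  classical
  induction s using Finset.induction_on with
  | empty => simp
  | insert a s ha ih =>
    simp only [Finset.sum_insert ha]
    refine (lintegral_mono fun ω => add_sq_le_four_mul (f a ω) (∑ i ∈ s, f i ω)).trans_lt ?_
    rw [lintegral_const_mul' _ _ (by norm_num), lintegral_add_left ((hf a).pow_const 2)]
    exact ENNReal.mul_lt_top (by norm_num) (ENNReal.add_lt_top.2 ⟨h a, ih⟩)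

/-- A finite second moment of the face content in one cube entails finite second moments in all
bodies. -/
lemma lintegral_cellContent_sq_lt_top (hX : ∀ n, Measurable (X n)) (hstat : IsStationary P X)
    {s : NNReal} (hs : 0 < s) (h : ∫⁻ ω, cellContent X k (cubeBody d s) ω ^ 2 ∂P < ∞)
    (W : ConvexBody (Euc d)) : ∫⁻ ω, cellContent X k W ω ^ 2 ∂P < ∞ := by
  obtain ⟨T, hT⟩ := exists_cover_cubes W.isCompact hs
  have hcube : ∀ x, ∫⁻ ω, cellContent X k (translate x (cubeBody d s)) ω ^ 2 ∂P < ∞ := fun x => by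
    have hst := hstat.lintegral_tsum (measurable_vol_skeleton_inter k k (cubeBody d s))
      (φ := fun y => y ^ 2) (measurable_id.pow_const 2) (-x)
    simp only [vol_skeleton_translate_inter, neg_neg] at hst
    exact hst.trans_lt h
  refine lt_of_le_of_lt (lintegral_mono fun ω => ?_)
    (lintegral_sum_sq_lt_top T (fun x => measurable_cellContent hX k (translate x (cubeBody d s)))
      hcube)
  refine pow_le_pow_left' ?_ 2
  simp only [cellContent]
  rw [← Summable.tsum_finsetSum fun _ _ => ENNReal.summable]
  refine ENNReal.tsum_le_tsum fun n => ?_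
  calc vol k (skeleton k (X n ω) ∩ W)
      ≤ vol k (⋃ x ∈ T, skeleton k (X n ω) ∩ translate x (cubeBody d s)) := by
        refine vol_mono k ?_
        rw [← inter_iUnion₂]
        exact inter_subset_inter_right _ hT
    _ ≤ _ := measure_biUnion_finset_le T _

end FaceContent

/-! ### Sections of faces with an independent motion-invariant tessellation -/

section Nesting

variable {d : ℕ} {Ω : Type*} [MeasurableSpace Ω] {P : Measure Ω}

lemma var_eq_of_identDistrib {A B : Type*} [MeasurableSpace A] [MeasurableSpace B]
    {μ : Measure A} {ν : Measure B} {f : A → ℝ≥0∞} {g : B → ℝ≥0∞} (h : IdentDistrib f g μ ν) :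
    var μ f = var ν g := by
  have h2 := (h.comp ENNReal.measurable_toReal).evariance_eq
  exact h2

/-- The law of the code of a random tessellation. -/
noncomputable def codeLaw (P : Measure Ω) (X : ℕ → Ω → ConvexBody (Euc d)) : Measure Code :=
  P.map fun ω => code (cellMeasure fun n => X n ω)

/-- The `(k-1)`-volume in `W` of the section of the `k`-skeleton of `C` with the coded set. -/
noncomputable def sectionVol (k : ℕ) (W C : ConvexBody (Euc d)) (t : Code) : ℝ≥0∞ :=
  vol (k - 1) (codedSet d t ∩ (skeleton k C ∩ W))

lemma measurable_sectionVol (k : ℕ) :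
    Measurable fun q : ConvexBody (Euc d) × ConvexBody (Euc d) × Code =>
      sectionVol k q.1 q.2.1 q.2.2 := by
  have h2 : Measurable fun q : ConvexBody (Euc d) × ConvexBody (Euc d) × Code =>
      (q.2.2, (q.2.1, q.1)) := by fun_prop
  have h := (measurable_vol_codedSet_skeleton (d := d) (k - 1) k).comp h2
  exact h

lemma measurable_sectionVol_uncurry (k : ℕ) (W : ConvexBody (Euc d)) :
    Measurable (Function.uncurry (sectionVol k W)) := by
  have h2 : Measurable fun q : ConvexBody (Euc d) × Code => (W, q) := measurable_prodMk_left
  have h := (measurable_sectionVol (d := d) k).comp h2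
  exact h

lemma measurable_sectionVol_code (k : ℕ) (W C : ConvexBody (Euc d)) :
    Measurable (sectionVol k W C) :=
  (measurable_sectionVol_uncurry k W).of_uncurry_left

variable {X X₀ : ℕ → Ω → ConvexBody (Euc d)} {Y : ℕ → ℕ → Ω → ConvexBody (Euc d)} {k : ℕ}

lemma isProbabilityMeasure_codeLaw [IsProbabilityMeasure P] (hX : ∀ n, Measurable (X n)) :
    IsProbabilityMeasure (codeLaw P X) :=
  Measure.isProbabilityMeasure_map (measurable_code_cellMeasure hX).aemeasurable

lemma IsRandomTessellation.ae_codedSet_eq (hX : IsRandomTessellation P X) (hd : 1 ≤ d) :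
    ∀ᵐ ω ∂P, codedSet d (code (cellMeasure fun n => X n ω)) =
      facetUnion (d - 1) (fun n => X n ω) :=
  hX.ae_tessellation.mono fun _ h => h.codedSet_eq hd

lemma flatIntensity_codeLaw (hX : IsRandomTessellation P X) (hkd : k < d) :
    flatIntensity d (codeLaw P X) (k - 1) k = sectionIntensity P X k := by
  rw [flatIntensity, codeLaw, lintegral_map (measurable_vol_codedSet_halfOpenSubcube hkd.le _)
    (measurable_code_cellMeasure hX.measurable), sectionIntensity]
  exact lintegral_congr_ae ((hX.ae_codedSet_eq (by omega)).mono fun ω hω => by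
    change vol _ (_ ∩ _) = vol _ (_ ∩ _)
    rw [hω])

lemma lintegral_sectionVol [IsProbabilityMeasure P] (hX : IsRandomTessellation P X)
    (hmot : IsMotionInvariant P X) (hkd : k < d) (hfin : sectionIntensity P X k < ∞)
    (W C : ConvexBody (Euc d)) :
    ∫⁻ t, sectionVol k W C t ∂(codeLaw P X) =
      sectionIntensity P X k * vol k (skeleton k C ∩ W) := by
  have := isProbabilityMeasure_codeLaw (P := P) hX.measurable
  rw [← flatIntensity_codeLaw hX hkd] at hfin ⊢
  exact (hmot.isInvariantLaw hX.measurable).meanVol_skeleton hkd (k - 1) hfin.ne le_rfl C W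

lemma lintegral_sectionVol_ne_top [IsProbabilityMeasure P] (hX : IsRandomTessellation P X)
    (hmot : IsMotionInvariant P X) (hkd : k < d) (hfin : sectionIntensity P X k < ∞)
    (W C : ConvexBody (Euc d)) : ∫⁻ t, sectionVol k W C t ∂(codeLaw P X) ≠ ∞ := by
  rw [lintegral_sectionVol hX hmot hkd hfin]
  exact ENNReal.mul_ne_top hfin.ne
    ((vol_mono k inter_subset_left).trans_lt (vol_skeleton_ne_top hkd C).lt_top).ne

/-- Almost surely, the section of the `(k-1)`-skeleton has no `(k-1)`-volume. Hence the union of the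
`k`-faces may be replaced by the `k`-skeleton. -/
lemma lintegral_vol_codedSet_skeleton_pred [IsProbabilityMeasure P] (hX : IsRandomTessellation P X)
    (hmot : IsMotionInvariant P X) (hk : 1 ≤ k) (hkd : k < d) (hfin : sectionIntensity P X k < ∞)
    (C : ConvexBody (Euc d)) :
    ∫⁻ t, vol (k - 1) (codedSet d t ∩ (skeleton (k - 1) C ∩ C)) ∂(codeLaw P X) = 0 := by
  have := isProbabilityMeasure_codeLaw (P := P) hX.measurable
  rw [← flatIntensity_codeLaw hX hkd] at hfin
  have h := (hmot.isInvariantLaw hX.measurable).meanVol_skeleton hkd (k - 1) hfin.ne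
    (Nat.sub_le k 1) C C
  rw [inter_eq_left.2 (skeleton_subset (k - 1) C), vol_skeleton_pred hk hkd, mul_zero] at h
  rw [inter_eq_left.2 (skeleton_subset (k - 1) C)]
  exact h

lemma vol_facetUnion_inter_ae [IsProbabilityMeasure P] (hX : IsRandomTessellation P X)
    (hmot : IsMotionInvariant P X) (hk : 1 ≤ k) (hkd : k < d) (hfin : sectionIntensity P X k < ∞)
    {C : ConvexBody (Euc d)} (hC : IsPolytope C) :
    ∀ᵐ ω ∂P, ∀ S : Set (Euc d),
      vol (k - 1) (facetUnion (d - 1) (fun n => X n ω) ∩ faceUnion k C ∩ S) =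
        vol (k - 1) (codedSet d (code (cellMeasure fun n => X n ω)) ∩ (skeleton k C ∩ S)) := by
  have hm := measurable_vol_codedSet_const (d := d) (k - 1)
    ((isCompact_skeleton (k - 1) C).inter_right C.isClosed)
  have h0 := lintegral_vol_codedSet_skeleton_pred hX hmot hk hkd hfin C
  rw [codeLaw, lintegral_map hm (measurable_code_cellMeasure hX.measurable)] at h0
  have hmc : Measurable fun ω => vol (k - 1)
      (codedSet d (code (cellMeasure fun n => X n ω)) ∩ (skeleton (k - 1) C ∩ C)) := by
    have h3 := hm.comp (measurable_code_cellMeasure hX.measurable)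
    exact h3
  filter_upwards [(lintegral_eq_zero_iff hmc).1 h0, hX.ae_codedSet_eq (by omega)] with ω h1 h2 S
  rw [inter_eq_left.2 (skeleton_subset (k - 1) C)] at h1
  rw [← h2]
  exact vol_inter_faceUnion_inter hC _ S h1

lemma IsNesting.map_code (hnest : IsNesting P X X₀ Y) (n : ℕ) :
    P.map (fun ω => code (cellMeasure fun l => Y n l ω)) = codeLaw P X₀ :=
  ((hnest.copies n).comp measurable_code).map_eq

lemma IsNesting.iIndepFun_code (hnest : IsNesting P X X₀ Y) :
    iIndepFun (fun n ω => code (cellMeasure fun l => Y n l ω)) P :=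
  hnest.independent.comp (fun _ => code) fun _ => measurable_code

lemma IsNesting.independent_code (hnest : IsNesting P X X₀ Y) :
    IndepFun (fun ω n => X n ω) (fun ω n => code (cellMeasure fun l => Y n l ω)) P :=
  hnest.independent_initial.comp (φ := id)
    (ψ := fun μ : ℕ → Measure (ConvexBody (Euc d)) => fun n => code (μ n)) measurable_id
    (measurable_pi_lambda _ fun n => measurable_code.comp (measurable_pi_apply n))

/-- The content `Z` as a functional of the cells, marked with the codes of the component
tessellations. -/
lemma IsNesting.Z_ae_eq [IsProbabilityMeasure P] (hnest : IsNesting P X X₀ Y)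
    (hmot : IsMotionInvariant P X₀) (hk : 1 ≤ k) (hkd : k < d)
    (hfin : sectionIntensity P X₀ k < ∞) (W : ConvexBody (Euc d)) :
    Z X Y k W =ᵐ[P] fun ω =>
      ∑' n, sectionVol k W (X n ω) (code (cellMeasure fun l => Y n l ω)) := by
  have hβ := fun n => measurable_code_cellMeasure (hnest.component n).measurable
  have hind := hnest.independent_code
  have hΨ : Measurable (Function.uncurry fun (C : ConvexBody (Euc d)) (t : Code) =>
      vol (k - 1) (codedSet d t ∩ (skeleton (k - 1) C ∩ C))) := by
    have h2 : Measurable fun q : ConvexBody (Euc d) × Code => (q.2, (q.1, q.1)) := by fun_prop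
    have h := (measurable_vol_codedSet_skeleton (d := d) (k - 1) (k - 1)).comp h2
    exact h
  have hnull : ∀ᵐ ω ∂P, ∀ n, vol (k - 1) (codedSet d (code (cellMeasure fun l => Y n l ω)) ∩
      skeleton (k - 1) (X n ω)) = 0 := by
    refine ae_all_iff.2 fun n => ?_
    have h := lintegral_mark hnest.initial.measurable hβ hnest.map_code hind hΨ n
    simp only [lintegral_vol_codedSet_skeleton_pred hnest.generic hmot hk hkd hfin,
      lintegral_zero] at h
    have hm : Measurable fun ω => vol (k - 1) (codedSet d (code (cellMeasure fun l => Y n l ω)) ∩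
        (skeleton (k - 1) (X n ω) ∩ X n ω)) := by
      have h3 := hΨ.comp ((hnest.initial.measurable n).prodMk (hβ n))
      exact h3
    filter_upwards [(lintegral_eq_zero_iff hm).1 h] with ω hω
    rwa [inter_eq_left.2 (skeleton_subset (k - 1) (X n ω))] at hω
  have hY : ∀ᵐ ω ∂P, ∀ n, codedSet d (code (cellMeasure fun l => Y n l ω)) =
      facetUnion (d - 1) (fun l => Y n l ω) :=
    ae_all_iff.2 fun n => (hnest.component n).ae_codedSet_eq (by omega)
  filter_upwards [hnull, hY, hnest.initial.ae_isPolytope] with ω h1 h2 h3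
  refine tsum_congr fun n => ?_
  rw [sectionVol, ← vol_inter_faceUnion_inter (h3 n) _ _ (h1 n), h2]

lemma IsNesting.measurable_tsum_sectionVol (hnest : IsNesting P X X₀ Y) (W : ConvexBody (Euc d)) :
    Measurable fun ω => ∑' n, sectionVol k W (X n ω) (code (cellMeasure fun l => Y n l ω)) :=
  Measurable.tsum fun n => by
    have h := (measurable_sectionVol_uncurry k W).comp ((hnest.initial.measurable n).prodMk
      (measurable_code_cellMeasure (hnest.component n).measurable))
    exact h

/-- The conditional mean of `Z`, given the initial tessellation, is proportional to the face
content of the cells. -/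
lemma IsNesting.lintegral_Z [IsProbabilityMeasure P] (hnest : IsNesting P X X₀ Y)
    (hmot : IsMotionInvariant P X₀) (hk : 1 ≤ k) (hkd : k < d)
    (hfin : sectionIntensity P X₀ k < ∞) (W : ConvexBody (Euc d)) :
    ∫⁻ ω, Z X Y k W ω ∂P = sectionIntensity P X₀ k * ∫⁻ ω, cellContent X k W ω ∂P := by
  have := isProbabilityMeasure_codeLaw (P := P) hnest.generic.measurable
  have hβ := fun n => measurable_code_cellMeasure (hnest.component n).measurable
  rw [lintegral_congr_ae (hnest.Z_ae_eq hmot hk hkd hfin W),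
    lintegral_tsum_mark hnest.initial.measurable hβ hnest.map_code hnest.independent_code
      (measurable_sectionVol_uncurry k W),
    ← lintegral_const_mul' _ _ hfin.ne]
  refine lintegral_congr fun ω => ?_
  simp only [lintegral_sectionVol hnest.generic hmot hkd hfin, cellContent, ENNReal.tsum_mul_left]

lemma measurable_var_sectionVol [IsProbabilityMeasure P] (hX : IsRandomTessellation P X)
    (hmot : IsMotionInvariant P X) (hkd : k < d) (hfin : sectionIntensity P X k < ∞)
    (W : ConvexBody (Euc d)) :
    Measurable fun C => var (codeLaw P X) (sectionVol k W C) := by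
  have := isProbabilityMeasure_codeLaw (P := P) hX.measurable
  have hm := measurable_sectionVol_uncurry (d := d) k W
  have hm2 : Measurable fun q : ConvexBody (Euc d) × Code => sectionVol k W q.1 q.2 ^ 2 :=
    hm.pow_const 2
  have heq : (fun C => var (codeLaw P X) (sectionVol k W C)) = fun C =>
      (∫⁻ t, sectionVol k W C t ^ 2 ∂(codeLaw P X)) -
        (∫⁻ t, sectionVol k W C t ∂(codeLaw P X)) ^ 2 := funext fun C => by
    have hne := lintegral_sectionVol_ne_top hX hmot hkd hfin W C
    rw [← var_add_sq (measurable_sectionVol_code k W C).aemeasurable hne,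
      ENNReal.add_sub_cancel_right (ENNReal.pow_ne_top hne)]
  rw [heq]
  exact hm2.lintegral_prod_right'.sub (hm.lintegral_prod_right'.pow_const 2)

/-- The second moment of `Z`, split by conditioning on the initial tessellation. -/
lemma IsNesting.lintegral_Z_sq [IsProbabilityMeasure P] (hnest : IsNesting P X X₀ Y)
    (hmot : IsMotionInvariant P X₀) (hk : 1 ≤ k) (hkd : k < d)
    (hfin : sectionIntensity P X₀ k < ∞) (W : ConvexBody (Euc d)) :
    ∫⁻ ω, Z X Y k W ω ^ 2 ∂P =
      sectionIntensity P X₀ k ^ 2 * (∫⁻ ω, cellContent X k W ω ^ 2 ∂P) +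
        ∫⁻ ω, ∑' n, var (codeLaw P X₀) (sectionVol k W (X n ω)) ∂P := by
  have := isProbabilityMeasure_codeLaw (P := P) hnest.generic.measurable
  have hβ := fun n => measurable_code_cellMeasure (hnest.component n).measurable
  have hsq : (fun ω => Z X Y k W ω ^ 2) =ᵐ[P] fun ω =>
      (∑' n, sectionVol k W (X n ω) (code (cellMeasure fun l => Y n l ω))) ^ 2 :=
    (hnest.Z_ae_eq hmot hk hkd hfin W).mono fun ω hω => by simp only [hω]
  rw [lintegral_congr_ae hsq, lintegral_tsum_mark_sq hnest.initial.measurable hβ hnest.map_code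
    hnest.iIndepFun_code hnest.independent_code (measurable_sectionVol_uncurry k W)
    (measurable_var_sectionVol hnest.generic hmot hkd hfin W)
    fun C => var_add_sq (measurable_sectionVol_code k W C).aemeasurable
      (lintegral_sectionVol_ne_top hnest.generic hmot hkd hfin W C),
    ← lintegral_const_mul' _ _ (ENNReal.pow_ne_top hfin.ne)]
  congr 1
  refine lintegral_congr fun ω => ?_
  simp only [lintegral_sectionVol hnest.generic hmot hkd hfin, cellContent, ENNReal.tsum_mul_left,
    mul_pow]

lemma var_sectionVol_translate (hX : IsRandomTessellation P X) (hmot : IsMotionInvariant P X)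
    (k : ℕ) (W C : ConvexBody (Euc d)) (x : Euc d) :
    var (codeLaw P X) (sectionVol k W (translate x C)) =
      var (codeLaw P X) (sectionVol k (translate (-x) W) C) := by
  refine var_eq_of_identDistrib ?_
  have hK : IsCompact (skeleton k C ∩ translate (-x) W) :=
    (isCompact_skeleton k C).inter_right (translate (-x) W).isClosed
  have h := hmot.isInvariantLaw hX.measurable (AffineIsometryEquiv.constVAdd ℝ (Euc d) x)
    (det_constVAdd x) (k - 1) _ hK
  have heq : sectionVol k W (translate x C) = fun t => vol (k - 1) (codedSet d t ∩
      AffineIsometryEquiv.constVAdd ℝ (Euc d) x '' (skeleton k C ∩ translate (-x) W)) := by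
    funext t
    rw [sectionVol, skeleton_translate_inter]
    rfl
  rw [heq]
  exact h

/-- The variance of a section with a fixed polytope, in terms of the law of the code. -/
lemma var_vol_facetUnion_inter [IsProbabilityMeasure P] (hX : IsRandomTessellation P X)
    (hmot : IsMotionInvariant P X) (hk : 1 ≤ k) (hkd : k < d) (hfin : sectionIntensity P X k < ∞)
    {C : ConvexBody (Euc d)} (hC : IsPolytope C) (W : ConvexBody (Euc d)) (x : Euc d) :
    var P (fun ω => vol (k - 1) (facetUnion (d - 1) (fun n => X n ω) ∩ faceUnion k C ∩
      {y | y + x ∈ W})) = var (codeLaw P X) (sectionVol k W (translate x C)) := by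
  have hcode := measurable_code_cellMeasure hX.measurable
  have h2 : IdentDistrib (sectionVol k (translate (-x) W) C) (fun ω =>
      sectionVol k (translate (-x) W) C (code (cellMeasure fun n => X n ω))) (codeLaw P X) P := by
    have hm := measurable_sectionVol_code k (translate (-x) W) C
    refine ⟨hm.aemeasurable, (hm.comp hcode).aemeasurable, ?_⟩
    rw [codeLaw, Measure.map_map hm hcode]
    rfl
  rw [var_sectionVol_translate hX hmot, var_eq_of_identDistrib h2]
  refine var_congr ?_
  filter_upwards [vol_facetUnion_inter_ae hX hmot hk hkd hfin hC] with ω hω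
  rw [hω, sectionVol, coe_translate_neg]

/-- The integral of the variances of the sections with all translates of a body is bounded by the
second moment of the section with the whole skeleton: one factor of the square is bounded by the
section with the whole skeleton, and the other one is integrated over all translations. -/
lemma lintegral_var_sectionVol_translate_le [IsProbabilityMeasure P]
    (hX : IsRandomTessellation P X)
    (hmot : IsMotionInvariant P X) (hkd : k < d) (hfin : sectionIntensity P X k < ∞)
    (W C : ConvexBody (Euc d)) :
    ∫⁻ x, var (codeLaw P X) (sectionVol k W (translate x C)) ≤
      (∫⁻ t, vol (k - 1) (codedSet d t ∩ skeleton k C) ^ 2 ∂(codeLaw P X)) *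
        volume (W : Set (Euc d)) := by
  have := isProbabilityMeasure_codeLaw (P := P) hX.measurable
  set Q := codeLaw P X
  have htrW : Measurable fun x : Euc d => translate (-x) W := by
    have h : Continuous fun x : Euc d => translate (-x) W :=
      continuous_translate.comp (continuous_neg.prodMk continuous_const)
    exact h.measurable
  have hm : Measurable fun q : Euc d × Code => sectionVol k (translate (-q.1) W) C q.2 := by
    have h2 : Measurable fun q : Euc d × Code => (translate (-q.1) W, C, q.2) :=
      (htrW.comp measurable_fst).prodMk (measurable_const.prodMk measurable_snd)
    have h := (measurable_sectionVol k).comp h2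
    exact h
  have hmC : Measurable fun t : Code => vol (k - 1) (codedSet d t ∩ skeleton k C) :=
    measurable_vol_codedSet_const (k - 1) (isCompact_skeleton k C)
  have hCC : ∀ t, sectionVol k C C t = vol (k - 1) (codedSet d t ∩ skeleton k C) := fun t => by
    rw [sectionVol, inter_eq_left.2 (skeleton_subset k C)]
  have hfinC : ∀ᵐ t ∂Q, vol (k - 1) (codedSet d t ∩ skeleton k C) < ∞ := by
    refine ae_lt_top hmC ?_
    have h := lintegral_sectionVol_ne_top hX hmot hkd hfin C C
    simpa only [hCC] using h
  have hint : ∀ᵐ t ∂Q, ∫⁻ x, sectionVol k (translate (-x) W) C t =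
      vol (k - 1) (codedSet d t ∩ skeleton k C) * volume (W : Set (Euc d)) := by
    filter_upwards [hfinC] with t ht
    have : IsFiniteMeasure ((Measure.euclideanHausdorffMeasure (k - 1) :
        Measure (Euc d)).restrict (codedSet d t ∩ skeleton k C)) :=
      ⟨by rw [Measure.restrict_apply_univ]; exact ht⟩
    have h := lintegral_measure_translate ((Measure.euclideanHausdorffMeasure (k - 1) :
      Measure (Euc d)).restrict (codedSet d t ∩ skeleton k C)) W.isClosed.measurableSet
    rw [Measure.restrict_apply_univ] at h
    refine Eq.trans (lintegral_congr fun x => ?_) h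
    rw [show {y : Euc d | y + x ∈ (W : Set (Euc d))} = translate (-x) W from
        (coe_translate_neg x W).symm,
      Measure.restrict_apply (translate (-x) W).isClosed.measurableSet, inter_comm, inter_assoc]
    rfl
  have hvar : ∀ x, var Q (sectionVol k W (translate x C)) ≤
      ∫⁻ t, sectionVol k (translate (-x) W) C t ^ 2 ∂Q := fun x => by
    rw [var_sectionVol_translate hX hmot k W C x,
      ← var_add_sq (measurable_sectionVol_code k (translate (-x) W) C).aemeasurable
        (lintegral_sectionVol_ne_top hX hmot hkd hfin (translate (-x) W) C)]
    exact le_self_add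
  calc ∫⁻ x, var Q (sectionVol k W (translate x C))
      ≤ ∫⁻ x, ∫⁻ t, vol (k - 1) (codedSet d t ∩ skeleton k C) *
          sectionVol k (translate (-x) W) C t ∂Q := by
        refine lintegral_mono fun x => (hvar x).trans (lintegral_mono fun t => ?_)
        rw [sq]
        gcongr
        exact vol_mono _ (inter_subset_inter_right _ inter_subset_left)
    _ = ∫⁻ t, ∫⁻ x, vol (k - 1) (codedSet d t ∩ skeleton k C) *
          sectionVol k (translate (-x) W) C t ∂volume ∂Q :=
        lintegral_lintegral_swap ((hmC.comp measurable_snd).mul hm).aemeasurable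
    _ = ∫⁻ t, vol (k - 1) (codedSet d t ∩ skeleton k C) ^ 2 * volume (W : Set (Euc d)) ∂Q := by
        refine lintegral_congr_ae (hint.mono fun t ht => ?_)
        change (∫⁻ x, vol (k - 1) (codedSet d t ∩ skeleton k C) *
          sectionVol k (translate (-x) W) C t) = _
        have hmt : Measurable fun x => sectionVol k (translate (-x) W) C t := by
          have h := hm.comp (measurable_prodMk_right (y := t))
          exact h
        rw [lintegral_const_mul _ hmt, ht]
        change _ = _ ^ 2 * _
        rw [sq, mul_assoc]
    _ = _ := lintegral_mul_const _ (hmC.pow_const 2)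

end Nesting
/-! ### Mean and variance of the section content -/

section Final

variable {d : ℕ} {Ω : Type*} [MeasurableSpace Ω] {P : Measure Ω} [IsProbabilityMeasure P]
  {X X₀ : ℕ → Ω → ConvexBody (Euc d)} {Y : ℕ → ℕ → Ω → ConvexBody (Euc d)}
  {α : ConvexBody (Euc d) → Euc d} {k m : ℕ}

lemma ConditionF.lintegral_vol_faceUnion_lt_top_iff (hF : ConditionF P X k m)
    (hX : IsRandomTessellation P X) (hstat : IsStationary P X) (hα : IsAssociatedPoint α)
    (hγ0 : cellIntensity P X α ≠ 0) (hγ : cellIntensity P X α ≠ ∞) (hk : 1 ≤ k) (hkd : k < d) :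
    facetIntensity P X k < ∞ ↔ ∫⁻ C, vol k (faceUnion k C) ∂(palmMark P X α) < ∞ := by
  have h := hF.mul_facetIntensity hX hstat hα hγ0 hγ hk hkd
  rw [lintegral_vol_faceUnion hX hα hk hkd]
  constructor
  · intro hfin
    have h1 : cellIntensity P X α * ∫⁻ C, vol k (skeleton k C) ∂(palmMark P X α) < ∞ :=
      h ▸ ENNReal.mul_lt_top (ENNReal.natCast_lt_top m) hfin
    exact ENNReal.lt_top_of_mul_ne_top_right h1.ne hγ0
  · intro hfin
    have h1 : m * facetIntensity P X k < ∞ := h ▸ ENNReal.mul_lt_top hγ.lt_top hfin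
    exact ENNReal.lt_top_of_mul_ne_top_right h1.ne hF.natCast_ne_zero

/-- The integrand on the right of the variance formula, with the law of the code. -/
lemma lintegral_var_section (hX : IsRandomTessellation P X) (hX₀ : IsRandomTessellation P X₀)
    (hmot : IsMotionInvariant P X₀) (hα : IsAssociatedPoint α) (hk : 1 ≤ k) (hkd : k < d)
    (hfin : sectionIntensity P X₀ k < ∞) (W : ConvexBody (Euc d)) :
    ∫⁻ C, ∫⁻ x, var P (fun ω => vol (k - 1) (facetUnion (d - 1) (fun n => X₀ n ω) ∩
        faceUnion k C ∩ {y | y + x ∈ W})) ∂volume ∂(palmMark P X α) =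
      ∫⁻ C, ∫⁻ x, var (codeLaw P X₀) (sectionVol k W (translate x C)) ∂volume
        ∂(palmMark P X α) :=
  lintegral_congr_ae ((ae_palmMark_isPolytope hX hα).mono fun _ hC =>
    lintegral_congr fun x => var_vol_facetUnion_inter hX₀ hmot hk hkd hfin hC W x)

lemma lintegral_var_section_lt_top (hX : IsRandomTessellation P X)
    (hX₀ : IsRandomTessellation P X₀)
    (hmot : IsMotionInvariant P X₀) (hα : IsAssociatedPoint α) (hk : 1 ≤ k) (hkd : k < d)
    (hfin : sectionIntensity P X₀ k < ∞)
    (h2 : ∫⁻ C, ∫⁻ ω, vol (k - 1) (facetUnion (d - 1) (fun n => X₀ n ω) ∩ faceUnion k C) ^ 2 ∂P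
      ∂(palmMark P X α) < ∞) (W : ConvexBody (Euc d)) :
    ∫⁻ C, ∫⁻ x, var (codeLaw P X₀) (sectionVol k W (translate x C)) ∂volume
      ∂(palmMark P X α) < ∞ := by
  have hle : ∫⁻ C, ∫⁻ x, var (codeLaw P X₀) (sectionVol k W (translate x C)) ∂volume
      ∂(palmMark P X α) ≤
      ∫⁻ C, (∫⁻ ω, vol (k - 1) (facetUnion (d - 1) (fun n => X₀ n ω) ∩ faceUnion k C) ^ 2 ∂P) *
        volume (W : Set (Euc d)) ∂(palmMark P X α) := by
    refine lintegral_mono_ae ((ae_palmMark_isPolytope hX hα).mono fun C hC => ?_)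
    refine (lintegral_var_sectionVol_translate_le hX₀ hmot hkd hfin W C).trans_eq ?_
    congr 1
    rw [codeLaw, lintegral_map
      ((measurable_vol_codedSet_const (k - 1) (isCompact_skeleton k C)).pow_const 2)
      (measurable_code_cellMeasure hX₀.measurable)]
    refine lintegral_congr_ae ((vol_facetUnion_inter_ae hX₀ hmot hk hkd hfin hC).mono fun ω hω => ?_)
    have h := hω univ
    simp only [inter_univ] at h
    simp only [h]
  refine hle.trans_lt ?_
  rw [lintegral_mul_const' _ _ W.isCompact.measure_lt_top.ne]
  exact ENNReal.mul_lt_top h2 W.isCompact.measure_lt_top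

theorem IsNesting.mean_Z (hnest : IsNesting P X X₀ Y) (hstat : IsStationary P X)
    (hmot : IsMotionInvariant P X₀) (hα : IsAssociatedPoint α)
    (hγ0 : cellIntensity P X α ≠ 0) (hγ : cellIntensity P X α ≠ ∞)
    (hk : 1 ≤ k) (hkd : k < d) (hF : ConditionF P X k m)
    (hfin : sectionIntensity P X₀ k < ∞) (W : ConvexBody (Euc d)) :
    ∫⁻ ω, Z X Y k W ω ∂P = sectionIntensity P X₀ k * m * facetIntensity P X k *
      volume (W : Set (Euc d)) := by
  rw [hnest.lintegral_Z hmot hk hkd hfin W,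
    lintegral_cellContent hnest.initial.measurable hstat hα hγ0 hγ hkd,
    ← hF.mul_facetIntensity hnest.initial hstat hα hγ0 hγ hk hkd]
  ring

theorem IsNesting.second_moment_Z (hnest : IsNesting P X X₀ Y) (hstat : IsStationary P X)
    (hmot : IsMotionInvariant P X₀) (hα : IsAssociatedPoint α)
    (hγ0 : cellIntensity P X α ≠ 0) (hγ : cellIntensity P X α ≠ ∞)
    (hk : 1 ≤ k) (hkd : k < d) (hF : ConditionF P X k m) (hμ : facetIntensity P X k < ∞)
    (hfin : sectionIntensity P X₀ k < ∞)
    (h1 : ∫⁻ ω, vol k (facetUnion k (fun n => X n ω) ∩ closedCube d) ^ 2 ∂P < ∞)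
    (h2 : ∫⁻ C, ∫⁻ ω, vol (k - 1) (facetUnion (d - 1) (fun n => X₀ n ω) ∩ faceUnion k C) ^ 2 ∂P
      ∂(palmMark P X α) < ∞) (W : ConvexBody (Euc d)) :
    ∫⁻ ω, Z X Y k W ω ^ 2 ∂P < ∞ ∧
      var P (Z X Y k W) =
        cellIntensity P X α * (∫⁻ C, ∫⁻ x, var P (fun ω => vol (k - 1)
          (facetUnion (d - 1) (fun n => X₀ n ω) ∩ faceUnion k C ∩
            {y | y + x ∈ W})) ∂volume ∂(palmMark P X α)) +
        (sectionIntensity P X₀ k * m) ^ 2 *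
          var P (fun ω => vol k (facetUnion k (fun n => X n ω) ∩ W)) := by
  have hX := hnest.initial
  have hm0 := hF.natCast_ne_zero
  have hmt : (m : ℝ≥0∞) ≠ ∞ := ENNReal.natCast_ne_top m
  have hcont := hF.ae_eq_of_facetIntensity_lt_top hX hstat hα hγ0 hγ hk hkd hμ
  -- `S B` is the face content of the tessellation in `B`, each facet counted once.
  set S : ConvexBody (Euc d) → Ω → ℝ≥0∞ := fun B ω =>
    vol k (facetUnion k (fun n => X n ω) ∩ B) with hS
  have hSm : AEMeasurable (S W) P := by
    refine ((measurable_cellContent hX.measurable k W).const_mul (m : ℝ≥0∞)⁻¹).aemeasurable.congr ?_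
    filter_upwards [hcont W] with ω hω
    rw [← hω, ← mul_assoc, ENNReal.inv_mul_cancel hm0 hmt, one_mul]
  have hsq : ∀ B, ∫⁻ ω, cellContent X k B ω ^ 2 ∂P = m ^ 2 * ∫⁻ ω, S B ω ^ 2 ∂P := fun B => by
    rw [← lintegral_const_mul' _ _ (ENNReal.pow_ne_top hmt)]
    refine lintegral_congr_ae ((hcont B).mono fun ω hω => ?_)
    change cellContent X k B ω ^ 2 = _
    rw [← hω, mul_pow]
  have hmean : ∫⁻ ω, cellContent X k W ω ∂P = m * ∫⁻ ω, S W ω ∂P := by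
    rw [← lintegral_const_mul' _ _ hmt]
    exact lintegral_congr_ae ((hcont W).mono fun ω hω => hω.symm)
  have hcube : closedCube d = cubeBody d 1 := by
    ext x
    simp [closedCube, mem_cubeBody]
  have hcontW : ∫⁻ ω, cellContent X k W ω ^ 2 ∂P < ∞ := by
    refine lintegral_cellContent_sq_lt_top hX.measurable hstat one_pos ?_ W
    rw [hsq]
    refine ENNReal.mul_lt_top (ENNReal.pow_lt_top hmt.lt_top) ?_
    simpa only [hcube] using h1
  have hvar : ∫⁻ ω, ∑' n, var (codeLaw P X₀) (sectionVol k W (X n ω)) ∂P =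
      cellIntensity P X α * (∫⁻ C, ∫⁻ x, var P (fun ω => vol (k - 1)
        (facetUnion (d - 1) (fun n => X₀ n ω) ∩ faceUnion k C ∩
          {y | y + x ∈ W})) ∂volume ∂(palmMark P X α)) := by
    rw [lintegral_var_section hX hnest.generic hmot hα hk hkd hfin W]
    exact campbell hX.measurable hstat hα hγ0 hγ
      (measurable_var_sectionVol hnest.generic hmot hkd hfin W)
  have hvarfin := lintegral_var_section_lt_top hX hnest.generic hmot hα hk hkd hfin h2 W
  rw [← lintegral_var_section hX hnest.generic hmot hα hk hkd hfin W] at hvarfin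
  have hZ2 := hnest.lintegral_Z_sq hmot hk hkd hfin W
  have hZ1 := hnest.lintegral_Z hmot hk hkd hfin W
  rw [hvar] at hZ2
  have hSfin : ∫⁻ ω, S W ω ∂P ≠ ∞ := by
    have h : m * ∫⁻ ω, S W ω ∂P ≠ ∞ := by
      rw [← hmean, lintegral_cellContent hX.measurable hstat hα hγ0 hγ hkd,
        ← hF.mul_facetIntensity hX hstat hα hγ0 hγ hk hkd]
      exact ENNReal.mul_ne_top (ENNReal.mul_ne_top hmt hμ.ne) W.isCompact.measure_lt_top.ne
    exact (ENNReal.lt_top_of_mul_ne_top_right h hm0).ne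
  rw [hmean] at hZ1
  have hZfin : ∫⁻ ω, Z X Y k W ω ∂P ≠ ∞ := by
    rw [hZ1]
    exact ENNReal.mul_ne_top hfin.ne (ENNReal.mul_ne_top hmt hSfin)
  refine ⟨?_, ?_⟩
  · rw [hZ2]
    exact ENNReal.add_lt_top.2 ⟨ENNReal.mul_lt_top (ENNReal.pow_lt_top hfin) hcontW,
      ENNReal.mul_lt_top hγ.lt_top hvarfin⟩
  · have hZm : AEMeasurable (Z X Y k W) P :=
      (hnest.measurable_tsum_sectionVol W).aemeasurable.congr
        (hnest.Z_ae_eq hmot hk hkd hfin W).symm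
    have hZv := var_add_sq hZm hZfin
    have hSv := var_add_sq hSm hSfin
    -- Both sides are compared after adding the square of the mean.
    refine (ENNReal.add_left_inj (ENNReal.pow_ne_top hZfin (n := 2))).1 ?_
    rw [hZv, hZ2, hsq, ← hSv, hZ1]
    ring

end Final

end Tess

theorem lemma3p1 {d : ℕ} {Ω : Type*} [MeasurableSpace Ω] (P : Measure Ω) [IsProbabilityMeasure P]
    (X X₀ : ℕ → Ω → ConvexBody (Euc d)) (Y : ℕ → ℕ → Ω → ConvexBody (Euc d))
    (hnest : Tess.IsNesting P X X₀ Y)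
    (hstat : Tess.IsStationary P X)
    (hmot : Tess.IsMotionInvariant P X₀)
    (α : ConvexBody (Euc d) → Euc d) (hα : Tess.IsAssociatedPoint α)
    (hγ_pos : 0 < Tess.cellIntensity P X α) (hγ_fin : Tess.cellIntensity P X α < ∞)
    (k m : ℕ) (hk : 1 ≤ k) (hkd : k < d)
    (hF : Tess.ConditionF P X k m) :
    -- the two finiteness conditions are equivalent
    (Tess.facetIntensity P X k < ∞ ↔
      ∫⁻ C, Tess.vol k (Tess.faceUnion k C) ∂(Tess.palmMark P X α) < ∞) ∧
    (Tess.facetIntensity P X k < ∞ → Tess.sectionIntensity P X₀ k < ∞ →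
      -- mean value formula
      (∀ W : ConvexBody (Euc d),
        AEMeasurable (Tess.Z X Y k W) P ∧
        ∫⁻ ω, Tess.Z X Y k W ω ∂P =
          Tess.sectionIntensity P X₀ k * m * Tess.facetIntensity P X k *
            volume (W : Set (Euc d))) ∧
      -- variance formula
      (∫⁻ ω, Tess.vol k (Tess.facetUnion k (fun n => X n ω) ∩ Tess.closedCube d) ^ 2 ∂P < ∞ →
        ∫⁻ C, ∫⁻ ω, Tess.vol (k - 1)
          (Tess.facetUnion (d - 1) (fun n => X₀ n ω) ∩ Tess.faceUnion k C) ^ 2 ∂P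
            ∂(Tess.palmMark P X α) < ∞ →
        ∀ W : ConvexBody (Euc d),
          ∫⁻ ω, Tess.Z X Y k W ω ^ 2 ∂P < ∞ ∧
          Tess.var P (Tess.Z X Y k W) =
            Tess.cellIntensity P X α *
              (∫⁻ C, ∫⁻ x, Tess.var P (fun ω => Tess.vol (k - 1)
                (Tess.facetUnion (d - 1) (fun n => X₀ n ω) ∩ Tess.faceUnion k C ∩
                  {y | y + x ∈ W})) ∂volume ∂(Tess.palmMark P X α)) +
            (Tess.sectionIntensity P X₀ k * m) ^ 2 *
              Tess.var P (fun ω =>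
                Tess.vol k (Tess.facetUnion k (fun n => X n ω) ∩ W)))) := by
  have hγ0 := hγ_pos.ne'
  have hγ := hγ_fin.ne
  refine ⟨hF.lintegral_vol_faceUnion_lt_top_iff hnest.initial hstat hα hγ0 hγ hk hkd,
    fun hμ hfin => ⟨fun W => ⟨?_, hnest.mean_Z hstat hmot hα hγ0 hγ hk hkd hF hfin W⟩,
      fun h1 h2 W => hnest.second_moment_Z hstat hmot hα hγ0 hγ hk hkd hF hμ hfin h1 h2 W⟩⟩
  exact (hnest.measurable_tsum_sectionVol W).aemeasurable.congr
    (hnest.Z_ae_eq hmot hk hkd hfin W).symm
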